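/- Write $\langle v\rangle=(1+|v|^2)^{1/2}$ for $v\in\mathbb{R}^3$ and $x_+=\max(x,0)$. For $g:\mathbb{R}^3\to\mathbb{R}$ set $$A[g]=\frac{\Pi(v)}{8\pi|v|}*g,\qquad a[g]=\frac{1}{4\pi|v|}*g,\qquad \Pi(v)=\mathrm{Id}-\frac{v\otimes v}{|v|^2}.$$ Let $c_0>0$. There are constants $\varepsilon_0>0$ and $C^*>0$, depending only on $c_0$, such that the following holds. Let $T>0$ and let $f:[0,T]\times\mathbb{R}^3\to[0,\infty)$ be a smooth, rapidly decaying solution of the Landau equation with Coulomb potential $$\partial_t f=\nabla\cdot\big(A[f]\nabla f-f\,\nabla a[f]\big),$$ where rapidly decaying means that $\sup_{t\in[0,T],\,v\in\mathbb{R}^3}|v|^k|\partial_v^{\alpha}f(t,v)|<\infty$ for all $k\in\mathbb{N}$ and all multi-indices $\alpha$. Suppose that the initial datum $f_{in}=f(0,\cdot)$ satisfies $$\int_{\mathbb{R}^3}f_{in}\,dv=1,\qquad \int_{\mathbb{R}^3}v f_{in}\,dv=0,\qquad \int_{\mathbb{R}^3}|v|^2f_{in}\,dv=3,$$ and that $A[f(t)](v)\ge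 c_0\langle v\rangle^{-3}\,\mathrm{Id}$ as symmetric matrices for all $(t,v)\in[0,T]\times\mathbb{R}^3$. Let $K\ge 0$ be such that $$\varepsilon(f):=\sup_{0<\tau<T}\int_{\mathbb{R}^3}\langle v\rangle^{9/2}(f(\tau,v)-K)_+^{3/2}\,dv+\int_0^T\!\!\int_{\mathbb{R}^3}\langle v\rangle^{3/2}\big|\nabla (f(\tau,v)-K)_+^{3/4}\big|^2\,dv\,d\tau<\varepsilon_0 .$$ Then for every $0<t\le T$, $$f(\tau,v)\le C^*(K+1)+C^*\,\varepsilon(f)^{2/3}\,t^{-1}\qquad\text{for all }(\tau,v)\in[t,T]\times\mathbb{R}^3 .$$ -/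

import Mathlib

open MeasureTheory Set
open scoped ENNReal ContDiff

noncomputable section

namespace LandauCoulomb

/-- Velocity space, three-dimensional Euclidean space. -/
abbrev E3 : Type := EuclideanSpace ℝ (Fin 3)

/-- The Japanese bracket of `v`, i.e. the square root of `1 + |v|^2`. -/
def bracket (v : E3) : ℝ := Real.sqrt (1 + ‖v‖ ^ 2)

/-- The matrix kernel `Π(z) / (8 π |z|)` where `Π(z) = Id - z ⊗ z / |z|^2`. -/
def kernelA (z : E3) : Matrix (Fin 3) (Fin 3) ℝ :=
  (8 * Real.pi * ‖z‖)⁻¹ • (1 - (‖z‖ ^ 2)⁻¹ • Matrix.of fun i j => z i * z j)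

/-- The diffusion matrix `A[g]`, the (entrywise) convolution of `Π(z) / (8 π |z|)` with `g`. -/
def coeffA (g : E3 → ℝ) (v : E3) : Matrix (Fin 3) (Fin 3) ℝ :=
  Matrix.of fun i j => ∫ w, kernelA (v - w) i j * g w

/-- The scalar coefficient `a[g]`, the convolution of `1 / (4 π |z|)` with `g`. -/
def coeffa (g : E3 → ℝ) (v : E3) : ℝ :=
  ∫ w, (4 * Real.pi * ‖v - w‖)⁻¹ * g w

/-- The flux `A[g] ∇g - g ∇a[g]`. -/
def flux (g : E3 → ℝ) (v : E3) : E3 :=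
  Matrix.toEuclideanLin (coeffA g v) (gradient g v) - g v • gradient (coeffa g) v

/-- The divergence of a vector field. -/
def divergence (F : E3 → E3) (v : E3) : ℝ :=
  ∑ i : Fin 3, (fderiv ℝ F v (EuclideanSpace.single i 1)) i

/-- `f : [0,T] × ℝ³ → [0,∞)` is a smooth, rapidly decaying solution of the Landau equation with
Coulomb potential: it is smooth up to the boundary in time, all its velocity derivatives decay
faster than any power of `|v|` uniformly in time (a Schwartz class solution), and the equation
holds pointwise. Values of `f` at times outside `[0,T]` play no role. -/
structure IsSmoothDecayingSolution (T : ℝ) (f : ℝ → E3 → ℝ) : Prop where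
  nonneg : ∀ t ∈ Icc 0 T, ∀ v, 0 ≤ f t v
  smooth : ContDiffOn ℝ ∞ (fun p : ℝ × E3 => f p.1 p.2) (Icc 0 T ×ˢ univ)
  decay : ∀ k n : ℕ, ∃ C : ℝ, ∀ t ∈ Icc 0 T, ∀ v,
    ‖v‖ ^ k * ‖iteratedFDeriv ℝ n (f t) v‖ ≤ C
  equation : ∀ t ∈ Ioo 0 T, ∀ v,
    deriv (fun s => f s v) t = divergence (flux (f t)) v

/-- Normalisation: nonnegative, with mass `1`, momentum `0` and second moment `3`. -/
structure IsNormalised (g : E3 → ℝ) : Prop where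
  nonneg : ∀ v, 0 ≤ g v
  mass : ∫ v, g v = 1
  momentum : ∫ v, g v • v = 0
  energy : ∫ v, ‖v‖ ^ 2 * g v = 3

/-- The truncation `(g - K)_+`. -/
def levelPart (K : ℝ) (g : E3 → ℝ) (v : E3) : ℝ := max (g v - K) 0

/-- The control quantity: the supremum over `0 < τ < T` of the integral of
`⟨v⟩^(9/2) (f(τ) - K)_+^(3/2)`, plus the integral over `(0,T) × ℝ³` of
`⟨v⟩^(3/2) |∇ (f(τ) - K)_+^(3/4)|^2`, with values in `[0,∞]`.
For smooth `f(τ)` the gradient exists in the classical sense outside the null set where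
`f(τ) = K` and `∇f(τ) ≠ 0`, and it is then also the weak gradient. -/
def criticalEnergy (K T : ℝ) (f : ℝ → E3 → ℝ) : ℝ≥0∞ :=
  (⨆ τ ∈ Ioo 0 T, ∫⁻ v,
    ENNReal.ofReal (bracket v ^ (9 / 2 : ℝ) * levelPart K (f τ) v ^ (3 / 2 : ℝ)))
  + ∫⁻ τ in Ioo 0 T, ∫⁻ v,
    ENNReal.ofReal (bracket v ^ (3 / 2 : ℝ) *
      ‖gradient (fun w => levelPart K (f τ) w ^ (3 / 4 : ℝ)) v‖ ^ 2)

end LandauCoulomb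

end

/-!
The bound is obtained by a De Giorgi iteration with the weighted energies
`Y_ℓ(t) = ∫ ⟨v⟩^(9/2) (f(t) - ℓ)_+^(5/2)`.

The equation is tested with `⟨v⟩^(9/2) (f - ℓ)_+^(3/2)`. By the lower bound `A[f] ≥ c₀ ⟨v⟩⁻³` the
diffusion produces the dissipation `∫ ⟨v⟩^(3/2) (f - ℓ)_+^(1/2) |∇f|²`, and this controls
`U_ℓ = (∫ ⟨v⟩^(9/2) (f - ℓ)_+^(15/2))^(1/3)` through the Sobolev inequality in `ℝ³`. The drift is
integrated by parts with the Poisson equation for `a[f]` (`divergence_gradient_coeffa`). What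
remains is `∫ ⟨v⟩^(9/2) (f - ℓ)_+^(7/2)` and an error produced by the gradient of the weight, of the
form `∫ ⟨v⟩^(9/2) (f - ℓ)_+^(5/2) (k * f)` with `k = |z|⁻² 1_{|z| < 1} + 1`. By Hölder's inequality
both are at most a power of `∫ ⟨v⟩^(9/2) (f - K)_+^(3/2)` times `U_ℓ`, up to terms of lower order,
so that the smallness of the critical energy absorbs them. The result is the differential inequality
`Y_ℓ' + c U_ℓ ≤ C (ℓ Y_ℓ + ℓ² ∫ ⟨v⟩^(9/2) (f - ℓ)_+^(3/2))` of `exists_energy_inequality`.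

Integrating it against a linear weight in time (`integrate_differential_inequality`) removes the
initial value. Chebyshev's inequality between two levels and the interpolation
`∫ ⟨v⟩^(9/2) (f - ℓ)_+^(25/6) ≤ U_ℓ Y_ℓ^(2/3)` then turn an energy bound `E` at one level into a
multiple of `E^(5/3)` at a higher one (`IsSmoothDecayingSolution.energyBound_step`). Along levels of
size `M` the iteration converges as soon as `(1 / r + M) M^(-5/3) E^(2/3)` is small, where `r` is the
length of the time interval (`IsSmoothDecayingSolution.le_of_energyBound`).

The starting value comes from the critical energy `ε`: Sobolev's inequality for
`⟨v⟩^(3/4) (f - K)_+^(3/4)` and Hölder's inequality bound the time integral of `Y_ℓ` by a multiple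
of `ε^(5/3)` (`exists_integral_energy_le`). With `M = K + 1 + N ε^(2/3) / r`, the constant `N` large
and `ε` small, the smallness condition holds, and `f ≤ 4 M` at the end of the time interval.
-/

namespace LandauCoulomb

open Filter Topology
open scoped RealInnerProductSpace SchwartzMap

/-! ### Truncated powers and weights -/

/-- The truncated power `x_+ ^ r`. -/
noncomputable def posPow (r x : ℝ) : ℝ := max x 0 ^ r

lemma posPow_nonneg (r x : ℝ) : 0 ≤ posPow r x := Real.rpow_nonneg (le_max_right _ _) _

lemma posPow_of_nonneg {r x : ℝ} (hx : 0 ≤ x) : posPow r x = x ^ r := by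
  simp [posPow, max_eq_left hx]

lemma posPow_of_nonpos {r x : ℝ} (hr : r ≠ 0) (hx : x ≤ 0) : posPow r x = 0 := by
  simp [posPow, max_eq_right hx, Real.zero_rpow hr]

lemma continuous_posPow {r : ℝ} (hr : 0 ≤ r) : Continuous (posPow r) := by
  unfold posPow
  exact (continuous_id.max continuous_const).rpow_const fun _ => Or.inr hr

lemma posPow_add {r s : ℝ} (hr : 0 < r) (hs : 0 < s) (x : ℝ) :
    posPow r x * posPow s x = posPow (r + s) x := by
  unfold posPow
  rw [Real.rpow_add_of_nonneg (le_max_right _ _) hr.le hs.le]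

lemma posPow_rpow (r s x : ℝ) : posPow r x ^ s = posPow (r * s) x := by
  unfold posPow
  rw [Real.rpow_mul (le_max_right _ _)]

lemma hasDerivAt_posPow {r : ℝ} (hr : 1 < r) (x : ℝ) :
    HasDerivAt (posPow r) (r * posPow (r - 1) x) x := by
  have hr1 : r - 1 ≠ 0 := by linarith
  have hr0 : r ≠ 0 := by linarith
  rcases lt_trichotomy x 0 with hx | hx | hx
  · rw [posPow_of_nonpos hr1 hx.le, mul_zero]
    refine (hasDerivAt_const x (0 : ℝ)).congr_of_eventuallyEq ?_
    filter_upwards [Iio_mem_nhds hx] with y hy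
    exact posPow_of_nonpos hr0 (le_of_lt hy)
  · subst hx
    have h1 : HasDerivWithinAt (posPow r) (r * posPow (r - 1) 0) (Ici 0) 0 := by
      have := (Real.hasDerivAt_rpow_const (x := 0) (p := r) (Or.inr hr.le)).hasDerivWithinAt
        (s := Ici 0)
      rw [posPow_of_nonneg le_rfl]
      exact this.congr (fun y hy => posPow_of_nonneg hy) (posPow_of_nonneg le_rfl)
    have h2 : HasDerivWithinAt (posPow r) (r * posPow (r - 1) 0) (Iic 0) 0 := by
      rw [posPow_of_nonpos hr1 le_rfl, mul_zero]
      exact (hasDerivWithinAt_const 0 (Iic 0) (0 : ℝ)).congr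
        (fun y hy => posPow_of_nonpos hr0 hy) (posPow_of_nonpos hr0 le_rfl)
    have := h1.union h2
    rwa [Ici_union_Iic, hasDerivWithinAt_univ] at this
  · rw [posPow_of_nonneg hx.le]
    refine (Real.hasDerivAt_rpow_const (Or.inr hr.le)).congr_of_eventuallyEq ?_
    filter_upwards [Ioi_mem_nhds hx] with y hy
    exact posPow_of_nonneg (le_of_lt hy)

lemma contDiff_posPow {r : ℝ} (hr : 1 < r) : ContDiff ℝ 1 (posPow r) := by
  rw [contDiff_one_iff_deriv]
  refine ⟨fun x => (hasDerivAt_posPow hr x).differentiableAt, ?_⟩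
  have : deriv (posPow r) = fun x => r * posPow (r - 1) x :=
    funext fun x => (hasDerivAt_posPow hr x).deriv
  rw [this]
  exact continuous_const.mul (continuous_posPow (by linarith))

lemma bracket_sq (v : E3) : bracket v ^ 2 = 1 + ‖v‖ ^ 2 := by
  unfold bracket; exact Real.sq_sqrt (by positivity)

lemma bracket_pos (v : E3) : 0 < bracket v := by unfold bracket; positivity

lemma one_le_bracket (v : E3) : 1 ≤ bracket v := by
  unfold bracket; rw [Real.one_le_sqrt]; nlinarith [sq_nonneg ‖v‖]

lemma norm_le_bracket (v : E3) : ‖v‖ ≤ bracket v := by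
  unfold bracket; exact Real.le_sqrt_of_sq_le (by linarith)

lemma bracket_rpow_eq (v : E3) (r : ℝ) : bracket v ^ r = (1 + ‖v‖ ^ 2) ^ (r / 2) := by
  unfold bracket
  rw [Real.sqrt_eq_rpow, ← Real.rpow_mul (by positivity)]
  ring_nf

lemma contDiff_bracket_rpow (r : ℝ) : ContDiff ℝ ∞ fun v : E3 => bracket v ^ r := by
  simp_rw [bracket_rpow_eq]
  exact (contDiff_const.add (contDiff_norm_sq ℝ)).rpow_const_of_ne fun v => by positivity

lemma continuous_bracket_rpow (r : ℝ) : Continuous fun v : E3 => bracket v ^ r :=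
  (contDiff_bracket_rpow r).continuous

/-! ### Gradients, integration by parts and the Sobolev inequality -/

lemma hasGradientAt_mul {f g : E3 → ℝ} {f' g' x : E3} (hf : HasGradientAt f f' x)
    (hg : HasGradientAt g g' x) :
    HasGradientAt (fun y => f y * g y) (f x • g' + g x • f') x := by
  rw [hasGradientAt_iff_hasFDerivAt] at *
  exact (hf.mul hg).congr_fderiv (by ext; simp)

lemma hasGradientAt_comp {β : ℝ → ℝ} {b : ℝ} {f : E3 → ℝ} {f' x : E3}
    (hβ : HasDerivAt β b (f x)) (hf : HasGradientAt f f' x) :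
    HasGradientAt (fun y => β (f y)) (b • f') x := by
  rw [hasGradientAt_iff_hasFDerivAt] at *
  exact (hβ.comp_hasFDerivAt x hf).congr_fderiv (by ext; simp)

lemma hasGradientAt_bracket_rpow (r : ℝ) (v : E3) :
    HasGradientAt (fun v : E3 => bracket v ^ r) ((r * bracket v ^ (r - 2)) • v) v := by
  simp_rw [bracket_rpow_eq]
  have h1 : HasGradientAt (fun v : E3 => 1 + ‖v‖ ^ 2) ((2 : ℝ) • v) v := by
    rw [hasGradientAt_iff_hasFDerivAt]
    exact ((hasStrictFDerivAt_norm_sq v).hasFDerivAt.const_add 1).congr_fderiv (by ext; simp)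
  have h2 : HasDerivAt (fun x : ℝ => x ^ (r / 2)) ((r / 2) * (1 + ‖v‖ ^ 2) ^ (r / 2 - 1))
      (1 + ‖v‖ ^ 2) :=
    Real.hasDerivAt_rpow_const (Or.inl (by positivity))
  convert hasGradientAt_comp h2 h1 using 1
  rw [smul_smul]
  congr 1
  rw [show (r - 2) / 2 = r / 2 - 1 by ring]
  ring

lemma norm_gradient_bracket_rpow_le (r : ℝ) (v : E3) :
    ‖(r * bracket v ^ (r - 2)) • v‖ ≤ |r| * bracket v ^ (r - 1) := by
  rw [norm_smul, Real.norm_eq_abs, abs_mul, abs_of_pos (Real.rpow_pos_of_pos (bracket_pos v) _),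
    mul_assoc]
  refine mul_le_mul_of_nonneg_left ?_ (abs_nonneg _)
  calc bracket v ^ (r - 2) * ‖v‖ ≤ bracket v ^ (r - 2) * bracket v ^ (1 : ℝ) := by
        rw [Real.rpow_one]
        exact mul_le_mul_of_nonneg_left (norm_le_bracket v)
          (Real.rpow_nonneg (bracket_pos v).le _)
    _ = bracket v ^ (r - 1) := by
        rw [← Real.rpow_add (bracket_pos v)]; ring_nf

lemma gradient_apply (f : E3 → ℝ) (v : E3) (i : Fin 3) :
    gradient f v i = fderiv ℝ f v (EuclideanSpace.single i 1) := by
  rw [← inner_gradient_left, EuclideanSpace.inner_single_right]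
  simp

lemma contDiff_gradient {f : E3 → ℝ} {m n : WithTop ℕ∞} (hf : ContDiff ℝ n f) (h : m + 1 ≤ n) :
    ContDiff ℝ m (gradient f) :=
  (InnerProductSpace.toDual ℝ E3).symm.contDiff.comp (hf.fderiv_right h)

lemma continuous_gradient {f : E3 → ℝ} (hf : ContDiff ℝ 1 f) : Continuous (gradient f) :=
  (contDiff_gradient (m := 0) hf (by simp)).continuous

lemma hasGradientAt_of_contDiff {f : E3 → ℝ} (hf : ContDiff ℝ 1 f) (v : E3) :
    HasGradientAt f (gradient f v) v :=
  ((hf.differentiable (by simp)) v).hasGradientAt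

lemma hasCompactSupport_gradient {f : E3 → ℝ} (hf : HasCompactSupport f) :
    HasCompactSupport (gradient f) :=
  (hf.fderiv ℝ).comp_left (g := (InnerProductSpace.toDual ℝ E3).symm) (map_zero _)

lemma norm_gradient (f : E3 → ℝ) (v : E3) : ‖gradient f v‖ = ‖fderiv ℝ f v‖ := by
  simp [gradient]

/-- The divergence theorem, tested against a compactly supported function. -/
lemma integral_mul_divergence {ψ : E3 → ℝ} {F : E3 → E3} (hψ : ContDiff ℝ 1 ψ)
    (hψc : HasCompactSupport ψ) (hF : ContDiff ℝ 1 F) :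
    ∫ v, ψ v * divergence F v = -∫ v, ⟪gradient ψ v, F v⟫ := by
  have hFi (i : Fin 3) : ContDiff ℝ 1 fun v => F v i :=
    (contDiff_piLp_apply (p := 2)).comp hF
  have hd (i : Fin 3) (v : E3) : (fderiv ℝ F v (EuclideanSpace.single i 1)) i
      = fderiv ℝ (fun v => F v i) v (EuclideanSpace.single i 1) := by
    have h := ((EuclideanSpace.proj (𝕜 := ℝ) i).hasFDerivAt.comp v
      ((hF.differentiable (by simp)) v).hasFDerivAt).fderiv
    have h2 : (fun v => F v i) = (EuclideanSpace.proj (𝕜 := ℝ) i) ∘ F := by ext; simp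
    rw [h2, h]; simp
  have hψ' := (hψ.continuous_fderiv (by simp))
  have hc1 (i : Fin 3) : Continuous fun v => fderiv ℝ ψ v (EuclideanSpace.single i 1) :=
    hψ'.clm_apply continuous_const
  have hs1 (i : Fin 3) : HasCompactSupport fun v => fderiv ℝ ψ v (EuclideanSpace.single i 1) :=
    (hψc.fderiv ℝ).comp_left (g := fun L : E3 →L[ℝ] ℝ => L (EuclideanSpace.single i 1)) (by simp)
  have hc2 (i : Fin 3) : Continuous fun v =>
      fderiv ℝ (fun v => F v i) v (EuclideanSpace.single i 1) :=
    ((hFi i).continuous_fderiv (by simp)).clm_apply continuous_const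
  have hi1 (i : Fin 3) : Integrable fun v =>
      fderiv ℝ ψ v (EuclideanSpace.single i 1) * F v i :=
    ((hc1 i).mul (hFi i).continuous).integrable_of_hasCompactSupport (hs1 i).mul_right
  have hi2 (i : Fin 3) : Integrable fun v =>
      ψ v * fderiv ℝ (fun v => F v i) v (EuclideanSpace.single i 1) :=
    (hψ.continuous.mul (hc2 i)).integrable_of_hasCompactSupport hψc.mul_right
  have hi3 (i : Fin 3) : Integrable fun v => ψ v * F v i :=
    (hψ.continuous.mul (hFi i).continuous).integrable_of_hasCompactSupport hψc.mul_right
  have key (i : Fin 3) := integral_mul_fderiv_eq_neg_fderiv_mul_of_integrable (hi1 i) (hi2 i)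
    (hi3 i) (fun x _ => (hψ.differentiable (by simp)) x)
    (fun x _ => ((hFi i).differentiable (by simp)) x)
  have e1 : (fun v => ψ v * divergence F v) = fun v => ∑ i : Fin 3,
      ψ v * fderiv ℝ (fun v => F v i) v (EuclideanSpace.single i 1) := by
    ext v; simp only [divergence, Finset.mul_sum, hd]
  have e2 : (fun v => ⟪gradient ψ v, F v⟫) = fun v => ∑ i : Fin 3,
      fderiv ℝ ψ v (EuclideanSpace.single i 1) * F v i := by
    ext v
    rw [PiLp.inner_apply]
    refine Finset.sum_congr rfl fun i _ => ?_
    rw [← gradient_apply]; simp [mul_comm]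
  rw [e1, e2, integral_finsetSum _ fun i _ => hi2 i, integral_finsetSum _ fun i _ => hi1 i,
    ← Finset.sum_neg_distrib]
  exact Finset.sum_congr rfl fun i _ => key i

/-- The Sobolev inequality `‖u‖_{L⁶}² ≤ S ‖∇u‖_{L²}²` in `ℝ³`. -/
lemma exists_sobolev : ∃ S : ℝ, 0 < S ∧ ∀ u : E3 → ℝ, ContDiff ℝ 1 u → HasCompactSupport u →
    (∫ v, |u v| ^ 6) ^ (1 / 3 : ℝ) ≤ S * ∫ v, ‖gradient u v‖ ^ 2 := by
  set C := SNormLESNormFDerivOfEqConst ℝ (volume : Measure E3) ((2 : NNReal) : ℝ)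
  refine ⟨(C : ℝ) ^ 2 + 1, by positivity, fun u hu huc => ?_⟩
  have hfr : Module.finrank ℝ E3 = 3 := by simp
  have h := eLpNorm_le_eLpNorm_fderiv_of_eq (volume : Measure E3) hu huc (p := 2) (p' := 6)
    (by norm_num) (by simp) (by rw [hfr]; norm_num)
  have m1 : MemLp u 6 := hu.continuous.memLp_of_hasCompactSupport huc
  have m2 : MemLp (fderiv ℝ u) 2 :=
    (hu.continuous_fderiv (by simp)).memLp_of_hasCompactSupport (huc.fderiv ℝ)
  have e1 : (eLpNorm u 6 volume).toReal = (∫ v, |u v| ^ 6) ^ (1 / 6 : ℝ) := by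
    rw [MemLp.eLpNorm_eq_integral_rpow_norm (by simp) (by simp) m1,
      ENNReal.toReal_ofReal (by positivity)]
    norm_num
  have e2 : (eLpNorm (fderiv ℝ u) 2 volume).toReal = (∫ v, ‖gradient u v‖ ^ 2) ^ (1 / 2 : ℝ) := by
    rw [MemLp.eLpNorm_eq_integral_rpow_norm (by simp) (by simp) m2,
      ENNReal.toReal_ofReal (by positivity)]
    simp_rw [norm_gradient]
    norm_num
  have h3 : (∫ v, |u v| ^ 6) ^ (1 / 6 : ℝ) ≤ C * (∫ v, ‖gradient u v‖ ^ 2) ^ (1 / 2 : ℝ) := by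
    rw [← e1, ← e2]
    have := ENNReal.toReal_mono (ENNReal.mul_ne_top ENNReal.coe_ne_top m2.eLpNorm_ne_top) h
    simp only [ENNReal.toReal_mul, ENNReal.coe_toReal] at this
    exact this
  have n1 : 0 ≤ ∫ v, |u v| ^ 6 := integral_nonneg fun v => by positivity
  have n2 : 0 ≤ ∫ v, ‖gradient u v‖ ^ 2 := integral_nonneg fun v => by positivity
  have h4 := pow_le_pow_left₀ (by positivity) h3 2
  have a1 : ((∫ v, |u v| ^ 6) ^ (1 / 6 : ℝ)) ^ 2 = (∫ v, |u v| ^ 6) ^ (1 / 3 : ℝ) := by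
    rw [← Real.rpow_natCast, ← Real.rpow_mul n1]; norm_num
  have a2 : ((∫ v, ‖gradient u v‖ ^ 2) ^ (1 / 2 : ℝ)) ^ 2 = ∫ v, ‖gradient u v‖ ^ 2 := by
    rw [← Real.rpow_natCast, ← Real.rpow_mul n2]; norm_num
  rw [a1, mul_pow, a2] at h4
  nlinarith

/-! ### Convolution with weakly singular kernels -/

/-- The part `|z|⁻² 1_{|z| < 1}` of the Coulomb force kernel near its singularity. -/
noncomputable def nearKernel (z : E3) : ℝ :=
  (Metric.ball (0 : E3) 1).indicator (fun z => (‖z‖ ^ 2)⁻¹) z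

lemma nearKernel_nonneg (z : E3) : 0 ≤ nearKernel z :=
  indicator_nonneg (fun _ _ => by positivity) z

lemma measurable_nearKernel : Measurable nearKernel :=
  Measurable.indicator (by fun_prop) Metric.isOpen_ball.measurableSet

lemma integrable_nearKernel : Integrable nearKernel := by
  have hfr : Module.finrank ℝ E3 = 3 := by simp
  unfold nearKernel
  rw [integrable_indicator_iff Metric.isOpen_ball.measurableSet]
  refine integrableOn_ball_of_norm_le_rpow (C := 1) (α := 2) (by rw [hfr]; norm_num)
    (by rw [hfr]; norm_num) (ae_of_all _ fun z => ?_)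
    (Measurable.aestronglyMeasurable (by fun_prop))
  rw [one_mul, Real.rpow_neg (norm_nonneg z)]
  simp

lemma inv_norm_sq_le (z : E3) : (‖z‖ ^ 2)⁻¹ ≤ nearKernel z + 1 := by
  unfold nearKernel
  by_cases hz : z ∈ Metric.ball (0 : E3) 1
  · rw [indicator_of_mem hz]; linarith
  · rw [indicator_of_notMem hz, zero_add]
    rw [mem_ball_zero_iff, not_lt] at hz
    exact inv_le_one_of_one_le₀ (one_le_pow₀ hz)

lemma inv_norm_le (z : E3) : ‖z‖⁻¹ ≤ nearKernel z + 1 := by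
  rcases le_or_gt 1 ‖z‖ with h | h
  · exact (inv_le_one_of_one_le₀ h).trans (by linarith [nearKernel_nonneg z])
  · refine le_trans ?_ (inv_norm_sq_le z)
    rcases eq_or_lt_of_le (norm_nonneg z) with h0 | h0
    · simp [← h0]
    · exact inv_anti₀ (by positivity) (by nlinarith)

/-- Functions of size `O((1 + |x|)⁻⁴)`; these are bounded and integrable on `ℝ³`. -/
def FourthOrderDecay {F : Type*} [NormedAddCommGroup F] (G : E3 → F) : Prop :=
  ∃ C : ℝ, 0 ≤ C ∧ ∀ x, ‖G x‖ ≤ C * (1 + ‖x‖) ^ (-4 : ℝ)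

section Decay
variable {F : Type*} [NormedAddCommGroup F]

lemma integrable_one_add_norm_neg_four : Integrable fun x : E3 => (1 + ‖x‖) ^ (-4 : ℝ) :=
  integrable_one_add_norm (by simp; norm_num)

lemma one_add_norm_neg_four_le_one (x : E3) : (1 + ‖x‖) ^ (-4 : ℝ) ≤ 1 :=
  Real.rpow_le_one_of_one_le_of_nonpos (by linarith [norm_nonneg x]) (by norm_num)

lemma one_add_norm_neg_four_shift (x y : E3) :
    (1 + ‖x‖) ^ (-4 : ℝ) ≤ (1 + ‖x - y‖) ^ 4 * (1 + ‖y‖) ^ (-4 : ℝ) := by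
  have h1 : 1 + ‖y‖ ≤ (1 + ‖x - y‖) * (1 + ‖x‖) := by
    have : ‖y‖ ≤ ‖x‖ + ‖x - y‖ := by
      simpa [norm_sub_rev] using norm_sub_le x (x - y)
    nlinarith [norm_nonneg x, norm_nonneg (x - y), mul_nonneg (norm_nonneg x) (norm_nonneg (x - y))]
  have e (z : E3) : (1 + ‖z‖) ^ (-4 : ℝ) = ((1 + ‖z‖) ^ 4)⁻¹ := by
    rw [Real.rpow_neg (by positivity)]; norm_cast
  rw [e, e, ← div_eq_mul_inv, le_div_iff₀ (by positivity), ← div_eq_inv_mul,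
    div_le_iff₀ (by positivity), ← mul_pow]
  exact pow_le_pow_left₀ (by positivity) h1 4

lemma FourthOrderDecay.exists_bound {G : E3 → F} (h : FourthOrderDecay G) :
    ∃ C, ∀ x, ‖G x‖ ≤ C := by
  obtain ⟨C, hC, h⟩ := h
  exact ⟨C, fun x => (h x).trans (mul_le_of_le_one_right hC (one_add_norm_neg_four_le_one x))⟩

lemma FourthOrderDecay.integrable {G : E3 → F} (h : FourthOrderDecay G) (hG : Continuous G) :
    Integrable G := by
  obtain ⟨C, _, h⟩ := h
  exact (integrable_one_add_norm_neg_four.const_mul C).mono' hG.aestronglyMeasurable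
    (ae_of_all _ h)

lemma FourthOrderDecay.comp_sub {G : E3 → F} (h : FourthOrderDecay G) (v : E3) :
    FourthOrderDecay fun z => G (v - z) := by
  obtain ⟨C, hC, h⟩ := h
  refine ⟨C * (1 + ‖v‖) ^ 4, by positivity, fun z => (h _).trans ?_⟩
  rw [mul_assoc]
  refine mul_le_mul_of_nonneg_left ?_ hC
  have := one_add_norm_neg_four_shift (v - z) (-z)
  simpa using this

lemma FourthOrderDecay.mono {F' : Type*} [NormedAddCommGroup F'] {G : E3 → F} {G' : E3 → F'}
    (h : FourthOrderDecay G) {c : ℝ} (h' : ∀ x, ‖G' x‖ ≤ c * ‖G x‖) : FourthOrderDecay G' := by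
  obtain ⟨C, hC, h⟩ := h
  refine ⟨|c| * C, by positivity, fun x => (h' x).trans ?_⟩
  calc c * ‖G x‖ ≤ |c| * ‖G x‖ := by gcongr; exact le_abs_self c
    _ ≤ |c| * (C * (1 + ‖x‖) ^ (-4 : ℝ)) := by gcongr; exact h x
    _ = _ := by ring

lemma fourthOrderDecay_schwartz [NormedSpace ℝ F] (g : 𝓢(E3, F)) : FourthOrderDecay g := by
  refine ⟨2 ^ 4 * ((Finset.Iic (4, 0)).sup fun m => SchwartzMap.seminorm ℝ m.1 m.2) g,
    by positivity, fun x => ?_⟩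
  have h := SchwartzMap.one_add_le_sup_seminorm_apply (𝕜 := ℝ) (m := (4, 0)) (k := 4) (n := 0)
    le_rfl le_rfl g x
  rw [norm_iteratedFDeriv_zero] at h
  rw [Real.rpow_neg (by positivity), ← div_eq_mul_inv, le_div_iff₀ (by positivity), mul_comm]
  exact_mod_cast h

/-- Kernels with at most a `|z|⁻²` singularity, bounded away from the origin. -/
structure WeaklySingular (κ : E3 → ℝ) : Prop where
  measurable : Measurable κ
  bound : ∃ C : ℝ, 0 ≤ C ∧ ∀ z, |κ z| ≤ C * (nearKernel z + 1)

lemma WeaklySingular.const_mul {κ : E3 → ℝ} (h : WeaklySingular κ) (c : ℝ) :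
    WeaklySingular fun z => c * κ z := by
  obtain ⟨hm, C, hC, h⟩ := h
  refine ⟨hm.const_mul c, |c| * C, by positivity, fun z => ?_⟩
  rw [abs_mul, mul_assoc]
  exact mul_le_mul_of_nonneg_left (h z) (abs_nonneg c)

lemma weaklySingular_inv_norm_sq : WeaklySingular fun z : E3 => (‖z‖ ^ 2)⁻¹ :=
  ⟨by fun_prop, 1, zero_le_one, fun z => by
    rw [abs_of_nonneg (by positivity), one_mul]; exact inv_norm_sq_le z⟩

lemma weaklySingular_inv_norm : WeaklySingular fun z : E3 => ‖z‖⁻¹ :=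
  ⟨by fun_prop, 1, zero_le_one, fun z => by
    rw [abs_of_nonneg (by positivity), one_mul]; exact inv_norm_le z⟩

variable [NormedSpace ℝ F]

lemma WeaklySingular.integrable_smul {κ : E3 → ℝ} (hκ : WeaklySingular κ) {G : E3 → F}
    (hG : FourthOrderDecay G) (hGc : Continuous G) : Integrable fun z => κ z • G z := by
  obtain ⟨hm, C, hC, h⟩ := hκ
  obtain ⟨B, hB⟩ := hG.exists_bound
  refine (((integrable_nearKernel.mul_const B).add (hG.integrable hGc).norm).const_mul C).mono'
    (hm.aestronglyMeasurable.smul hGc.aestronglyMeasurable) (ae_of_all _ fun z => ?_)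
  rw [norm_smul, Real.norm_eq_abs]
  simp only [Pi.add_apply]
  calc |κ z| * ‖G z‖ ≤ C * (nearKernel z + 1) * ‖G z‖ := by gcongr; exact h z
    _ = C * (nearKernel z * ‖G z‖ + ‖G z‖) := by ring
    _ ≤ C * (nearKernel z * B + ‖G z‖) := by
        gcongr
        · exact nearKernel_nonneg z
        · exact hB z

/-- The convolution of a scalar kernel with a vector-valued density. -/
noncomputable def kernelConv (κ : E3 → ℝ) (G : E3 → F) (v : E3) : F := ∫ z, κ z • G (v - z)

end Decay

section Schwartz
variable {F : Type} [NormedAddCommGroup F] [NormedSpace ℝ F]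

lemma WeaklySingular.integrable_schwartz {κ : E3 → ℝ} (hκ : WeaklySingular κ) (g : 𝓢(E3, F))
    (v : E3) : Integrable fun z => κ z • g (v - z) :=
  hκ.integrable_smul ((fourthOrderDecay_schwartz g).comp_sub v)
    (g.continuous.comp (continuous_const.sub continuous_id))

/-- The kernel is only locally integrable, so the derivative falls on the Schwartz function. -/
lemma hasFDerivAt_kernelConv {κ : E3 → ℝ} (hκ : WeaklySingular κ) (g : 𝓢(E3, F)) (v : E3) :
    HasFDerivAt (kernelConv κ g) (kernelConv κ (SchwartzMap.fderivCLM ℝ E3 F g) v) v := by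
  set g' := SchwartzMap.fderivCLM ℝ E3 F g with hg'
  obtain ⟨C, hC, h⟩ := fourthOrderDecay_schwartz g'
  have hb : FourthOrderDecay fun z : E3 => C * 16 * (1 + ‖v - z‖) ^ (-4 : ℝ) := by
    have : FourthOrderDecay fun z : E3 => C * 16 * (1 + ‖z‖) ^ (-4 : ℝ) :=
      ⟨C * 16, by positivity, fun x => by rw [Real.norm_of_nonneg (by positivity)]⟩
    exact this.comp_sub v
  have hcb : Continuous fun z : E3 => C * 16 * (1 + ‖v - z‖) ^ (-4 : ℝ) := by
    refine continuous_const.mul (Continuous.rpow_const (by fun_prop) fun z => Or.inl ?_)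
    positivity
  have hκabs : WeaklySingular fun z => |κ z| :=
    ⟨hκ.measurable.abs, by simpa using hκ.bound⟩
  refine hasFDerivAt_integral_of_dominated_of_fderiv_le (s := Metric.ball v 1)
    (bound := fun z => |κ z| • (C * 16 * (1 + ‖v - z‖) ^ (-4 : ℝ)))
    (F' := fun u z => κ z • g' (u - z))
    (Metric.ball_mem_nhds v one_pos) ?_ ?_ ?_ ?_ ?_ ?_
  · exact Eventually.of_forall fun u => (hκ.integrable_schwartz g u).aestronglyMeasurable
  · exact hκ.integrable_schwartz g v
  · exact (hκ.integrable_schwartz g' v).aestronglyMeasurable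
  · refine ae_of_all _ fun z u hu => ?_
    rw [norm_smul, Real.norm_eq_abs, smul_eq_mul]
    refine mul_le_mul_of_nonneg_left ((h _).trans ?_) (abs_nonneg _)
    rw [mul_assoc]
    refine mul_le_mul_of_nonneg_left ((one_add_norm_neg_four_shift (u - z) (v - z)).trans ?_) hC
    gcongr
    have : ‖u - z - (v - z)‖ < 1 := by simpa [dist_eq_norm] using hu
    calc (1 + ‖u - z - (v - z)‖) ^ 4 ≤ (1 + 1) ^ 4 := by gcongr
      _ = 16 := by norm_num
  · exact hκabs.integrable_smul hb hcb
  · refine ae_of_all _ fun z u _ => ?_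
    have h1 : HasFDerivAt (fun u : E3 => u - z) (ContinuousLinearMap.id ℝ E3) u :=
      (hasFDerivAt_id u).sub_const z
    have h2 := (g.differentiableAt (x := u - z)).hasFDerivAt.comp u h1
    rw [ContinuousLinearMap.comp_id] at h2
    exact h2.const_smul (κ z)

end Schwartz

/-- Smoothness of convolutions with a weakly singular kernel, by induction on the order. The target
space varies in the induction because derivatives take values in spaces of linear maps. -/
lemma contDiff_kernelConv {κ : E3 → ℝ} (hκ : WeaklySingular κ) (n : ℕ) :
    ∀ {F : Type} [NormedAddCommGroup F] [NormedSpace ℝ F] (g : 𝓢(E3, F)),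
      ContDiff ℝ n (kernelConv κ g) := by
  induction n with
  | zero =>
    intro F _ _ g
    rw [Nat.cast_zero, contDiff_zero]
    exact continuous_iff_continuousAt.2 fun v => (hasFDerivAt_kernelConv hκ g v).continuousAt
  | succ n ih =>
    intro F _ _ g
    have h2 : fderiv ℝ (kernelConv κ g) = kernelConv κ (SchwartzMap.fderivCLM ℝ E3 F g) :=
      funext fun v => (hasFDerivAt_kernelConv hκ g v).fderiv
    rw [Nat.cast_succ, contDiff_succ_iff_fderiv, h2]
    exact ⟨fun v => (hasFDerivAt_kernelConv hκ g v).differentiableAt, by simp, ih _⟩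

lemma fderiv_kernelConv_apply {κ : E3 → ℝ} (hκ : WeaklySingular κ) (g : 𝓢(E3, ℝ)) (v x : E3) :
    fderiv ℝ (kernelConv κ g) v x = ∫ z, κ z * fderiv ℝ g (v - z) x := by
  rw [(hasFDerivAt_kernelConv hκ g v).fderiv, kernelConv,
    ContinuousLinearMap.integral_apply (hκ.integrable_schwartz _ v)]
  simp [SchwartzMap.fderivCLM_apply]

/-! ### The Newtonian potential -/

/-- The gradient of the regularised power `(|z|² + δ²) ^ s`. -/
lemma hasGradientAt_regPower {δ : ℝ} (hδ : 0 < δ) (s : ℝ) (z : E3) :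
    HasGradientAt (fun z : E3 => (‖z‖ ^ 2 + δ ^ 2) ^ s)
      ((2 * s * (‖z‖ ^ 2 + δ ^ 2) ^ (s - 1)) • z) z := by
  have h1 : HasGradientAt (fun v : E3 => ‖v‖ ^ 2 + δ ^ 2) ((2 : ℝ) • z) z := by
    rw [hasGradientAt_iff_hasFDerivAt]
    exact ((hasStrictFDerivAt_norm_sq z).hasFDerivAt.add_const _).congr_fderiv (by ext; simp)
  have h2 : HasDerivAt (fun x : ℝ => x ^ s) (s * (‖z‖ ^ 2 + δ ^ 2) ^ (s - 1))
      (‖z‖ ^ 2 + δ ^ 2) :=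
    Real.hasDerivAt_rpow_const (Or.inl (by positivity))
  convert hasGradientAt_comp h2 h1 using 1
  rw [smul_smul]
  congr 1
  ring

lemma continuous_regPower {δ : ℝ} (hδ : 0 < δ) (s : ℝ) :
    Continuous fun z : E3 => (‖z‖ ^ 2 + δ ^ 2) ^ s :=
  Continuous.rpow_const (by fun_prop) fun z => Or.inl (by positivity)

/-- Integration by parts in a fixed direction. All integrability is obtained from bounds on the
first factor and decay of the second. -/
lemma integral_mul_fderiv_of_decay {q h : E3 → ℝ} {q' : E3 → E3} (x : E3)
    (hq : ∀ z, HasGradientAt q (q' z) z) (hqc : Continuous q) (hq'c : Continuous q') {B : ℝ}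
    (hB : ∀ z, |q z| ≤ B) (hB' : ∀ z, ‖q' z‖ ≤ B)
    (hh : ContDiff ℝ 1 h) (hd : FourthOrderDecay h) (hd' : FourthOrderDecay (fderiv ℝ h)) :
    ∫ z, q z * fderiv ℝ h z x = -∫ z, ⟪q' z, x⟫ * h z := by
  have hi := hd.integrable hh.continuous
  have hi' := hd'.integrable (hh.continuous_fderiv (by simp))
  have hfd (z : E3) : fderiv ℝ q z x = ⟪q' z, x⟫ := (hq z).fderiv_apply
  simp_rw [← hfd]
  refine integral_mul_fderiv_eq_neg_fderiv_mul_of_integrable ?_ ?_ ?_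
    (fun z _ => (hq z).differentiableAt) (fun z _ => (hh.differentiable (by simp)) z)
  · simp_rw [hfd]
    refine hi.bdd_mul (c := B * ‖x‖) (by fun_prop) (ae_of_all _ fun z => ?_)
    exact (norm_inner_le_norm _ _).trans (by gcongr; exact hB' z)
  · exact (hi'.apply_continuousLinearMap x).bdd_mul (c := B) (by fun_prop)
      (ae_of_all _ fun z => hB z)
  · exact hi.bdd_mul (c := B) (by fun_prop) (ae_of_all _ fun z => hB z)

/-- A sequence of positive regularisation parameters tending to zero. -/
noncomputable def regSeq (n : ℕ) : ℝ := 1 / ((n : ℝ) + 1)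

lemma regSeq_pos (n : ℕ) : 0 < regSeq n := by unfold regSeq; positivity

lemma tendsto_regSeq : Tendsto regSeq atTop (𝓝 0) := tendsto_one_div_add_atTop_nhds_zero_nat

lemma tendsto_regPower {z : E3} (hz : z ≠ 0) (s : ℝ) :
    Tendsto (fun n => (‖z‖ ^ 2 + regSeq n ^ 2) ^ s) atTop (𝓝 ((‖z‖ ^ 2) ^ s)) := by
  have h0 : ‖z‖ ^ 2 ≠ 0 := by positivity
  have : Tendsto (fun n => ‖z‖ ^ 2 + regSeq n ^ 2) atTop (𝓝 (‖z‖ ^ 2 + 0 ^ 2)) :=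
    tendsto_const_nhds.add (tendsto_regSeq.pow 2)
  rw [zero_pow two_ne_zero, add_zero] at this
  exact this.rpow_const (Or.inl h0)

lemma sq_rpow_neg_half {z : E3} : (‖z‖ ^ 2) ^ (-(1 / 2) : ℝ) = ‖z‖⁻¹ := by
  rw [← Real.rpow_natCast, ← Real.rpow_mul (norm_nonneg z), ← Real.rpow_neg_one]
  norm_num

lemma sq_rpow_neg_three_half {z : E3} : (‖z‖ ^ 2) ^ (-(3 / 2) : ℝ) = (‖z‖ ^ 3)⁻¹ := by
  rw [← Real.rpow_natCast, ← Real.rpow_mul (norm_nonneg z)]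
  rw [show ((2 : ℕ) : ℝ) * -(3 / 2) = -((3 : ℕ) : ℝ) by norm_num, Real.rpow_neg (norm_nonneg z),
    Real.rpow_natCast]

lemma regPower_le {z : E3} (hz : z ≠ 0) (δ : ℝ) {s : ℝ} (hs : s ≤ 0) :
    (‖z‖ ^ 2 + δ ^ 2) ^ s ≤ (‖z‖ ^ 2) ^ s :=
  Real.rpow_le_rpow_of_nonpos (by positivity) (by nlinarith [sq_nonneg δ]) hs

lemma regPower_le_const {δ : ℝ} (hδ : 0 < δ) (z : E3) {s : ℝ} (hs : s ≤ 0) :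
    (‖z‖ ^ 2 + δ ^ 2) ^ s ≤ (δ ^ 2) ^ s :=
  Real.rpow_le_rpow_of_nonpos (by positivity) (by nlinarith [sq_nonneg ‖z‖]) hs

lemma norm_mul_regPower_le (δ : ℝ) (z : E3) :
    (‖z‖ ^ 2 + δ ^ 2) ^ (-(3 / 2) : ℝ) * ‖z‖ ≤ (‖z‖ ^ 2)⁻¹ := by
  rcases eq_or_ne z 0 with rfl | hz
  · simp
  · refine (mul_le_mul_of_nonneg_right (regPower_le hz δ (by norm_num)) (norm_nonneg z)).trans ?_
    rw [sq_rpow_neg_three_half]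
    have : 0 < ‖z‖ := norm_pos_iff.2 hz
    apply le_of_eq
    field_simp

lemma ae_ne_zero : ∀ᵐ z : E3, z ≠ 0 := by
  simp [ae_iff, measure_singleton]

lemma FourthOrderDecay.fderiv_apply {h : E3 → ℝ} (hd' : FourthOrderDecay (fderiv ℝ h)) (x : E3) :
    FourthOrderDecay fun z => fderiv ℝ h z x :=
  hd'.mono (c := ‖x‖) fun z => by
    rw [mul_comm]; exact (fderiv ℝ h z).le_opNorm x

/-- Integration by parts against `|z|⁻¹`, by regularising the kernel. -/
lemma integral_inv_norm_mul_fderiv {h : E3 → ℝ} (x : E3)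
    (hh : ContDiff ℝ 1 h) (hd : FourthOrderDecay h) (hd' : FourthOrderDecay (fderiv ℝ h)) :
    ∫ z, ‖z‖⁻¹ * fderiv ℝ h z x = ∫ z, (⟪z, x⟫ * (‖z‖ ^ 3)⁻¹) * h z := by
  have hc' := hh.continuous_fderiv (by simp)
  have hi1 : Integrable fun z : E3 => ‖z‖⁻¹ * fderiv ℝ h z x :=
    weaklySingular_inv_norm.integrable_smul (hd'.fderiv_apply x) (by fun_prop)
  have hi2 : Integrable fun z : E3 => (‖z‖ ^ 2)⁻¹ * h z :=
    weaklySingular_inv_norm_sq.integrable_smul hd hh.continuous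
  have key (n : ℕ) : ∫ z, (‖z‖ ^ 2 + regSeq n ^ 2) ^ (-(1 / 2) : ℝ) * fderiv ℝ h z x =
      ∫ z, (⟪z, x⟫ * (‖z‖ ^ 2 + regSeq n ^ 2) ^ (-(3 / 2) : ℝ)) * h z := by
    have hp := regSeq_pos n
    rw [integral_mul_fderiv_of_decay x (fun z => hasGradientAt_regPower hp _ z)
      (continuous_regPower hp _)
      ((continuous_const.mul (continuous_regPower hp _)).smul continuous_id)
      (B := (regSeq n ^ 2) ^ (-(1 / 2) : ℝ) + (regSeq n ^ 2) ^ (-1 : ℝ)) ?_ ?_ hh hd hd',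
      ← integral_neg]
    · congr 1; ext z
      simp only [inner_smul_left, conj_trivial]
      rw [show (-(1 / 2) - 1 : ℝ) = -(3 / 2) by norm_num]
      ring
    · intro z
      rw [abs_of_nonneg (by positivity)]
      exact (regPower_le_const hp z (by norm_num)).trans (le_add_of_nonneg_right (by positivity))
    · intro z
      have h1 : ‖z‖ ≤ (‖z‖ ^ 2 + regSeq n ^ 2) ^ (1 / 2 : ℝ) := by
        rw [← Real.sqrt_eq_rpow]; exact Real.le_sqrt_of_sq_le (by nlinarith [sq_nonneg (regSeq n)])
      rw [norm_smul, Real.norm_eq_abs, abs_mul, abs_of_nonneg (by positivity :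
        0 ≤ (‖z‖ ^ 2 + regSeq n ^ 2) ^ (-(1 / 2) - 1 : ℝ))]
      rw [show (-(1 / 2) - 1 : ℝ) = -(3 / 2) by norm_num,
        show |(2 * -(1 / 2) : ℝ)| = 1 by norm_num, one_mul]
      calc (‖z‖ ^ 2 + regSeq n ^ 2) ^ (-(3 / 2) : ℝ) * ‖z‖ ≤
          (‖z‖ ^ 2 + regSeq n ^ 2) ^ (-(3 / 2) : ℝ) * (‖z‖ ^ 2 + regSeq n ^ 2) ^ (1 / 2 : ℝ) := by
            gcongr
        _ = (‖z‖ ^ 2 + regSeq n ^ 2) ^ (-1 : ℝ) := by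
            rw [← Real.rpow_add (by positivity)]; norm_num
        _ ≤ (regSeq n ^ 2) ^ (-1 : ℝ) := regPower_le_const hp z (by norm_num)
        _ ≤ _ := le_add_of_nonneg_left (by positivity)
  have t1 : Tendsto (fun n => ∫ z, (‖z‖ ^ 2 + regSeq n ^ 2) ^ (-(1 / 2) : ℝ) * fderiv ℝ h z x)
      atTop (𝓝 (∫ z, ‖z‖⁻¹ * fderiv ℝ h z x)) := by
    refine tendsto_integral_of_dominated_convergence _ (fun n => ?_) hi1.norm (fun n => ?_) ?_
    · exact ((continuous_regPower (regSeq_pos n) _).mul (by fun_prop)).aestronglyMeasurable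
    · filter_upwards [ae_ne_zero] with z hz
      rw [norm_mul, norm_mul, Real.norm_of_nonneg (by positivity),
        Real.norm_of_nonneg (by positivity : 0 ≤ ‖z‖⁻¹)]
      gcongr
      rw [← sq_rpow_neg_half]
      exact regPower_le hz _ (by norm_num)
    · filter_upwards [ae_ne_zero] with z hz
      rw [← sq_rpow_neg_half]
      exact (tendsto_regPower hz _).mul_const _
  have t2 : Tendsto (fun n => ∫ z, (⟪z, x⟫ * (‖z‖ ^ 2 + regSeq n ^ 2) ^ (-(3 / 2) : ℝ)) * h z)
      atTop (𝓝 (∫ z, (⟪z, x⟫ * (‖z‖ ^ 3)⁻¹) * h z)) := by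
    refine tendsto_integral_of_dominated_convergence (fun z => ‖x‖ * ‖(‖z‖ ^ 2)⁻¹ * h z‖)
      (fun n => ?_) (hi2.norm.const_mul _) (fun n => ae_of_all _ fun z => ?_) ?_
    · exact (((continuous_id.inner continuous_const).mul
        (continuous_regPower (regSeq_pos n) _)).mul hh.continuous).aestronglyMeasurable
    · rw [norm_mul, norm_mul, norm_mul, Real.norm_of_nonneg (by positivity :
        0 ≤ (‖z‖ ^ 2 + regSeq n ^ 2) ^ (-(3 / 2) : ℝ)), Real.norm_of_nonneg (by positivity :
        0 ≤ (‖z‖ ^ 2)⁻¹), ← mul_assoc]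
      refine mul_le_mul_of_nonneg_right ?_ (norm_nonneg _)
      calc ‖⟪z, x⟫‖ * (‖z‖ ^ 2 + regSeq n ^ 2) ^ (-(3 / 2) : ℝ)
          ≤ ‖z‖ * ‖x‖ * (‖z‖ ^ 2 + regSeq n ^ 2) ^ (-(3 / 2) : ℝ) := by
            gcongr; exact norm_inner_le_norm _ _
        _ = ‖x‖ * ((‖z‖ ^ 2 + regSeq n ^ 2) ^ (-(3 / 2) : ℝ) * ‖z‖) := by ring
        _ ≤ _ := by gcongr; exact norm_mul_regPower_le _ z
    · filter_upwards [ae_ne_zero] with z hz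
      rw [← sq_rpow_neg_three_half]
      exact ((tendsto_regPower hz _).const_mul _).mul_const _
  simp_rw [key] at t1
  exact tendsto_nhds_unique t1 t2

/-- The constant `∫ 3 (1 + |y|²)^(-5/2) dy`, the strength of the point source of the Coulomb
force field `z / |z|³`. Its value is `4π`, but only its sign matters. -/
noncomputable def sourceStrength : ℝ := ∫ y : E3, 3 * (‖y‖ ^ 2 + 1) ^ (-(5 / 2) : ℝ)

lemma sourceStrength_nonneg : 0 ≤ sourceStrength := integral_nonneg fun y => by positivity

lemma integrable_sourceProfile : Integrable fun y : E3 => 3 * (‖y‖ ^ 2 + 1) ^ (-(5 / 2) : ℝ) := by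
  have := (integrable_rpow_neg_one_add_norm_sq (E := E3) (μ := volume) (r := 5)
    (by simp; norm_num)).const_mul 3
  convert this using 3 with y
  rw [add_comm, neg_div]

/-- The divergence `3 δ² (|z|² + δ²)^(-5/2)` of the regularised force field is an approximate
identity of total mass `sourceStrength`; this is seen by rescaling `z = δ y`. -/
lemma tendsto_integral_sourceProfile {h : E3 → ℝ} (hc : Continuous h) {B : ℝ}
    (hB : ∀ z, |h z| ≤ B) :
    Tendsto (fun n => ∫ z, (3 * regSeq n ^ 2 * (‖z‖ ^ 2 + regSeq n ^ 2) ^ (-(5 / 2) : ℝ)) * h z)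
      atTop (𝓝 (sourceStrength * h 0)) := by
  have hsc (n : ℕ) : ∫ z, (3 * regSeq n ^ 2 * (‖z‖ ^ 2 + regSeq n ^ 2) ^ (-(5 / 2) : ℝ)) * h z
      = ∫ y : E3, (3 * (‖y‖ ^ 2 + 1) ^ (-(5 / 2) : ℝ)) * h (regSeq n • y) := by
    have hp := regSeq_pos n
    set δ := regSeq n
    have h1 := Measure.integral_comp_smul_of_nonneg (volume : Measure E3)
      (fun z => (3 * δ ^ 2 * (‖z‖ ^ 2 + δ ^ 2) ^ (-(5 / 2) : ℝ)) * h z) δ (hR := hp.le)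
    have hfr : Module.finrank ℝ E3 = 3 := by simp
    rw [hfr, smul_eq_mul] at h1
    have h2 : ∫ z, (3 * δ ^ 2 * (‖z‖ ^ 2 + δ ^ 2) ^ (-(5 / 2) : ℝ)) * h z =
        δ ^ 3 * ∫ x, 3 * δ ^ 2 * (‖δ • x‖ ^ 2 + δ ^ 2) ^ (-(5 / 2) : ℝ) * h (δ • x) := by
      rw [h1]; field_simp
    rw [h2, ← integral_const_mul]
    congr 1; ext y
    have e1 : ‖δ • y‖ ^ 2 + δ ^ 2 = δ ^ 2 * (‖y‖ ^ 2 + 1) := by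
      rw [norm_smul, Real.norm_of_nonneg hp.le]; ring
    have e2 : (δ ^ 2 : ℝ) ^ (-(5 / 2) : ℝ) = (δ ^ 5)⁻¹ := by
      rw [← Real.rpow_natCast, ← Real.rpow_mul hp.le]
      rw [show ((2 : ℕ) : ℝ) * -(5 / 2) = -((5 : ℕ) : ℝ) by norm_num, Real.rpow_neg hp.le,
        Real.rpow_natCast]
    rw [e1, Real.mul_rpow (by positivity) (by positivity), e2]
    field_simp
  simp_rw [hsc]
  have : sourceStrength * h 0 = ∫ y : E3, (3 * (‖y‖ ^ 2 + 1) ^ (-(5 / 2) : ℝ)) * h 0 := by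
    rw [integral_mul_const]; rfl
  rw [this]
  refine tendsto_integral_of_dominated_convergence
    (fun y => (3 * (‖y‖ ^ 2 + 1) ^ (-(5 / 2) : ℝ)) * B) (fun n => ?_)
    (integrable_sourceProfile.mul_const _) (fun n => ae_of_all _ fun y => ?_)
    (ae_of_all _ fun y => ?_)
  · exact integrable_sourceProfile.aestronglyMeasurable.mul
      (by fun_prop : Continuous fun y => h (regSeq n • y)).aestronglyMeasurable
  · rw [norm_mul, Real.norm_of_nonneg (by positivity)]
    gcongr
    exact hB _
  · refine Tendsto.const_mul _ ((hc.tendsto 0).comp ?_)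
    have := tendsto_regSeq.smul_const y
    rwa [zero_smul] at this

/-- The field `z / |z|³` has a point source at the origin as its divergence. -/
lemma integral_coulombField_gradient {h : E3 → ℝ}
    (hh : ContDiff ℝ 1 h) (hd : FourthOrderDecay h) (hd' : FourthOrderDecay (fderiv ℝ h)) :
    ∑ i : Fin 3, ∫ z, (z i * (‖z‖ ^ 3)⁻¹) * fderiv ℝ h z (EuclideanSpace.single i 1)
      = -(sourceStrength * h 0) := by
  set e : Fin 3 → E3 := fun i => EuclideanSpace.single i 1 with he
  have hc' := hh.continuous_fderiv (by simp)
  have hi2 (i : Fin 3) : Integrable fun z : E3 => (‖z‖ ^ 2)⁻¹ * fderiv ℝ h z (e i) :=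
    weaklySingular_inv_norm_sq.integrable_smul (hd'.fderiv_apply _) (by fun_prop)
  have hzi (z : E3) (i : Fin 3) : |z i| ≤ ‖z‖ := PiLp.norm_apply_le z i
  obtain ⟨B, hB⟩ := hd.exists_bound
  have hgr (n : ℕ) (i : Fin 3) (z : E3) :
      HasGradientAt (fun z : E3 => z i * (‖z‖ ^ 2 + regSeq n ^ 2) ^ (-(3 / 2) : ℝ))
        (z i • ((2 * -(3 / 2) * (‖z‖ ^ 2 + regSeq n ^ 2) ^ (-(3 / 2) - 1 : ℝ)) • z)
          + (‖z‖ ^ 2 + regSeq n ^ 2) ^ (-(3 / 2) : ℝ) • e i) z := by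
    refine hasGradientAt_mul ?_ (hasGradientAt_regPower (regSeq_pos n) _ z)
    rw [hasGradientAt_iff_hasFDerivAt]
    exact ((EuclideanSpace.proj (𝕜 := ℝ) i).hasFDerivAt (x := z)).congr_fderiv
      (by ext y; simp [he, EuclideanSpace.inner_single_left])
  have key (n : ℕ) : ∑ i : Fin 3, ∫ z, (z i * (‖z‖ ^ 2 + regSeq n ^ 2) ^ (-(3 / 2) : ℝ))
        * fderiv ℝ h z (e i) =
      -∫ z, (3 * regSeq n ^ 2 * (‖z‖ ^ 2 + regSeq n ^ 2) ^ (-(5 / 2) : ℝ)) * h z := by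
    have hp := regSeq_pos n
    set δ := regSeq n
    have hw (z : E3) : 0 < ‖z‖ ^ 2 + δ ^ 2 := by positivity
    have hnw (z : E3) : ‖z‖ ≤ (‖z‖ ^ 2 + δ ^ 2) ^ (1 / 2 : ℝ) := by
      rw [← Real.sqrt_eq_rpow]; exact Real.le_sqrt_of_sq_le (by nlinarith [sq_nonneg δ])
    have hqc (i : Fin 3) : Continuous fun z : E3 => z i * (‖z‖ ^ 2 + δ ^ 2) ^ (-(3 / 2) : ℝ) :=
      Continuous.mul (by fun_prop) (continuous_regPower hp _)
    have hq'c (i : Fin 3) : Continuous fun z : E3 =>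
        z i • ((2 * -(3 / 2) * (‖z‖ ^ 2 + δ ^ 2) ^ (-(3 / 2) - 1 : ℝ)) • z)
          + (‖z‖ ^ 2 + δ ^ 2) ^ (-(3 / 2) : ℝ) • e i := by
      have c1 := continuous_regPower hp (-(3 / 2) - 1)
      have c2 := continuous_regPower hp (-(3 / 2))
      fun_prop
    have hbd1 (i : Fin 3) (z : E3) :
        |z i * (‖z‖ ^ 2 + δ ^ 2) ^ (-(3 / 2) : ℝ)| ≤ (δ ^ 2) ^ (-1 : ℝ) := by
      rw [abs_mul, abs_of_nonneg (by positivity : 0 ≤ (‖z‖ ^ 2 + δ ^ 2) ^ (-(3 / 2) : ℝ))]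
      calc |z i| * (‖z‖ ^ 2 + δ ^ 2) ^ (-(3 / 2) : ℝ)
          ≤ (‖z‖ ^ 2 + δ ^ 2) ^ (1 / 2 : ℝ) * (‖z‖ ^ 2 + δ ^ 2) ^ (-(3 / 2) : ℝ) := by
            gcongr; exact (hzi z i).trans (hnw z)
        _ = (‖z‖ ^ 2 + δ ^ 2) ^ (-1 : ℝ) := by rw [← Real.rpow_add (hw z)]; norm_num
        _ ≤ _ := regPower_le_const hp z (by norm_num)
    have hbd2 (i : Fin 3) (z : E3) :
        ‖z i • ((2 * -(3 / 2) * (‖z‖ ^ 2 + δ ^ 2) ^ (-(3 / 2) - 1 : ℝ)) • z)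
          + (‖z‖ ^ 2 + δ ^ 2) ^ (-(3 / 2) : ℝ) • e i‖ ≤ 4 * (δ ^ 2) ^ (-(3 / 2) : ℝ) := by
      have hpp : 0 ≤ (‖z‖ ^ 2 + δ ^ 2) ^ (-(3 / 2) - 1 : ℝ) := by positivity
      have hle := regPower_le_const hp z (s := -(3 / 2)) (by norm_num)
      have hprod : (‖z‖ ^ 2 + δ ^ 2) ^ (-(3 / 2) - 1 : ℝ) * (‖z‖ ^ 2 + δ ^ 2)
          = (‖z‖ ^ 2 + δ ^ 2) ^ (-(3 / 2) : ℝ) := by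
        rw [Real.rpow_sub_one (hw z).ne']; field_simp
      refine (norm_add_le _ _).trans ?_
      rw [norm_smul, norm_smul, norm_smul, he, PiLp.norm_single, norm_one,
        Real.norm_of_nonneg (by positivity : 0 ≤ (‖z‖ ^ 2 + δ ^ 2) ^ (-(3 / 2) : ℝ)), mul_one,
        Real.norm_eq_abs, Real.norm_eq_abs, abs_mul, abs_of_nonneg hpp,
        show |(2 * -(3 / 2) : ℝ)| = 3 by norm_num]
      have : |z i| * ‖z‖ ≤ ‖z‖ ^ 2 + δ ^ 2 := by nlinarith [hzi z i, norm_nonneg z, sq_nonneg δ]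
      have := mul_le_mul_of_nonneg_left this hpp
      nlinarith
    have hstep (i : Fin 3) := integral_mul_fderiv_of_decay (e i) (hgr n i) (hqc i) (hq'c i)
      (B := (δ ^ 2) ^ (-1 : ℝ) + 4 * (δ ^ 2) ^ (-(3 / 2) : ℝ))
      (fun z => (hbd1 i z).trans (le_add_of_nonneg_right (by positivity)))
      (fun z => (hbd2 i z).trans (le_add_of_nonneg_left (by positivity))) hh hd hd'
    rw [Finset.sum_congr rfl fun i _ => hstep i, Finset.sum_neg_distrib,
      ← integral_finsetSum]
    · congr 2; ext z
      rw [← Finset.sum_mul]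
      congr 1
      have hsq : ∑ i : Fin 3, z i * z i = ‖z‖ ^ 2 := by
        rw [EuclideanSpace.norm_sq_eq]; simp [sq]
      simp only [inner_add_left, inner_smul_left, conj_trivial, Finset.sum_add_distrib, he,
        EuclideanSpace.inner_single_right]
      simp only [PiLp.single_apply, if_true, one_mul, mul_one, Finset.sum_const,
        Finset.card_univ, Fintype.card_fin, nsmul_eq_mul]
      have h1 : ∑ i : Fin 3, z i * (2 * -(3 / 2) * (‖z‖ ^ 2 + δ ^ 2) ^ (-(3 / 2) - 1 : ℝ) * z i)
          = 2 * -(3 / 2) * (‖z‖ ^ 2 + δ ^ 2) ^ (-(3 / 2) - 1 : ℝ) * ‖z‖ ^ 2 := by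
        rw [← hsq, Finset.mul_sum]; exact Finset.sum_congr rfl fun i _ => by ring
      rw [h1, show (-(3 / 2) - 1 : ℝ) = -(5 / 2) by norm_num,
        show (-(3 / 2) : ℝ) = -(5 / 2) + 1 by norm_num, Real.rpow_add_one (hw z).ne']
      push_cast
      ring
    · intro i _
      exact (hd.integrable hh.continuous).bdd_mul
        (c := 4 * (δ ^ 2) ^ (-(3 / 2) : ℝ) * ‖e i‖)
        ((hq'c i).inner continuous_const).aestronglyMeasurable
        (ae_of_all _ fun z => (norm_inner_le_norm _ _).trans (by gcongr; exact hbd2 i z))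
  -- dominated convergence, with `|z|⁻² |∇h|` as majorant
  have t1 : Tendsto (fun n => ∑ i : Fin 3,
      ∫ z, (z i * (‖z‖ ^ 2 + regSeq n ^ 2) ^ (-(3 / 2) : ℝ)) * fderiv ℝ h z (e i))
      atTop (𝓝 (∑ i : Fin 3, ∫ z, (z i * (‖z‖ ^ 3)⁻¹) * fderiv ℝ h z (e i))) := by
    refine tendsto_finsetSum _ fun i _ => ?_
    refine tendsto_integral_of_dominated_convergence
      (fun z => ‖(‖z‖ ^ 2)⁻¹ * fderiv ℝ h z (e i)‖)
      (fun n => ?_) (hi2 i).norm (fun n => ae_of_all _ fun z => ?_) ?_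
    · exact ((Continuous.mul (by fun_prop) (continuous_regPower (regSeq_pos n) _)).mul
        (by fun_prop)).aestronglyMeasurable
    · rw [norm_mul, norm_mul, norm_mul, Real.norm_of_nonneg (by positivity :
        0 ≤ (‖z‖ ^ 2 + regSeq n ^ 2) ^ (-(3 / 2) : ℝ)), Real.norm_of_nonneg (by positivity :
        0 ≤ (‖z‖ ^ 2)⁻¹), Real.norm_eq_abs (z i)]
      refine mul_le_mul_of_nonneg_right ?_ (norm_nonneg _)
      refine le_trans ?_ (norm_mul_regPower_le (regSeq n) z)
      rw [mul_comm]
      gcongr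
      exact hzi z i
    · filter_upwards [ae_ne_zero] with z hz
      rw [← sq_rpow_neg_three_half]
      exact ((tendsto_regPower hz _).const_mul _).mul_const _
  simp_rw [key] at t1
  exact tendsto_nhds_unique t1 (tendsto_integral_sourceProfile hh.continuous hB).neg

/-! ### The coefficients of the Landau equation -/

lemma weaklySingular_potential : WeaklySingular fun z : E3 => (4 * Real.pi)⁻¹ * ‖z‖⁻¹ :=
  weaklySingular_inv_norm.const_mul _

lemma coeffa_eq (g : E3 → ℝ) :
    coeffa g = kernelConv (fun z : E3 => (4 * Real.pi)⁻¹ * ‖z‖⁻¹) g := by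
  ext v
  unfold coeffa kernelConv
  rw [← integral_sub_left_eq_self (fun w => (4 * Real.pi * ‖v - w‖)⁻¹ * g w) volume v]
  simp only [sub_sub_cancel, mul_inv, smul_eq_mul]

lemma contDiff_coeffa (g : 𝓢(E3, ℝ)) (n : ℕ) : ContDiff ℝ n (coeffa g) := by
  rw [coeffa_eq]; exact contDiff_kernelConv weaklySingular_potential n g

section Reflect
variable (g : 𝓢(E3, ℝ)) (v : E3)

lemma hasFDerivAt_comp_reflect (z : E3) :
    HasFDerivAt (fun z => g (v - z)) (-fderiv ℝ g (v - z)) z := by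
  have h1 : HasFDerivAt (fun z : E3 => v - z) (-ContinuousLinearMap.id ℝ E3) z :=
    (hasFDerivAt_id z).const_sub v
  exact ((g.differentiableAt (x := v - z)).hasFDerivAt.comp z h1).congr_fderiv (by ext; simp)

lemma contDiff_comp_reflect : ContDiff ℝ 1 fun z => g (v - z) :=
  (g.smooth 1).comp (contDiff_const.sub contDiff_id)

lemma decay_comp_reflect : FourthOrderDecay fun z => g (v - z) :=
  (fourthOrderDecay_schwartz g).comp_sub v

lemma decay_fderiv_comp_reflect : FourthOrderDecay (fderiv ℝ fun z => g (v - z)) := by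
  have := (fourthOrderDecay_schwartz (SchwartzMap.fderivCLM ℝ E3 ℝ g)).comp_sub v
  refine this.mono (c := 1) fun z => ?_
  rw [(hasFDerivAt_comp_reflect g v z).fderiv, norm_neg, one_mul]
  rfl

end Reflect

lemma fderiv_coeffa_apply (g : 𝓢(E3, ℝ)) (v x : E3) :
    fderiv ℝ (coeffa g) v x =
      -((4 * Real.pi)⁻¹ * ∫ z, (⟪z, x⟫ * (‖z‖ ^ 3)⁻¹) * g (v - z)) := by
  rw [coeffa_eq, fderiv_kernelConv_apply weaklySingular_potential]
  have h := integral_inv_norm_mul_fderiv x (contDiff_comp_reflect g v) (decay_comp_reflect g v)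
    (decay_fderiv_comp_reflect g v)
  simp_rw [(hasFDerivAt_comp_reflect g v _).fderiv, _root_.neg_apply, mul_neg] at h
  rw [integral_neg] at h
  simp_rw [mul_assoc (4 * Real.pi)⁻¹]
  rw [integral_const_mul, ← h]
  ring

/-- The derivative of a Schwartz function in a fixed direction. -/
noncomputable def dirDeriv (x : E3) (g : 𝓢(E3, ℝ)) : 𝓢(E3, ℝ) :=
  SchwartzMap.evalCLM ℝ E3 ℝ x (SchwartzMap.fderivCLM ℝ E3 ℝ g)

lemma dirDeriv_apply (x : E3) (g : 𝓢(E3, ℝ)) (v : E3) : dirDeriv x g v = fderiv ℝ g v x := rfl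

/-- The Poisson equation for the potential `a[g]`. -/
lemma divergence_gradient_coeffa (g : 𝓢(E3, ℝ)) (v : E3) :
    divergence (gradient (coeffa g)) v = -((4 * Real.pi)⁻¹ * sourceStrength * g v) := by
  set e : Fin 3 → E3 := fun i => EuclideanSpace.single i 1 with he
  have hc : ContDiff ℝ 1 (gradient (coeffa g)) :=
    contDiff_gradient (contDiff_coeffa g 2) (by norm_num)
  have h1 (i : Fin 3) : (fderiv ℝ (gradient (coeffa g)) v (e i)) i
      = ∫ z, (4 * Real.pi)⁻¹ * ‖z‖⁻¹ * fderiv ℝ (dirDeriv (e i) g) (v - z) (e i) := by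
    have h := ((EuclideanSpace.proj (𝕜 := ℝ) i).hasFDerivAt.comp v
      ((hc.differentiable (by simp)) v).hasFDerivAt).fderiv
    have h2 : (EuclideanSpace.proj (𝕜 := ℝ) i) ∘ gradient (coeffa g)
        = kernelConv (fun z : E3 => (4 * Real.pi)⁻¹ * ‖z‖⁻¹) (dirDeriv (e i) g) := by
      ext u
      change gradient (coeffa g) u i = _
      rw [gradient_apply, coeffa_eq, fderiv_kernelConv_apply weaklySingular_potential]
      rfl
    have h3 : (fderiv ℝ (gradient (coeffa g)) v (e i)) i
        = fderiv ℝ ((EuclideanSpace.proj (𝕜 := ℝ) i) ∘ gradient (coeffa g)) v (e i) := by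
      rw [h]; simp
    rw [h3, h2, fderiv_kernelConv_apply weaklySingular_potential]
  have h2 (i : Fin 3) : ∫ z, (4 * Real.pi)⁻¹ * ‖z‖⁻¹ * fderiv ℝ (dirDeriv (e i) g) (v - z) (e i)
      = (4 * Real.pi)⁻¹ * ∫ z, (z i * (‖z‖ ^ 3)⁻¹) * fderiv ℝ (fun z => g (v - z)) z (e i) := by
    have h := integral_inv_norm_mul_fderiv (e i) (contDiff_comp_reflect (dirDeriv (e i) g) v)
      (decay_comp_reflect _ v) (decay_fderiv_comp_reflect _ v)
    simp_rw [(hasFDerivAt_comp_reflect _ v _).fderiv, _root_.neg_apply, mul_neg] at h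
    rw [integral_neg, neg_eq_iff_eq_neg, ← integral_neg] at h
    simp_rw [mul_assoc (4 * Real.pi)⁻¹]
    rw [integral_const_mul, h]
    congr 2; ext z
    rw [(hasFDerivAt_comp_reflect g v _).fderiv, dirDeriv_apply, he,
      EuclideanSpace.inner_single_right]
    simp
  unfold divergence
  rw [Finset.sum_congr rfl fun i _ => (h1 i).trans (h2 i), ← Finset.mul_sum,
    integral_coulombField_gradient (contDiff_comp_reflect g v) (decay_comp_reflect g v)
      (decay_fderiv_comp_reflect g v), sub_zero]
  ring

lemma norm_gradient_coeffa_le {g : 𝓢(E3, ℝ)} (hg : ∀ v, 0 ≤ g v) (v : E3) :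
    ‖gradient (coeffa g) v‖ ≤ ∫ z, (‖z‖ ^ 2)⁻¹ * g (v - z) := by
  have hi : Integrable fun z => (‖z‖ ^ 2)⁻¹ * g (v - z) :=
    weaklySingular_inv_norm_sq.integrable_schwartz g v
  have hpi : (4 * Real.pi)⁻¹ ≤ 1 := inv_le_one_of_one_le₀ (by nlinarith [Real.pi_gt_three])
  have h0 : 0 ≤ ∫ z, (‖z‖ ^ 2)⁻¹ * g (v - z) :=
    integral_nonneg fun z => mul_nonneg (by positivity) (hg _)
  rw [norm_gradient]
  refine ContinuousLinearMap.opNorm_le_bound _ h0 fun x => ?_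
  rw [fderiv_coeffa_apply, norm_neg, norm_mul, Real.norm_of_nonneg (by positivity)]
  have : ‖∫ z, (⟪z, x⟫ * (‖z‖ ^ 3)⁻¹) * g (v - z)‖ ≤ ∫ z, ((‖z‖ ^ 2)⁻¹ * g (v - z)) * ‖x‖ := by
    refine norm_integral_le_of_norm_le (hi.mul_const _) (ae_of_all _ fun z => ?_)
    rw [norm_mul, norm_mul, Real.norm_of_nonneg (hg _),
      Real.norm_of_nonneg (by positivity : 0 ≤ (‖z‖ ^ 3)⁻¹), mul_right_comm _ _ ‖x‖]
    refine mul_le_mul_of_nonneg_right ?_ (hg _)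
    calc ‖⟪z, x⟫‖ * (‖z‖ ^ 3)⁻¹ ≤ ‖z‖ * ‖x‖ * (‖z‖ ^ 3)⁻¹ := by
          gcongr; exact norm_inner_le_norm _ _
      _ = (‖z‖ ^ 2)⁻¹ * ‖x‖ := by
          rcases eq_or_ne ‖z‖ 0 with h | h
          · simp [h]
          · field_simp
  rw [integral_mul_const] at this
  calc (4 * Real.pi)⁻¹ * ‖∫ z, (⟪z, x⟫ * (‖z‖ ^ 3)⁻¹) * g (v - z)‖
      ≤ 1 * ((∫ z, (‖z‖ ^ 2)⁻¹ * g (v - z)) * ‖x‖) := by gcongr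
    _ = _ := one_mul _

lemma abs_kernelA_le (z : E3) (i j : Fin 3) : |kernelA z i j| ≤ ‖z‖⁻¹ := by
  have hzi (i : Fin 3) : |z i| ≤ ‖z‖ := PiLp.norm_apply_le z i
  have h1 : |(1 : Matrix (Fin 3) (Fin 3) ℝ) i j| ≤ 1 := by
    rw [Matrix.one_apply]; split_ifs <;> simp
  have h2 : |(‖z‖ ^ 2)⁻¹ * (z i * z j)| ≤ 1 := by
    rw [abs_mul, abs_of_nonneg (by positivity : 0 ≤ (‖z‖ ^ 2)⁻¹), abs_mul]
    refine inv_mul_le_one_of_le₀ ?_ (by positivity)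
    rw [sq]
    exact mul_le_mul (hzi i) (hzi j) (abs_nonneg _) (norm_nonneg _)
  unfold kernelA
  simp only [Matrix.smul_apply, Matrix.sub_apply, Matrix.of_apply, smul_eq_mul]
  rw [abs_mul, abs_of_nonneg (by positivity), mul_inv]
  have h3 := abs_sub ((1 : Matrix (Fin 3) (Fin 3) ℝ) i j) ((‖z‖ ^ 2)⁻¹ * (z i * z j))
  have hpi : (8 * Real.pi)⁻¹ * 2 ≤ 1 := by
    rw [inv_mul_le_one₀ (by positivity)]
    nlinarith [Real.pi_gt_three]
  have h0 : (0 : ℝ) ≤ ‖z‖⁻¹ := by positivity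
  calc (8 * Real.pi)⁻¹ * ‖z‖⁻¹ * |(1 : Matrix (Fin 3) (Fin 3) ℝ) i j - (‖z‖ ^ 2)⁻¹ * (z i * z j)|
      ≤ (8 * Real.pi)⁻¹ * ‖z‖⁻¹ * 2 := by gcongr; linarith
    _ = (8 * Real.pi)⁻¹ * 2 * ‖z‖⁻¹ := by ring
    _ ≤ 1 * ‖z‖⁻¹ := by gcongr
    _ = _ := one_mul _

lemma weaklySingular_kernelA (i j : Fin 3) : WeaklySingular fun z => kernelA z i j := by
  refine ⟨?_, 1, zero_le_one, fun z => ?_⟩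
  · unfold kernelA
    simp only [Matrix.smul_apply, Matrix.sub_apply, Matrix.of_apply, smul_eq_mul]
    fun_prop
  · rw [one_mul]; exact (abs_kernelA_le z i j).trans (inv_norm_le z)

lemma coeffA_apply (g : E3 → ℝ) (v : E3) (i j : Fin 3) :
    coeffA g v i j = kernelConv (fun z => kernelA z i j) g v := by
  unfold coeffA kernelConv
  rw [Matrix.of_apply,
    ← integral_sub_left_eq_self (fun w => kernelA (v - w) i j * g w) volume v]
  simp

lemma abs_coeffA_le {g : 𝓢(E3, ℝ)} (hg : ∀ v, 0 ≤ g v) (v : E3) (i j : Fin 3) :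
    |coeffA g v i j| ≤ ∫ z, ‖z‖⁻¹ * g (v - z) := by
  rw [coeffA_apply, kernelConv, ← Real.norm_eq_abs]
  refine norm_integral_le_of_norm_le (weaklySingular_inv_norm.integrable_schwartz g v)
    (ae_of_all _ fun z => ?_)
  rw [norm_smul, Real.norm_of_nonneg (hg _)]
  exact mul_le_mul_of_nonneg_right (abs_kernelA_le z i j) (hg _)

lemma toEuclideanLin_apply_apply (A : Matrix (Fin 3) (Fin 3) ℝ) (x : E3) (i : Fin 3) :
    Matrix.toEuclideanLin A x i = ∑ j, A i j * x j := by
  rfl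

lemma contDiff_flux (g : 𝓢(E3, ℝ)) : ContDiff ℝ 1 (flux g) := by
  have hg : ContDiff ℝ 2 g := g.smooth 2
  have h1 : ContDiff ℝ 1 (gradient (coeffa g)) :=
    contDiff_gradient (contDiff_coeffa g 2) (by norm_num)
  have h2 : ContDiff ℝ 1 (gradient g) := contDiff_gradient hg (by norm_num)
  unfold flux
  refine ContDiff.sub ?_ ((g.smooth 1).smul h1)
  rw [contDiff_piLp]
  intro i
  simp_rw [toEuclideanLin_apply_apply, coeffA_apply]
  refine ContDiff.sum fun j _ => ContDiff.mul ?_ ?_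
  · exact_mod_cast contDiff_kernelConv (weaklySingular_kernelA i j) 1 g
  · exact (contDiff_piLp_apply (p := 2)).comp h2

/-! ### Weighted truncations -/

lemma hasGradientAt_weighted {g : E3 → ℝ} (hg : ContDiff ℝ 1 g) (r : ℝ) {s : ℝ} (hs : 1 < s)
    (ℓ : ℝ) (v : E3) :
    HasGradientAt (fun v => bracket v ^ r * posPow s (g v - ℓ))
      (bracket v ^ r • ((s * posPow (s - 1) (g v - ℓ)) • gradient g v)
        + posPow s (g v - ℓ) • ((r * bracket v ^ (r - 2)) • v)) v := by
  refine hasGradientAt_mul (hasGradientAt_bracket_rpow r v) ?_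
  have h : HasDerivAt (fun x => posPow s (x - ℓ)) (s * posPow (s - 1) (g v - ℓ)) (g v) :=
    (hasDerivAt_posPow hs (g v - ℓ)).comp_sub_const (g v) ℓ
  exact hasGradientAt_comp (β := fun x => posPow s (x - ℓ)) h (hasGradientAt_of_contDiff hg v)

lemma contDiff_weighted {g : E3 → ℝ} (hg : ContDiff ℝ 1 g) (r : ℝ) {s : ℝ} (hs : 1 < s)
    (ℓ : ℝ) : ContDiff ℝ 1 fun v => bracket v ^ r * posPow s (g v - ℓ) :=
  ((contDiff_bracket_rpow r).of_le (by simp)).mul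
    ((contDiff_posPow hs).comp (hg.sub contDiff_const))

lemma continuous_weighted {g : E3 → ℝ} (hg : Continuous g) (r : ℝ) {s : ℝ} (hs : 0 ≤ s)
    (ℓ : ℝ) : Continuous fun v => bracket v ^ r * posPow s (g v - ℓ) :=
  (continuous_bracket_rpow r).mul ((continuous_posPow hs).comp (hg.sub continuous_const))

lemma posPow_eq_zero_of_decay {g : E3 → ℝ} {C : ℝ} (hC : ∀ v, ‖v‖ * |g v| ≤ C) {ℓ : ℝ}
    (hℓ : 0 < ℓ) {s : ℝ} (hs : s ≠ 0) {v : E3} (hv : v ∉ Metric.closedBall (0 : E3) (C / ℓ)) :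
    posPow s (g v - ℓ) = 0 := by
  refine posPow_of_nonpos hs ?_
  rw [mem_closedBall_zero_iff, not_le, div_lt_iff₀ hℓ] at hv
  by_contra! h
  have := le_abs_self (g v)
  nlinarith [hC v, norm_nonneg v]

lemma hasCompactSupport_posPow (g : 𝓢(E3, ℝ)) {ℓ : ℝ} (hℓ : 0 < ℓ) {s : ℝ} (hs : s ≠ 0) :
    HasCompactSupport fun v => posPow s (g v - ℓ) := by
  obtain ⟨C, hC⟩ := g.decay 1 0
  refine HasCompactSupport.intro (isCompact_closedBall (0 : E3) (C / ℓ)) fun v hv => ?_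
  refine posPow_eq_zero_of_decay (fun v => ?_) hℓ hs hv
  have := hC.2 v
  rwa [pow_one, norm_iteratedFDeriv_zero] at this

lemma hasCompactSupport_weighted (g : 𝓢(E3, ℝ)) (r : ℝ) {ℓ : ℝ} (hℓ : 0 < ℓ) {s : ℝ}
    (hs : s ≠ 0) : HasCompactSupport fun v => bracket v ^ r * posPow s (g v - ℓ) :=
  (hasCompactSupport_posPow g hℓ hs).mul_left

/-- The weighted integral `∫ ⟨v⟩^(9/2) (g - ℓ)_+ ^ s`. -/
noncomputable def levelIntegral (s ℓ : ℝ) (g : E3 → ℝ) : ℝ :=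
  ∫ v, bracket v ^ (9 / 2 : ℝ) * posPow s (g v - ℓ)

/-- The norm `(∫ ⟨v⟩^(9/2) (g - ℓ)_+ ^ (15/2))^(1/3)` which the dissipation controls through
the Sobolev inequality. -/
noncomputable def sobolevNorm (ℓ : ℝ) (g : E3 → ℝ) : ℝ := levelIntegral (15 / 2) ℓ g ^ (1 / 3 : ℝ)

lemma levelIntegral_nonneg (s ℓ : ℝ) (g : E3 → ℝ) : 0 ≤ levelIntegral s ℓ g :=
  integral_nonneg fun v => mul_nonneg (Real.rpow_nonneg (bracket_pos v).le _) (posPow_nonneg _ _)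

lemma sobolevNorm_nonneg (ℓ : ℝ) (g : E3 → ℝ) : 0 ≤ sobolevNorm ℓ g :=
  Real.rpow_nonneg (levelIntegral_nonneg _ _ _) _

/-! ### The matrix quadratic form -/

lemma inner_toEuclideanLin (A : Matrix (Fin 3) (Fin 3) ℝ) (x y : E3) :
    ⟪x, Matrix.toEuclideanLin A y⟫ = ∑ i, ∑ j, A i j * x i * y j := by
  rw [PiLp.inner_apply]
  refine Finset.sum_congr rfl fun i _ => ?_
  rw [toEuclideanLin_apply_apply]
  simp only [RCLike.inner_apply, conj_trivial, Finset.sum_mul]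
  exact Finset.sum_congr rfl fun j _ => by ring

lemma abs_inner_toEuclideanLin_le {A : Matrix (Fin 3) (Fin 3) ℝ} {a : ℝ}
    (hA : ∀ i j, |A i j| ≤ a) (x y : E3) :
    |⟪x, Matrix.toEuclideanLin A y⟫| ≤ 9 * a * ‖x‖ * ‖y‖ := by
  have hx (x : E3) (i : Fin 3) : |x i| ≤ ‖x‖ := PiLp.norm_apply_le x i
  have ha : 0 ≤ a := (abs_nonneg _).trans (hA 0 0)
  rw [inner_toEuclideanLin]
  have : ∀ i j, |A i j * x i * y j| ≤ a * ‖x‖ * ‖y‖ := fun i j => by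
    rw [abs_mul, abs_mul]
    gcongr <;> [exact hA i j; exact hx x i; exact hx y j]
  calc |∑ i, ∑ j, A i j * x i * y j| ≤ ∑ i : Fin 3, ∑ j : Fin 3, a * ‖x‖ * ‖y‖ :=
        (Finset.abs_sum_le_sum_abs _ _).trans (Finset.sum_le_sum fun i _ =>
          (Finset.abs_sum_le_sum_abs _ _).trans (Finset.sum_le_sum fun j _ => this i j))
    _ = 9 * a * ‖x‖ * ‖y‖ := by simp; ring

lemma le_inner_toEuclideanLin {A : Matrix (Fin 3) (Fin 3) ℝ} {c : ℝ}
    (hA : (A - c • (1 : Matrix (Fin 3) (Fin 3) ℝ)).PosSemidef) (x : E3) :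
    c * ‖x‖ ^ 2 ≤ ⟪x, Matrix.toEuclideanLin A x⟫ := by
  have h := hA.dotProduct_mulVec_nonneg (x := WithLp.ofLp x)
  rw [inner_toEuclideanLin]
  have hsq : ‖x‖ ^ 2 = ∑ i : Fin 3, x i * x i := by
    rw [EuclideanSpace.norm_sq_eq]; simp [sq]
  rw [hsq]
  simp only [dotProduct, Matrix.mulVec, Fin.sum_univ_three, Matrix.sub_apply, Matrix.smul_apply,
    Matrix.one_apply, Pi.star_apply, star_trivial] at h ⊢
  simp at h
  linarith

lemma inner_toEuclideanLin_symm {A : Matrix (Fin 3) (Fin 3) ℝ} {c : ℝ}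
    (hA : (A - c • (1 : Matrix (Fin 3) (Fin 3) ℝ)).PosSemidef) (x y : E3) :
    ⟪x, Matrix.toEuclideanLin A y⟫ = ⟪y, Matrix.toEuclideanLin A x⟫ := by
  have hs : ∀ i j, A i j = A j i := fun i j => by
    have := hA.1.apply i j
    simp only [Matrix.sub_apply, Matrix.smul_apply, star_trivial, Matrix.one_apply,
      eq_comm (a := j)] at this
    linarith
  rw [inner_toEuclideanLin, inner_toEuclideanLin, Finset.sum_comm]
  exact Finset.sum_congr rfl fun i _ => Finset.sum_congr rfl fun j _ => by rw [hs]; ring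

/-! ### Hölder bounds against the critical norm -/

lemma bracket_le_of_norm_sub_le {v w : E3} (h : ‖v - w‖ ≤ 1) : bracket v ≤ 2 * bracket w := by
  have h1 : ‖v‖ ≤ ‖w‖ + 1 := by
    calc ‖v‖ = ‖w + (v - w)‖ := by simp
      _ ≤ ‖w‖ + ‖v - w‖ := norm_add_le _ _
      _ ≤ _ := by linarith
  refine abs_le_of_sq_le_sq' ?_ (by linarith [bracket_pos w]) |>.2
  rw [mul_pow, bracket_sq, bracket_sq]
  nlinarith [norm_nonneg v, norm_nonneg w, sq_nonneg (‖w‖ - 1)]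

lemma lintegral_rpow_eq_levelIntegral {g : 𝓢(E3, ℝ)} {ℓ : ℝ} (hℓ : 0 < ℓ) {s : ℝ} (hs : 0 < s) :
    ∫⁻ v, ENNReal.ofReal (bracket v ^ (9 / 2 : ℝ) * posPow s (g v - ℓ))
      = ENNReal.ofReal (levelIntegral s ℓ g) := by
  unfold levelIntegral
  rw [ofReal_integral_eq_lintegral_ofReal]
  · exact (continuous_weighted g.continuous _ hs.le ℓ).integrable_of_hasCompactSupport
      (hasCompactSupport_weighted g _ hℓ hs.ne')
  · exact ae_of_all _ fun v =>
      mul_nonneg (Real.rpow_nonneg (bracket_pos v).le _) (posPow_nonneg _ _)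

/-- Hölder's inequality with exponents `3` and `3/2`, in which the second factor may be shifted
by a bounded amount: the weights at `v` and `v - z` are comparable. -/
lemma lintegral_shift_le {g : 𝓢(E3, ℝ)} {K ε : ℝ}
    (hε : ∫⁻ v, ENNReal.ofReal (bracket v ^ (9 / 2 : ℝ) * levelPart K g v ^ (3 / 2 : ℝ))
      ≤ ENNReal.ofReal ε) (hε0 : 0 ≤ ε) {ℓ : ℝ} (hℓ : 0 < ℓ) {z : E3} (hz : ‖z‖ ≤ 1) :
    ∫⁻ v, ENNReal.ofReal (bracket v ^ (9 / 2 : ℝ) * posPow (5 / 2) (g v - ℓ))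
        * ENNReal.ofReal (levelPart K g (v - z))
      ≤ ENNReal.ofReal (8 * ε ^ (2 / 3 : ℝ) * sobolevNorm ℓ g) := by
  have hlc : Continuous (levelPart K g) := (g.continuous.sub continuous_const).max continuous_const
  have hln (v : E3) : 0 ≤ levelPart K g v := le_max_right _ _
  set F : E3 → ℝ≥0∞ := fun v => ENNReal.ofReal (bracket v ^ (3 / 2 : ℝ) * posPow (5 / 2) (g v - ℓ))
  set G : E3 → ℝ≥0∞ := fun v => ENNReal.ofReal (bracket v ^ (3 : ℝ) * levelPart K g v)
  have hFm : Measurable F :=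
    (continuous_weighted g.continuous _ (by norm_num) ℓ).measurable.ennreal_ofReal
  have hGm : Measurable G :=
    ((continuous_bracket_rpow 3).mul hlc).measurable.ennreal_ofReal
  have hpt (v : E3) : ENNReal.ofReal (bracket v ^ (9 / 2 : ℝ) * posPow (5 / 2) (g v - ℓ))
        * ENNReal.ofReal (levelPart K g (v - z)) ≤ ENNReal.ofReal 8 * (F * fun v => G (v - z)) v := by
    have hb := bracket_pos v
    have hb' := bracket_pos (v - z)
    simp only [Pi.mul_apply, F, G]
    have hP := posPow_nonneg (5 / 2) (g v - ℓ)
    rw [← ENNReal.ofReal_mul (by positivity), ← ENNReal.ofReal_mul (by positivity),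
      ← ENNReal.ofReal_mul (by norm_num)]
    refine ENNReal.ofReal_le_ofReal ?_
    have h1 : bracket v ^ (9 / 2 : ℝ) = bracket v ^ (3 / 2 : ℝ) * bracket v ^ (3 : ℝ) := by
      rw [← Real.rpow_add hb]; norm_num
    have h2 : bracket v ^ (3 : ℝ) ≤ 8 * bracket (v - z) ^ (3 : ℝ) := by
      have := bracket_le_of_norm_sub_le (v := v) (w := v - z) (by simpa using hz)
      calc bracket v ^ (3 : ℝ) ≤ (2 * bracket (v - z)) ^ (3 : ℝ) := by gcongr
        _ = _ := by rw [Real.mul_rpow (by norm_num) hb'.le]; norm_num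
    rw [h1]
    calc bracket v ^ (3 / 2 : ℝ) * bracket v ^ (3 : ℝ) * posPow (5 / 2) (g v - ℓ)
          * levelPart K g (v - z)
        ≤ bracket v ^ (3 / 2 : ℝ) * (8 * bracket (v - z) ^ (3 : ℝ)) * posPow (5 / 2) (g v - ℓ)
          * levelPart K g (v - z) := by
          gcongr
          exact hln _
      _ = _ := by ring
  have hFp : ∫⁻ v, F v ^ (3 : ℝ) = ENNReal.ofReal (levelIntegral (15 / 2) ℓ g) := by
    rw [← lintegral_rpow_eq_levelIntegral hℓ (by norm_num)]
    congr 1; ext v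
    have hb := bracket_pos v
    have hP := posPow_nonneg (5 / 2) (g v - ℓ)
    rw [ENNReal.ofReal_rpow_of_nonneg (by positivity) (by norm_num),
      Real.mul_rpow (by positivity) hP, posPow_rpow, ← Real.rpow_mul hb.le]
    norm_num
  have hGp : ∫⁻ v, G (v - z) ^ (3 / 2 : ℝ) ≤ ENNReal.ofReal ε := by
    rw [lintegral_sub_right_eq_self (fun v => G v ^ (3 / 2 : ℝ)) z]
    refine le_trans (le_of_eq ?_) hε
    congr 1; ext v
    have hb := bracket_pos v
    rw [ENNReal.ofReal_rpow_of_nonneg (mul_nonneg (by positivity) (hln v)) (by norm_num),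
      Real.mul_rpow (by positivity) (hln v), ← Real.rpow_mul hb.le]
    norm_num
  calc _ ≤ ∫⁻ v, ENNReal.ofReal 8 * (F * fun v => G (v - z)) v := lintegral_mono hpt
    _ = ENNReal.ofReal 8 * ∫⁻ v, (F * fun v => G (v - z)) v := by
        rw [lintegral_const_mul]
        exact hFm.mul (hGm.comp (measurable_id.sub_const z))
    _ ≤ ENNReal.ofReal 8 * ((∫⁻ v, F v ^ (3 : ℝ)) ^ (1 / 3 : ℝ)
          * (∫⁻ v, G (v - z) ^ (3 / 2 : ℝ)) ^ (1 / (3 / 2) : ℝ)) := by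
        gcongr
        exact ENNReal.lintegral_mul_le_Lp_mul_Lq volume
          (Real.holderConjugate_iff.mpr ⟨by norm_num, by norm_num⟩) hFm.aemeasurable
          (hGm.comp (measurable_id.sub_const z)).aemeasurable
    _ ≤ ENNReal.ofReal 8 * (ENNReal.ofReal (levelIntegral (15 / 2) ℓ g) ^ (1 / 3 : ℝ)
          * (ENNReal.ofReal ε) ^ (1 / (3 / 2) : ℝ)) := by
        rw [hFp]
        gcongr
    _ = _ := by
        rw [ENNReal.ofReal_rpow_of_nonneg (levelIntegral_nonneg _ _ _) (by norm_num),
          ENNReal.ofReal_rpow_of_nonneg hε0 (by norm_num), ← ENNReal.ofReal_mul (by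
            exact sobolevNorm_nonneg ℓ g), ← ENNReal.ofReal_mul (by norm_num)]
        congr 1
        unfold sobolevNorm
        norm_num
        ring

/-- The total mass `∫ |z|⁻² 1_{|z| < 1} dz` of the near kernel. -/
noncomputable def nearMass : ℝ := ∫ z, nearKernel z

lemma nearMass_nonneg : 0 ≤ nearMass := integral_nonneg nearKernel_nonneg

/-- The convolution `(|z|⁻² 1_{|z| < 1} + 1) * g`, which dominates both `|A[g]|` and `|∇a[g]|`. -/
noncomputable def coeffBound (g : E3 → ℝ) : E3 → ℝ := kernelConv (fun z => nearKernel z + 1) g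

lemma weaklySingular_nearKernel_add_one : WeaklySingular fun z => nearKernel z + 1 :=
  ⟨measurable_nearKernel.add_const 1, 1, zero_le_one, fun z => by
    rw [abs_of_nonneg (by linarith [nearKernel_nonneg z]), one_mul]⟩

lemma continuous_coeffBound (g : 𝓢(E3, ℝ)) : Continuous (coeffBound g) :=
  (contDiff_kernelConv weaklySingular_nearKernel_add_one 0 g).continuous

lemma coeffBound_nonneg {g : E3 → ℝ} (hg : ∀ v, 0 ≤ g v) (v : E3) : 0 ≤ coeffBound g v :=
  integral_nonneg fun z => smul_nonneg (by linarith [nearKernel_nonneg z]) (hg _)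

lemma norm_gradient_coeffa_le_coeffBound {g : 𝓢(E3, ℝ)} (hg : ∀ v, 0 ≤ g v) (v : E3) :
    ‖gradient (coeffa g) v‖ ≤ coeffBound g v := by
  refine (norm_gradient_coeffa_le hg v).trans ?_
  refine integral_mono (weaklySingular_inv_norm_sq.integrable_schwartz g v)
    (weaklySingular_nearKernel_add_one.integrable_schwartz g v) fun z => ?_
  exact mul_le_mul_of_nonneg_right (inv_norm_sq_le z) (hg _)

lemma abs_coeffA_le_coeffBound {g : 𝓢(E3, ℝ)} (hg : ∀ v, 0 ≤ g v) (v : E3) (i j : Fin 3) :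
    |coeffA g v i j| ≤ coeffBound g v := by
  refine (abs_coeffA_le hg v i j).trans ?_
  refine integral_mono (weaklySingular_inv_norm.integrable_schwartz g v)
    (weaklySingular_nearKernel_add_one.integrable_schwartz g v) fun z => ?_
  exact mul_le_mul_of_nonneg_right (inv_norm_le z) (hg _)

/-- The coefficients split into the contribution of `min g K`, bounded by `1 + K`, and that of
`(g - K)_+`, which is small in the critical norm and is absorbed by the Sobolev norm. -/
lemma integral_mul_coeffBound_le {g : 𝓢(E3, ℝ)} (hg : ∀ v, 0 ≤ g v) (hmass : ∫ v, g v ≤ 1)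
    {K ε : ℝ} (hK : 0 ≤ K)
    (hε : ∫⁻ v, ENNReal.ofReal (bracket v ^ (9 / 2 : ℝ) * levelPart K g v ^ (3 / 2 : ℝ))
      ≤ ENNReal.ofReal ε) (hε0 : 0 ≤ ε) {ℓ : ℝ} (hℓ : 0 < ℓ) :
    ∫ v, bracket v ^ (9 / 2 : ℝ) * posPow (5 / 2) (g v - ℓ) * coeffBound g v
      ≤ (1 + K * nearMass) * levelIntegral (5 / 2) ℓ g
        + 8 * nearMass * ε ^ (2 / 3 : ℝ) * sobolevNorm ℓ g := by
  have hlc : Continuous (levelPart K g) := (g.continuous.sub continuous_const).max continuous_const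
  have hln (v : E3) : 0 ≤ levelPart K g v := le_max_right _ _
  set w : E3 → ℝ := fun v => bracket v ^ (9 / 2 : ℝ) * posPow (5 / 2) (g v - ℓ)
  have hw0 (v : E3) : 0 ≤ w v :=
    mul_nonneg (Real.rpow_nonneg (bracket_pos v).le _) (posPow_nonneg _ _)
  have hwc : Continuous w := continuous_weighted g.continuous _ (by norm_num) ℓ
  have hwm : Measurable fun v => ENNReal.ofReal (w v) := hwc.measurable.ennreal_ofReal
  have hws : HasCompactSupport w := hasCompactSupport_weighted g _ hℓ (by norm_num)
  have hnm : Measurable fun z => ENNReal.ofReal (nearKernel z) :=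
    measurable_nearKernel.ennreal_ofReal
  have hnI : ∫⁻ z, ENNReal.ofReal (nearKernel z) = ENNReal.ofReal nearMass :=
    (ofReal_integral_eq_lintegral_ofReal integrable_nearKernel
      (ae_of_all _ nearKernel_nonneg)).symm
  have hgi : Integrable g := (fourthOrderDecay_schwartz g).integrable g.continuous
  -- `J` is the contribution of `(g - K)_+` near the singularity of the kernel
  set J : E3 → ℝ≥0∞ := fun v =>
    ∫⁻ z, ENNReal.ofReal (nearKernel z) * ENNReal.ofReal (levelPart K g (v - z))
  have hB (v : E3) : ENNReal.ofReal (coeffBound g v)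
      ≤ ENNReal.ofReal (1 + K * nearMass) + J v := by
    have e1 : ENNReal.ofReal (coeffBound g v)
        = ∫⁻ z, ENNReal.ofReal ((nearKernel z + 1) * g (v - z)) :=
      ofReal_integral_eq_lintegral_ofReal
        (weaklySingular_nearKernel_add_one.integrable_schwartz g v)
        (ae_of_all _ fun z => mul_nonneg (by linarith [nearKernel_nonneg z]) (hg _))
    have hpt (z : E3) : ENNReal.ofReal ((nearKernel z + 1) * g (v - z)) ≤
        ENNReal.ofReal (nearKernel z * K) + ENNReal.ofReal (g (v - z))
          + ENNReal.ofReal (nearKernel z) * ENNReal.ofReal (levelPart K g (v - z)) := by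
      have hn := nearKernel_nonneg z
      rw [← ENNReal.ofReal_add (by positivity) (hg _), ← ENNReal.ofReal_mul hn,
        ← ENNReal.ofReal_add (add_nonneg (by positivity) (hg _)) (mul_nonneg hn (hln _))]
      refine ENNReal.ofReal_le_ofReal ?_
      have : g (v - z) ≤ K + levelPart K g (v - z) := by
        unfold levelPart; linarith [le_max_left (g (v - z) - K) 0]
      nlinarith [mul_le_mul_of_nonneg_left this hn]
    rw [e1]
    refine (lintegral_mono hpt).trans ?_
    rw [lintegral_add_left, lintegral_add_left]
    · gcongr ?_ + J v
      have i1 : ∫⁻ z, ENNReal.ofReal (nearKernel z * K) = ENNReal.ofReal (K * nearMass) := by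
        rw [← ofReal_integral_eq_lintegral_ofReal (integrable_nearKernel.mul_const K)
          (ae_of_all _ fun z => mul_nonneg (nearKernel_nonneg z) hK), integral_mul_const, mul_comm]
        rfl
      have i2 : ∫⁻ z, ENNReal.ofReal (g (v - z)) ≤ ENNReal.ofReal 1 := by
        rw [lintegral_sub_left_eq_self (fun w => ENNReal.ofReal (g w)) v,
          ← ofReal_integral_eq_lintegral_ofReal hgi (ae_of_all _ hg)]
        exact ENNReal.ofReal_le_ofReal hmass
      rw [i1, add_comm (1 : ℝ), ENNReal.ofReal_add (mul_nonneg hK nearMass_nonneg) zero_le_one]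
      gcongr
    · exact (measurable_nearKernel.mul_const K).ennreal_ofReal
    · exact ((measurable_nearKernel.mul_const K).ennreal_ofReal).add
        (g.continuous.comp (continuous_const.sub continuous_id)).measurable.ennreal_ofReal
  -- after exchanging the integrals, Hölder's inequality is applied for each fixed shift `z`
  have hswap : ∫⁻ v, ENNReal.ofReal (w v) * J v ≤
      ENNReal.ofReal nearMass * ENNReal.ofReal (8 * ε ^ (2 / 3 : ℝ) * sobolevNorm ℓ g) := by
    have h1 : ∫⁻ v, ENNReal.ofReal (w v) * J v = ∫⁻ v, ∫⁻ z, ENNReal.ofReal (w v) *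
        (ENNReal.ofReal (nearKernel z) * ENNReal.ofReal (levelPart K g (v - z))) := by
      congr 1; ext v
      rw [lintegral_const_mul]
      exact hnm.mul (hlc.comp (continuous_const.sub continuous_id)).measurable.ennreal_ofReal
    rw [h1, lintegral_lintegral_swap]
    · rw [← hnI, ← lintegral_mul_const _ hnm]
      refine lintegral_mono fun z => ?_
      have h2 : ∫⁻ v, ENNReal.ofReal (w v) *
          (ENNReal.ofReal (nearKernel z) * ENNReal.ofReal (levelPart K g (v - z)))
          = ENNReal.ofReal (nearKernel z) *
            ∫⁻ v, ENNReal.ofReal (w v) * ENNReal.ofReal (levelPart K g (v - z)) := by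
        rw [← lintegral_const_mul]
        · congr 1; ext v; ring
        · exact hwm.mul (hlc.comp (continuous_id.sub continuous_const)).measurable.ennreal_ofReal
      rw [h2]
      by_cases hz : z ∈ Metric.ball (0 : E3) 1
      · gcongr
        exact lintegral_shift_le hε hε0 hℓ (le_of_lt (by simpa using hz))
      · simp [nearKernel, indicator_of_notMem hz]
    · refine Measurable.aemeasurable ?_
      exact (hwm.comp measurable_fst).mul ((hnm.comp measurable_snd).mul
        ((hlc.comp (continuous_fst.sub continuous_snd)).measurable.ennreal_ofReal))
  have hS := sobolevNorm_nonneg ℓ g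
  have hY := levelIntegral_nonneg (5 / 2) ℓ g
  have hn := nearMass_nonneg
  refine (ENNReal.ofReal_le_ofReal_iff (by positivity)).1 ?_
  refine (le_of_eq (ofReal_integral_eq_lintegral_ofReal (f := fun v => w v * coeffBound g v)
    ((hwc.mul (continuous_coeffBound g)).integrable_of_hasCompactSupport hws.mul_right)
    (ae_of_all _ fun v => mul_nonneg (hw0 v) (coeffBound_nonneg hg v)))).trans ?_
  calc ∫⁻ v, ENNReal.ofReal (w v * coeffBound g v)
      ≤ ∫⁻ v, (ENNReal.ofReal (w v) * ENNReal.ofReal (1 + K * nearMass)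
          + ENNReal.ofReal (w v) * J v) := by
        refine lintegral_mono fun v => ?_
        rw [ENNReal.ofReal_mul (hw0 v), ← mul_add]
        gcongr
        exact hB v
    _ = ENNReal.ofReal (levelIntegral (5 / 2) ℓ g) * ENNReal.ofReal (1 + K * nearMass)
          + ∫⁻ v, ENNReal.ofReal (w v) * J v := by
        rw [lintegral_add_left (hwm.mul_const _), lintegral_mul_const _ hwm,
          lintegral_rpow_eq_levelIntegral hℓ (by norm_num)]
    _ ≤ _ := by
        refine (add_le_add_right hswap _).trans (le_of_eq ?_)
        rw [← ENNReal.ofReal_mul hY, ← ENNReal.ofReal_mul hn, ← ENNReal.ofReal_add (by positivity)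
          (by positivity)]
        congr 1; ring

/-- The quadratic interaction term is absorbed by the Sobolev norm. -/
lemma levelIntegral_seven_half_le {g : 𝓢(E3, ℝ)} {K ε : ℝ}
    (hε : ∫⁻ v, ENNReal.ofReal (bracket v ^ (9 / 2 : ℝ) * levelPart K g v ^ (3 / 2 : ℝ))
      ≤ ENNReal.ofReal ε) (hε0 : 0 ≤ ε) {ℓ : ℝ} (hℓ : 0 < ℓ) (hKℓ : K ≤ ℓ) :
    levelIntegral (7 / 2) ℓ g ≤ 8 * ε ^ (2 / 3 : ℝ) * sobolevNorm ℓ g := by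
  have hS := sobolevNorm_nonneg ℓ g
  refine (ENNReal.ofReal_le_ofReal_iff (by positivity)).1 ?_
  rw [← lintegral_rpow_eq_levelIntegral hℓ (by norm_num)]
  refine le_trans (lintegral_mono fun v => ?_) (lintegral_shift_le hε hε0 hℓ (z := 0) (by simp))
  have hb := bracket_pos v
  have hP := posPow_nonneg (5 / 2) (g v - ℓ)
  rw [← ENNReal.ofReal_mul (by positivity), sub_zero]
  refine ENNReal.ofReal_le_ofReal ?_
  rw [mul_assoc]
  have h1 : posPow (7 / 2) (g v - ℓ) = posPow (5 / 2) (g v - ℓ) * posPow 1 (g v - ℓ) := by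
    rw [posPow_add (by norm_num) (by norm_num)]; norm_num
  rw [h1]
  gcongr
  unfold posPow levelPart
  rw [Real.rpow_one]
  exact max_le_max_right _ (by linarith)

/-! ### The energy inequality at a fixed time -/

/-- The weighted dissipation `∫ ⟨v⟩^(3/2) (g - ℓ)_+^(1/2) |∇g|²`. -/
noncomputable def dissipation (ℓ : ℝ) (g : E3 → ℝ) : ℝ :=
  ∫ v, bracket v ^ (3 / 2 : ℝ) * posPow (1 / 2) (g v - ℓ) * ‖gradient g v‖ ^ 2

lemma integrable_dissipation (g : 𝓢(E3, ℝ)) {ℓ : ℝ} (hℓ : 0 < ℓ) :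
    Integrable fun v =>
      bracket v ^ (3 / 2 : ℝ) * posPow (1 / 2) (g v - ℓ) * ‖gradient g v‖ ^ 2 :=
  ((continuous_weighted g.continuous _ (by norm_num) ℓ).mul
    ((continuous_gradient (g.smooth 1)).norm.pow 2)).integrable_of_hasCompactSupport
    (hasCompactSupport_weighted g _ hℓ (by norm_num)).mul_right

lemma integrable_levelIntegral (g : 𝓢(E3, ℝ)) {ℓ : ℝ} (hℓ : 0 < ℓ) {s : ℝ} (hs : 0 < s) :
    Integrable fun v => bracket v ^ (9 / 2 : ℝ) * posPow s (g v - ℓ) :=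
  (continuous_weighted g.continuous _ hs.le ℓ).integrable_of_hasCompactSupport
    (hasCompactSupport_weighted g _ hℓ hs.ne')

lemma norm_gradient_weighted_sq_le {g : E3 → ℝ} (hg : ContDiff ℝ 1 g) (ℓ : ℝ) (v : E3) :
    ‖gradient (fun v => bracket v ^ (3 / 4 : ℝ) * posPow (5 / 4) (g v - ℓ)) v‖ ^ 2 ≤
      4 * (bracket v ^ (3 / 2 : ℝ) * posPow (1 / 2) (g v - ℓ) * ‖gradient g v‖ ^ 2)
      + 4 * (bracket v ^ (9 / 2 : ℝ) * posPow (5 / 2) (g v - ℓ)) := by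
  have hb := bracket_pos v
  have hb1 := one_le_bracket v
  have hP := posPow_nonneg (5 / 4) (g v - ℓ)
  have hP' := posPow_nonneg (1 / 4) (g v - ℓ)
  rw [(hasGradientAt_weighted hg _ (by norm_num) ℓ v).gradient]
  have e1 : bracket v ^ (3 / 2 : ℝ) = (bracket v ^ (3 / 4 : ℝ)) ^ 2 := by
    rw [← Real.rpow_natCast, ← Real.rpow_mul hb.le]; norm_num
  have e2 : posPow (1 / 2) (g v - ℓ) = posPow (1 / 4) (g v - ℓ) ^ 2 := by
    rw [← Real.rpow_natCast, posPow_rpow]; norm_num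
  have e3 : posPow (5 / 2) (g v - ℓ) = posPow (5 / 4) (g v - ℓ) ^ 2 := by
    rw [← Real.rpow_natCast, posPow_rpow]; norm_num
  have n1 : ‖bracket v ^ (3 / 4 : ℝ) •
      ((5 / 4 * posPow (5 / 4 - 1) (g v - ℓ)) • gradient g v)‖
      = 5 / 4 * (bracket v ^ (3 / 4 : ℝ) * posPow (1 / 4) (g v - ℓ) * ‖gradient g v‖) := by
    rw [show (5 / 4 - 1 : ℝ) = 1 / 4 by norm_num, norm_smul, norm_smul,
      Real.norm_of_nonneg (by positivity), Real.norm_of_nonneg (by positivity)]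
    ring
  have n2 : ‖posPow (5 / 4) (g v - ℓ) • ((3 / 4 * bracket v ^ (3 / 4 - 2 : ℝ)) • v)‖
      ≤ posPow (5 / 4) (g v - ℓ) := by
    rw [norm_smul, Real.norm_of_nonneg hP]
    refine mul_le_of_le_one_right hP ((norm_gradient_bracket_rpow_le _ v).trans ?_)
    have : bracket v ^ (3 / 4 - 1 : ℝ) ≤ 1 :=
      Real.rpow_le_one_of_one_le_of_nonpos hb1 (by norm_num)
    rw [abs_of_pos (by norm_num)]
    linarith
  have n3 : 1 ≤ bracket v ^ (9 / 2 : ℝ) := Real.one_le_rpow hb1 (by norm_num)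
  rw [e1, e2, e3]
  have ha : 0 ≤ bracket v ^ (3 / 4 : ℝ) * posPow (1 / 4) (g v - ℓ) * ‖gradient g v‖ := by
    positivity
  have htri := (norm_add_le (bracket v ^ (3 / 4 : ℝ) •
      ((5 / 4 * posPow (5 / 4 - 1) (g v - ℓ)) • gradient g v))
      (posPow (5 / 4) (g v - ℓ) • ((3 / 4 * bracket v ^ (3 / 4 - 2 : ℝ)) • v)))
  rw [n1] at htri
  have hsq := pow_le_pow_left₀ (norm_nonneg _) (htri.trans (add_le_add_right n2 _)) 2
  refine hsq.trans ?_
  have hx : posPow (5 / 4) (g v - ℓ) ^ 2 ≤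
      bracket v ^ (9 / 2 : ℝ) * posPow (5 / 4) (g v - ℓ) ^ 2 :=
    le_mul_of_one_le_left (by positivity) n3
  set a := bracket v ^ (3 / 4 : ℝ) * posPow (1 / 4) (g v - ℓ) * ‖gradient g v‖
  have e4 : (bracket v ^ (3 / 4 : ℝ)) ^ 2 * posPow (1 / 4) (g v - ℓ) ^ 2 * ‖gradient g v‖ ^ 2
      = a ^ 2 := by ring
  rw [e4]
  nlinarith [sq_nonneg (5 / 4 * a - posPow (5 / 4) (g v - ℓ))]

/-- The Sobolev inequality applied to `⟨v⟩^(3/4) (g - ℓ)_+^(5/4)`. -/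
lemma exists_sobolevNorm_le : ∃ S : ℝ, 0 < S ∧ ∀ (g : 𝓢(E3, ℝ)) (ℓ : ℝ), 0 < ℓ →
    sobolevNorm ℓ g ≤ S * (dissipation ℓ g + levelIntegral (5 / 2) ℓ g) := by
  obtain ⟨S, hS, h⟩ := exists_sobolev
  refine ⟨4 * S, by positivity, fun g ℓ hℓ => ?_⟩
  set u : E3 → ℝ := fun v => bracket v ^ (3 / 4 : ℝ) * posPow (5 / 4) (g v - ℓ)
  have hu : ContDiff ℝ 1 u := contDiff_weighted (g.smooth 1) _ (by norm_num) ℓ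
  have huc : HasCompactSupport u := hasCompactSupport_weighted g _ hℓ (by norm_num)
  have h6 : sobolevNorm ℓ g = (∫ v, |u v| ^ 6) ^ (1 / 3 : ℝ) := by
    unfold sobolevNorm levelIntegral
    congr 2; ext v
    have hb := bracket_pos v
    have hP := posPow_nonneg (5 / 4) (g v - ℓ)
    simp only [u]
    rw [abs_of_nonneg (by positivity), mul_pow, ← Real.rpow_natCast, ← Real.rpow_natCast,
      posPow_rpow, ← Real.rpow_mul hb.le]
    norm_num
  have hpt (v : E3) : ‖gradient u v‖ ^ 2 ≤
      4 * (bracket v ^ (3 / 2 : ℝ) * posPow (1 / 2) (g v - ℓ) * ‖gradient g v‖ ^ 2)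
      + 4 * (bracket v ^ (9 / 2 : ℝ) * posPow (5 / 2) (g v - ℓ)) :=
    norm_gradient_weighted_sq_le (g.smooth 1) ℓ v
  have i1 : Integrable fun v => ‖gradient u v‖ ^ 2 :=
    ((continuous_gradient hu).norm.pow 2).integrable_of_hasCompactSupport
      ((hasCompactSupport_gradient huc).mono fun v hv hv' => hv (by simp [hv']))
  have i2 := (integrable_dissipation g hℓ).const_mul 4
  have i3 := (integrable_levelIntegral g hℓ (s := 5 / 2) (by norm_num)).const_mul 4
  have hint : ∫ v, ‖gradient u v‖ ^ 2 ≤ 4 * dissipation ℓ g + 4 * levelIntegral (5 / 2) ℓ g := by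
    unfold dissipation levelIntegral
    rw [← integral_const_mul, ← integral_const_mul, ← integral_add i2 i3]
    exact integral_mono_of_nonneg (ae_of_all _ fun v => sq_nonneg _) (i2.add i3)
      (ae_of_all _ hpt)
  rw [h6]
  refine (h u hu huc).trans ?_
  have := mul_le_mul_of_nonneg_left hint hS.le
  linarith

/-- The pointwise form of the energy inequality: the cross term between the gradients of the
solution and of the weight is absorbed by the Cauchy-Schwarz inequality for the matrix `A[g]`. -/
lemma neg_inner_gradient_weighted_le {g : 𝓢(E3, ℝ)} (hg : ∀ v, 0 ≤ g v) {c₀ : ℝ}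
    (hc₀ : 0 < c₀) {v : E3}
    (hA : (coeffA g v - (c₀ * (bracket v ^ 3)⁻¹) • (1 : Matrix (Fin 3) (Fin 3) ℝ)).PosSemidef)
    (ℓ : ℝ) :
    -⟪bracket v ^ (9 / 2 : ℝ) • ((3 / 2 * posPow (1 / 2) (g v - ℓ)) • gradient g v)
        + posPow (3 / 2) (g v - ℓ) • ((9 / 2 * bracket v ^ (9 / 2 - 2 : ℝ)) • v),
        Matrix.toEuclideanLin (coeffA g v) (gradient g v)⟫
      ≤ -(c₀ * (bracket v ^ (3 / 2 : ℝ) * posPow (1 / 2) (g v - ℓ) * ‖gradient g v‖ ^ 2))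
        + 92 * (bracket v ^ (9 / 2 : ℝ) * posPow (5 / 2) (g v - ℓ) * coeffBound g v) := by
  have hb := bracket_pos v
  set A := coeffA g v
  set G := gradient g v
  set W : E3 := (9 / 2 * bracket v ^ (9 / 2 - 2 : ℝ)) • v with hW
  set p := posPow (1 / 4) (g v - ℓ)
  have hp : 0 ≤ p := posPow_nonneg _ _
  set s := bracket v ^ (9 / 4 : ℝ)
  have hs : 0 < s := Real.rpow_pos_of_pos hb _
  have e1 : posPow (1 / 2) (g v - ℓ) = p ^ 2 := by
    rw [← Real.rpow_natCast, posPow_rpow]; norm_num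
  have e2 : posPow (3 / 2) (g v - ℓ) = p ^ 6 := by
    rw [← Real.rpow_natCast, posPow_rpow]; norm_num
  have e3 : posPow (5 / 2) (g v - ℓ) = p ^ 10 := by
    rw [← Real.rpow_natCast, posPow_rpow]; norm_num
  have e4 : bracket v ^ (9 / 2 : ℝ) = s ^ 2 := by
    rw [← Real.rpow_natCast, ← Real.rpow_mul hb.le]; norm_num
  have e5 : bracket v ^ (3 / 2 : ℝ) = s ^ 2 * (bracket v ^ 3)⁻¹ := by
    rw [← e4, ← div_eq_mul_inv, eq_div_iff (by positivity), ← Real.rpow_natCast,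
      ← Real.rpow_add hb]
    norm_num
  have hWn : ‖W‖ ≤ 9 / 2 * s ^ 2 := by
    refine (norm_gradient_bracket_rpow_le _ v).trans ?_
    rw [abs_of_pos (by norm_num), ← e4]
    gcongr
    · exact one_le_bracket v
    · norm_num
  have hpos : ∀ x : E3, c₀ * (bracket v ^ 3)⁻¹ * ‖x‖ ^ 2 ≤ ⟪x, Matrix.toEuclideanLin A x⟫ :=
    le_inner_toEuclideanLin hA
  have hN := coeffBound_nonneg hg v
  -- positivity of the form at `s p ∇g + (p⁵ / s) ∇⟨v⟩^(9/2)`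
  have h1 := (show 0 ≤ c₀ * (bracket v ^ 3)⁻¹ * ‖(s * p) • G + (p ^ 5 / s) • W‖ ^ 2 by
    positivity).trans (hpos ((s * p) • G + (p ^ 5 / s) • W))
  have h2 := hpos G
  have h3 : ⟪W, Matrix.toEuclideanLin A W⟫ ≤ 9 * coeffBound g v * (9 / 2 * s ^ 2) ^ 2 :=
    by
    have := (le_abs_self _).trans
      (abs_inner_toEuclideanLin_le (abs_coeffA_le_coeffBound hg v) W W)
    rw [mul_assoc, ← sq] at this
    exact this.trans (by gcongr)
  have hsym : ⟪G, Matrix.toEuclideanLin A W⟫ = ⟪W, Matrix.toEuclideanLin A G⟫ :=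
    inner_toEuclideanLin_symm hA _ _
  simp only [map_add, map_smul, inner_add_left, inner_add_right, inner_smul_left,
    inner_smul_right, conj_trivial, hsym] at h1
  rw [e1, e2, e3, e4, e5]
  simp only [inner_add_left, inner_smul_left, conj_trivial]
  set qG := ⟪G, Matrix.toEuclideanLin A G⟫
  set qW := ⟪W, Matrix.toEuclideanLin A W⟫
  set x := ⟪W, Matrix.toEuclideanLin A G⟫
  have h1' : 0 ≤ s ^ 2 * p ^ 2 * qG + 2 * p ^ 6 * x + p ^ 10 / s ^ 2 * qW := by
    refine h1.trans (le_of_eq ?_)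
    field_simp
    ring
  have h3' : p ^ 10 / s ^ 2 * qW ≤ p ^ 10 / s ^ 2 * (9 * coeffBound g v * (9 / 2 * s ^ 2) ^ 2) := by
    gcongr
  have e6 : p ^ 10 / s ^ 2 * (9 * coeffBound g v * (9 / 2 * s ^ 2) ^ 2)
      = 729 / 4 * (s ^ 2 * p ^ 10 * coeffBound g v) := by
    field_simp
    ring
  have h2' := mul_le_mul_of_nonneg_left h2 (by positivity : 0 ≤ s ^ 2 * p ^ 2)
  have hT : 0 ≤ s ^ 2 * p ^ 10 * coeffBound g v := by positivity
  rw [e6] at h3'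
  have goal_eq : c₀ * (s ^ 2 * (bracket v ^ 3)⁻¹ * p ^ 2 * ‖G‖ ^ 2)
      = s ^ 2 * p ^ 2 * (c₀ * (bracket v ^ 3)⁻¹ * ‖G‖ ^ 2) := by ring
  rw [goal_eq]
  linarith

/-- Tested against `⟨v⟩^(9/2) (g - ℓ)_+^(3/2)`, the drift is a potential plus an error carried by
the gradient of the weight; the Poisson equation turns the potential into powers of `g`. -/
lemma integral_drift_le {g : 𝓢(E3, ℝ)} (hg : ∀ v, 0 ≤ g v) {ℓ : ℝ} (hℓ : 0 < ℓ) :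
    ∫ v, g v * ⟪bracket v ^ (9 / 2 : ℝ) • ((3 / 2 * posPow (1 / 2) (g v - ℓ)) • gradient g v)
        + posPow (3 / 2) (g v - ℓ) • ((9 / 2 * bracket v ^ (9 / 2 - 2 : ℝ)) • v),
        gradient (coeffa g) v⟫
      ≤ 2 * (∫ v, bracket v ^ (9 / 2 : ℝ) * posPow (5 / 2) (g v - ℓ) * coeffBound g v)
        + sourceStrength * (levelIntegral (7 / 2) ℓ g + 2 * ℓ * levelIntegral (5 / 2) ℓ g
          + ℓ ^ 2 * levelIntegral (3 / 2) ℓ g) := by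
  set φ : E3 → ℝ := fun v => bracket v ^ (9 / 2 : ℝ) with hφ
  set W : E3 → E3 := fun v => (9 / 2 * bracket v ^ (9 / 2 - 2 : ℝ)) • v with hW
  have hWc : Continuous W :=
    (continuous_const.mul (continuous_bracket_rpow _)).smul continuous_id
  set a' := gradient (coeffa g) with ha'
  have ha'1 : ContDiff ℝ 1 a' := contDiff_gradient (contDiff_coeffa g 2) (by norm_num)
  -- `Ψ` is chosen such that `g ∇((g - ℓ)_+^(3/2)) φ` is the part of `∇Ψ` with derivatives of `g`
  set Ψ : E3 → ℝ := fun v =>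
    3 / 5 * (φ v * posPow (5 / 2) (g v - ℓ)) + ℓ * (φ v * posPow (3 / 2) (g v - ℓ)) with hΨ
  have hΨ1 : ContDiff ℝ 1 Ψ :=
    (contDiff_const.mul (contDiff_weighted (g.smooth 1) _ (by norm_num) ℓ)).add
      (contDiff_const.mul (contDiff_weighted (g.smooth 1) _ (by norm_num) ℓ))
  have hΨc : HasCompactSupport Ψ :=
    (hasCompactSupport_weighted g _ hℓ (by norm_num)).mul_left.add
      (hasCompactSupport_weighted g _ hℓ (by norm_num)).mul_left
  have hΨg (v : E3) : gradient Ψ v =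
      (3 / 5 : ℝ) • (φ v • ((5 / 2 * posPow (5 / 2 - 1) (g v - ℓ)) • gradient g v)
          + posPow (5 / 2) (g v - ℓ) • W v)
        + ℓ • (φ v • ((3 / 2 * posPow (3 / 2 - 1) (g v - ℓ)) • gradient g v)
          + posPow (3 / 2) (g v - ℓ) • W v) := by
    have g1 := hasGradientAt_weighted (g.smooth 1) (9 / 2) (s := 5 / 2) (by norm_num) ℓ v
    have g2 := hasGradientAt_weighted (g.smooth 1) (9 / 2) (s := 3 / 2) (by norm_num) ℓ v
    refine HasGradientAt.gradient ?_
    rw [hasGradientAt_iff_hasFDerivAt] at g1 g2 ⊢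
    exact ((g1.const_mul (3 / 5)).add (g2.const_mul ℓ)).congr_fderiv (by ext; simp [hφ, hW])
  have hlin (v : E3) (s : ℝ) (hs : 0 < s) :
      g v * posPow s (g v - ℓ) = posPow (s + 1) (g v - ℓ) + ℓ * posPow s (g v - ℓ) := by
    rw [← posPow_add hs one_pos]
    rcases le_or_gt (g v - ℓ) 0 with h | h
    · rw [posPow_of_nonpos hs.ne' h]; ring
    · rw [posPow_of_nonneg (r := 1) h.le, Real.rpow_one]; ring
  have hid (v : E3) : g v * ⟪φ v • ((3 / 2 * posPow (1 / 2) (g v - ℓ)) • gradient g v)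
        + posPow (3 / 2) (g v - ℓ) • W v, a' v⟫
      = ⟪gradient Ψ v, a' v⟫ + 2 / 5 * (posPow (5 / 2) (g v - ℓ) * ⟪W v, a' v⟫) := by
    rw [hΨg]
    have l1 := hlin v (1 / 2) (by norm_num)
    have l2 := hlin v (3 / 2) (by norm_num)
    norm_num at l1 l2
    norm_num
    simp only [inner_add_left, inner_smul_left, conj_trivial]
    linear_combination (3 / 2 * φ v * ⟪gradient g v, a' v⟫) * l1 + ⟪W v, a' v⟫ * l2
  have hPoisson : ∫ v, ⟪gradient Ψ v, a' v⟫ = (4 * Real.pi)⁻¹ * sourceStrength *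
      (3 / 5 * levelIntegral (7 / 2) ℓ g + 8 / 5 * ℓ * levelIntegral (5 / 2) ℓ g
        + ℓ ^ 2 * levelIntegral (3 / 2) ℓ g) := by
    have h1 := integral_mul_divergence hΨ1 hΨc ha'1
    rw [eq_neg_iff_add_eq_zero, add_comm, ← eq_neg_iff_add_eq_zero] at h1
    rw [h1, ← integral_neg]
    have e (v : E3) : -(Ψ v * divergence a' v) = (4 * Real.pi)⁻¹ * sourceStrength *
        (3 / 5 * (φ v * posPow (7 / 2) (g v - ℓ)) + 8 / 5 * ℓ * (φ v * posPow (5 / 2) (g v - ℓ))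
          + ℓ ^ 2 * (φ v * posPow (3 / 2) (g v - ℓ))) := by
      rw [ha', divergence_gradient_coeffa, hΨ]
      have l1 := hlin v (5 / 2) (by norm_num)
      have l2 := hlin v (3 / 2) (by norm_num)
      norm_num at l1 l2
      linear_combination ((4 * Real.pi)⁻¹ * sourceStrength * φ v) * (3 / 5 * l1 + ℓ * l2)
    simp_rw [e]
    have i1 := integrable_levelIntegral g hℓ (s := 7 / 2) (by norm_num)
    have i2 := integrable_levelIntegral g hℓ (s := 5 / 2) (by norm_num)
    have i3 := integrable_levelIntegral g hℓ (s := 3 / 2) (by norm_num)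
    have i12 : Integrable fun v => 3 / 5 * (φ v * posPow (7 / 2) (g v - ℓ))
        + 8 / 5 * ℓ * (φ v * posPow (5 / 2) (g v - ℓ)) := (i1.const_mul _).add (i2.const_mul _)
    rw [integral_const_mul, integral_add i12 (i3.const_mul _),
      integral_add (i1.const_mul _) (i2.const_mul _), integral_const_mul, integral_const_mul,
      integral_const_mul]
    rfl
  have hI1 : Integrable fun v => ⟪gradient Ψ v, a' v⟫ := by
    refine ((continuous_gradient hΨ1).inner ha'1.continuous).integrable_of_hasCompactSupport ?_
    exact (hasCompactSupport_gradient hΨc).mono fun v hv hv' => hv (by simp [hv'])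
  have hPc : Continuous fun v => posPow (5 / 2) (g v - ℓ) :=
    (continuous_posPow (by norm_num)).comp (g.continuous.sub continuous_const)
  have hI2 : Integrable fun v => 2 / 5 * (posPow (5 / 2) (g v - ℓ) * ⟪W v, a' v⟫) :=
    (Continuous.integrable_of_hasCompactSupport
      (hPc.mul (hWc.inner ha'1.continuous))
      (hasCompactSupport_posPow g hℓ (by norm_num)).mul_right).const_mul _
  have hI3 : Integrable fun v => φ v * posPow (5 / 2) (g v - ℓ) * coeffBound g v :=
    ((continuous_weighted g.continuous _ (by norm_num) ℓ).mul
      (continuous_coeffBound g)).integrable_of_hasCompactSupport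
      (hasCompactSupport_weighted g _ hℓ (by norm_num)).mul_right
  refine (integral_congr_ae (ae_of_all _ hid)).trans_le ?_
  rw [integral_add hI1 hI2, hPoisson, add_comm]
  refine add_le_add ?_ ?_
  · rw [← integral_const_mul]
    refine integral_mono hI2 (hI3.const_mul _) fun v => ?_
    have hP := posPow_nonneg (5 / 2) (g v - ℓ)
    have hb := bracket_pos v
    have hWn : ‖W v‖ ≤ 9 / 2 * φ v := by
      refine (norm_gradient_bracket_rpow_le _ v).trans ?_
      rw [abs_of_pos (by norm_num)]
      exact mul_le_mul_of_nonneg_left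
        (Real.rpow_le_rpow_of_exponent_le (one_le_bracket v) (by norm_num)) (by norm_num)
    have hin : ⟪W v, a' v⟫ ≤ 9 / 2 * φ v * coeffBound g v :=
      (real_inner_le_norm _ _).trans (mul_le_mul hWn (norm_gradient_coeffa_le_coeffBound hg v)
        (norm_nonneg _) (by positivity))
    have := mul_le_mul_of_nonneg_left hin hP
    have h0 : 0 ≤ φ v * posPow (5 / 2) (g v - ℓ) * coeffBound g v :=
      mul_nonneg (by positivity) (coeffBound_nonneg hg v)
    nlinarith
  · have hpi : (4 * Real.pi)⁻¹ ≤ 1 := inv_le_one_of_one_le₀ (by nlinarith [Real.pi_gt_three])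
    have h7 := levelIntegral_nonneg (7 / 2) ℓ g
    have h5 := levelIntegral_nonneg (5 / 2) ℓ g
    have h3 := levelIntegral_nonneg (3 / 2) ℓ g
    have hs := sourceStrength_nonneg
    refine mul_le_mul (mul_le_of_le_one_left hs hpi) ?_ (by positivity) hs
    have : 0 ≤ ℓ * levelIntegral (5 / 2) ℓ g := by positivity
    linarith

/-- The energy inequality: as long as the critical norm of `(g - K)_+` is small, the energy of
`(g - ℓ)_+` dissipates its Sobolev norm up to terms of lower order. -/
lemma exists_energy_inequality {c₀ : ℝ} (hc₀ : 0 < c₀) :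
    ∃ ε₀ : ℝ, 0 < ε₀ ∧ ∃ c : ℝ, 0 < c ∧ ∃ C : ℝ, 0 < C ∧ ∀ g : 𝓢(E3, ℝ), (∀ v, 0 ≤ g v) →
      ∫ v, g v ≤ 1 →
      (∀ v, (coeffA g v
        - (c₀ * (bracket v ^ 3)⁻¹) • (1 : Matrix (Fin 3) (Fin 3) ℝ)).PosSemidef) →
      ∀ K, 0 ≤ K → ∀ ε, 0 ≤ ε → ε ≤ ε₀ →
      ∫⁻ v, ENNReal.ofReal (bracket v ^ (9 / 2 : ℝ) * levelPart K g v ^ (3 / 2 : ℝ))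
        ≤ ENNReal.ofReal ε →
      ∀ ℓ, 1 ≤ ℓ → K ≤ ℓ →
      5 / 2 * ∫ v, bracket v ^ (9 / 2 : ℝ) * posPow (3 / 2) (g v - ℓ) * divergence (flux g) v
        ≤ C * (ℓ * levelIntegral (5 / 2) ℓ g + ℓ ^ 2 * levelIntegral (3 / 2) ℓ g)
          - c * sobolevNorm ℓ g := by
  obtain ⟨S, hS, hSob⟩ := exists_sobolevNorm_le
  have hn := nearMass_nonneg
  have hs := sourceStrength_nonneg
  -- `κ ε^(2/3) U` collects the critical terms; `η` bounds `ε^(2/3)` such that they consume at most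
  -- half of the dissipation. The weight contributes `92` from the diffusion and `2` from the drift.
  set κ : ℝ := 94 * (8 * nearMass) + 8 * sourceStrength with hκ
  have hκ0 : 0 ≤ κ := by positivity
  set η : ℝ := c₀ / (2 * S * (κ + 1)) with hη
  have hη0 : 0 < η := by positivity
  refine ⟨η ^ (3 / 2 : ℝ), by positivity, 5 / 2 * (c₀ / (2 * S)), by positivity,
    5 / 2 * (c₀ + 94 * (1 + nearMass) + 2 * sourceStrength), by positivity, ?_⟩
  intro g hg hmass hA K hK ε hε0 hεη hε ℓ hℓ1 hKℓ
  have hℓ : 0 < ℓ := by linarith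
  set ψ : E3 → ℝ := fun v => bracket v ^ (9 / 2 : ℝ) * posPow (3 / 2) (g v - ℓ) with hψ
  have hψ1 : ContDiff ℝ 1 ψ := contDiff_weighted (g.smooth 1) _ (by norm_num) ℓ
  have hψc : HasCompactSupport ψ := hasCompactSupport_weighted g _ hℓ (by norm_num)
  have hψg (v : E3) : gradient ψ v =
      bracket v ^ (9 / 2 : ℝ) • ((3 / 2 * posPow (1 / 2) (g v - ℓ)) • gradient g v)
        + posPow (3 / 2) (g v - ℓ) • ((9 / 2 * bracket v ^ (9 / 2 - 2 : ℝ)) • v) := by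
    rw [(hasGradientAt_weighted (g.smooth 1) _ (by norm_num) ℓ v).gradient]
    norm_num
  have ha'1 : ContDiff ℝ 1 (gradient (coeffa g)) :=
    contDiff_gradient (contDiff_coeffa g 2) (by norm_num)
  have hfl := contDiff_flux g
  have hψgs := hasCompactSupport_gradient hψc
  have hJ1 : Integrable fun v => -⟪gradient ψ v, flux g v⟫ := by
    refine (((continuous_gradient hψ1).inner
      hfl.continuous).integrable_of_hasCompactSupport ?_).neg
    exact hψgs.mono fun v hv hv' => hv (by simp [hv'])
  have hJ3 : Integrable fun v => g v * ⟪gradient ψ v, gradient (coeffa g) v⟫ := by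
    refine (g.continuous.mul ((continuous_gradient hψ1).inner
      ha'1.continuous)).integrable_of_hasCompactSupport ?_
    exact hψgs.mono fun v hv hv' => hv (by simp [hv'])
  have hI3 : Integrable fun v =>
      bracket v ^ (9 / 2 : ℝ) * posPow (5 / 2) (g v - ℓ) * coeffBound g v :=
    ((continuous_weighted g.continuous _ (by norm_num) ℓ).mul
      (continuous_coeffBound g)).integrable_of_hasCompactSupport
      (hasCompactSupport_weighted g _ hℓ (by norm_num)).mul_right
  have hID := integrable_dissipation g hℓ
  have hmain : ∫ v, ψ v * divergence (flux g) v ≤ -(c₀ * dissipation ℓ g)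
      + 92 * (∫ v, bracket v ^ (9 / 2 : ℝ) * posPow (5 / 2) (g v - ℓ) * coeffBound g v)
      + ∫ v, g v * ⟪gradient ψ v, gradient (coeffa g) v⟫ := by
    rw [integral_mul_divergence hψ1 hψc hfl, ← integral_neg]
    unfold dissipation
    have k1 : Integrable fun v =>
        -(c₀ * (bracket v ^ (3 / 2 : ℝ) * posPow (1 / 2) (g v - ℓ) * ‖gradient g v‖ ^ 2)) :=
      (hID.const_mul _).neg
    have k2 := hI3.const_mul 92
    have k12 : Integrable fun v =>
        -(c₀ * (bracket v ^ (3 / 2 : ℝ) * posPow (1 / 2) (g v - ℓ) * ‖gradient g v‖ ^ 2))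
          + 92 * (bracket v ^ (9 / 2 : ℝ) * posPow (5 / 2) (g v - ℓ) * coeffBound g v) :=
      k1.add k2
    rw [← integral_const_mul, ← integral_const_mul, ← integral_neg, ← integral_add k1 k2,
      ← integral_add k12 hJ3]
    refine integral_mono hJ1 (k12.add hJ3) fun v => ?_
    have h := neg_inner_gradient_weighted_le hg hc₀ (hA v) ℓ
    rw [← hψg] at h
    simp only [flux, inner_sub_right, inner_smul_right]
    linarith
  have hdrift := integral_drift_le hg hℓ
  simp_rw [← hψg] at hdrift
  have hcb := integral_mul_coeffBound_le hg hmass hK hε hε0 hℓ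
  have h72 := levelIntegral_seven_half_le hε hε0 hℓ hKℓ
  have hsob := hSob g ℓ hℓ
  have hε' : ε ^ (2 / 3 : ℝ) ≤ η := by
    calc ε ^ (2 / 3 : ℝ) ≤ (η ^ (3 / 2 : ℝ)) ^ (2 / 3 : ℝ) := by gcongr
      _ = η := by rw [← Real.rpow_mul hη0.le]; norm_num
  set Y := levelIntegral (5 / 2) ℓ g
  set Z := levelIntegral (3 / 2) ℓ g
  set U := sobolevNorm ℓ g
  set D := dissipation ℓ g
  set I := ∫ v, ψ v * divergence (flux g) v
  set X := ∫ v, bracket v ^ (9 / 2 : ℝ) * posPow (5 / 2) (g v - ℓ) * coeffBound g v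
  set R := ∫ v, g v * ⟪gradient ψ v, gradient (coeffa g) v⟫
  have hY : 0 ≤ Y := levelIntegral_nonneg _ _ _
  have hZ : 0 ≤ Z := levelIntegral_nonneg _ _ _
  have hU : 0 ≤ U := sobolevNorm_nonneg _ _
  have hκη : κ * ε ^ (2 / 3 : ℝ) * U ≤ c₀ / (2 * S) * U := by
    gcongr
    calc κ * ε ^ (2 / 3 : ℝ) ≤ (κ + 1) * η := by gcongr; linarith
      _ = c₀ / (2 * S) := by rw [hη]; field_simp
  have hD : c₀ / S * U - c₀ * Y ≤ c₀ * D := by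
    have : c₀ / S * U ≤ c₀ / S * (S * (D + Y)) := by gcongr
    have e : c₀ / S * (S * (D + Y)) = c₀ * (D + Y) := by field_simp
    linarith
  have hhalf : c₀ / S * U = 2 * (c₀ / (2 * S) * U) := by field_simp
  have s1 : sourceStrength * levelIntegral (7 / 2) ℓ g ≤
      sourceStrength * (8 * ε ^ (2 / 3 : ℝ) * U) := by gcongr
  have s2 : K * nearMass * Y ≤ ℓ * nearMass * Y := by gcongr
  have s3 : 1 * Y ≤ ℓ * Y := by gcongr
  have s4 : c₀ * (1 * Y) ≤ c₀ * (ℓ * Y) := by gcongr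
  have s5 : 0 ≤ (c₀ + 94 * (1 + nearMass) + sourceStrength) * (ℓ ^ 2 * Z) := by positivity
  have : I ≤ (c₀ + 94 * (1 + nearMass) + 2 * sourceStrength) * (ℓ * Y + ℓ ^ 2 * Z)
      - c₀ / (2 * S) * U := by
    rw [hκ] at hκη
    linarith
  change 5 / 2 * I ≤ _
  linarith

/-! ### Evolution in time and conservation of mass -/

section Evolution
variable {T : ℝ} {f : ℝ → E3 → ℝ}

lemma IsSmoothDecayingSolution.exists_schwartz (hf : IsSmoothDecayingSolution T f) {t : ℝ}
    (ht : t ∈ Icc 0 T) : ∃ g : 𝓢(E3, ℝ), ⇑g = f t := by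
  have hs : ContDiff ℝ ∞ (f t) := by
    rw [← contDiffOn_univ]
    exact hf.smooth.comp (t := Icc 0 T ×ˢ univ) (f := fun v : E3 => (t, v))
      (contDiff_prodMk_right t).contDiffOn fun v _ => ⟨ht, mem_univ _⟩
  refine ⟨⟨f t, hs, fun k n => ?_⟩, rfl⟩
  obtain ⟨C, hC⟩ := hf.decay k n
  exact ⟨C, fun v => hC t ht v⟩

lemma IsSmoothDecayingSolution.continuousOn (hf : IsSmoothDecayingSolution T f) :
    ContinuousOn (fun p : ℝ × E3 => f p.1 p.2) (Icc 0 T ×ˢ univ) := hf.smooth.continuousOn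

lemma IsSmoothDecayingSolution.continuous_slice (hf : IsSmoothDecayingSolution T f) {t : ℝ}
    (ht : t ∈ Icc 0 T) : Continuous (f t) := by
  obtain ⟨g, hg⟩ := hf.exists_schwartz ht
  rw [← hg]; exact g.continuous

/-- In the interior of the time interval the equation expresses the time derivative, which is
jointly continuous. -/
lemma IsSmoothDecayingSolution.hasDerivAt (hf : IsSmoothDecayingSolution T f) {t : ℝ}
    (ht : t ∈ Ioo 0 T) (v : E3) :
    HasDerivAt (fun s => f s v) (divergence (flux (f t)) v) t := by
  have hnh : Icc 0 T ×ˢ (univ : Set E3) ∈ 𝓝 (t, v) :=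
    prod_mem_nhds (Icc_mem_nhds ht.1 ht.2) univ_mem
  have hd : DifferentiableAt ℝ (fun p : ℝ × E3 => f p.1 p.2) (t, v) :=
    (hf.smooth.contDiffAt hnh).differentiableAt (by simp)
  have h1 : DifferentiableAt ℝ (fun s => f s v) t :=
    DifferentiableAt.comp (g := fun p : ℝ × E3 => f p.1 p.2) (f := fun s : ℝ => (s, v)) t hd
      (differentiableAt_id.prodMk (differentiableAt_const v))
  rw [← hf.equation t ht v]
  exact h1.hasDerivAt

lemma IsSmoothDecayingSolution.continuousOn_divergence (hf : IsSmoothDecayingSolution T f) :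
    ContinuousOn (fun p : ℝ × E3 => divergence (flux (f p.1)) p.2) (Ioo 0 T ×ˢ univ) := by
  have hopen : IsOpen (Ioo 0 T ×ˢ (univ : Set E3)) := isOpen_Ioo.prod isOpen_univ
  have h1 : ContDiffOn ℝ ∞ (fun p : ℝ × E3 => f p.1 p.2) (Ioo 0 T ×ˢ univ) :=
    hf.smooth.mono (prod_mono Ioo_subset_Icc_self subset_rfl)
  have h2 := h1.continuousOn_fderiv_of_isOpen hopen (by simp)
  refine (h2.clm_apply (continuousOn_const (c := ((1 : ℝ), (0 : E3))))).congr fun p hp => ?_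
  have hd : DifferentiableAt ℝ (fun p : ℝ × E3 => f p.1 p.2) (p.1, p.2) :=
    (h1.contDiffAt (hopen.mem_nhds hp)).differentiableAt (by simp)
  have h3 : HasDerivAt (fun s : ℝ => (s, p.2)) ((1 : ℝ), (0 : E3)) p.1 :=
    (hasDerivAt_id _).prodMk (hasDerivAt_const _ _)
  have h4 := hd.hasFDerivAt.comp_hasDerivAt p.1 h3
  exact (hf.hasDerivAt hp.1 p.2).unique h4

/-- Differentiation under the integral sign for functionals `∫ χ β(f)` of the solution whose
integrand is supported in a fixed compact set. -/
lemma IsSmoothDecayingSolution.hasDerivAt_integral (hf : IsSmoothDecayingSolution T f)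
    {χ : E3 → ℝ} (hχ : Continuous χ) {β β' : ℝ → ℝ} (hβ : ∀ x, HasDerivAt β (β' x) x)
    (hβ' : Continuous β') {k : Set E3} (hk : IsCompact k)
    (h0 : ∀ s ∈ Icc 0 T, ∀ v, v ∉ k → χ v * β (f s v) = 0)
    (h0' : ∀ s ∈ Icc 0 T, ∀ v, v ∉ k → χ v * β' (f s v) = 0) {t : ℝ} (ht : t ∈ Ioo 0 T) :
    HasDerivAt (fun s => ∫ v, χ v * β (f s v))
      (∫ v, χ v * β' (f t v) * divergence (flux (f t)) v) t := by
  have hβc : Continuous β := continuous_iff_continuousAt.2 fun x => (hβ x).continuousAt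
  obtain ⟨δ, hδ, hball⟩ := Metric.nhds_basis_closedBall.mem_iff.1 (Ioo_mem_nhds ht.1 ht.2)
  have hcont : ContinuousOn
      (fun p : ℝ × E3 => χ p.2 * β' (f p.1 p.2) * divergence (flux (f p.1)) p.2)
      (Ioo 0 T ×ˢ univ) := by
    refine ContinuousOn.mul (ContinuousOn.mul ?_ ?_) hf.continuousOn_divergence
    · exact (hχ.comp continuous_snd).continuousOn
    · exact hβ'.comp_continuousOn
        (hf.continuousOn.mono (prod_mono Ioo_subset_Icc_self subset_rfl))
  obtain ⟨B, hB⟩ := ((isCompact_closedBall t δ).prod hk).exists_bound_of_continuousOn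
    (hcont.mono (prod_mono hball (subset_univ _)))
  have hmeas (s : ℝ) (hs : s ∈ Icc 0 T) : Continuous fun v => χ v * β (f s v) :=
    hχ.mul (hβc.comp (hf.continuous_slice hs))
  have hts : t ∈ Icc 0 T := Ioo_subset_Icc_self ht
  refine (hasDerivAt_integral_of_dominated_loc_of_deriv_le (s := Metric.ball t δ)
    (bound := k.indicator fun _ => B)
    (F' := fun s v => χ v * β' (f s v) * divergence (flux (f s)) v)
    (Metric.ball_mem_nhds t hδ) ?_ ?_ ?_ ?_ ?_ ?_).2
  · filter_upwards [Ioo_mem_nhds ht.1 ht.2] with s hs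
    exact (hmeas s (Ioo_subset_Icc_self hs)).aestronglyMeasurable
  · exact (hmeas t hts).integrable_of_hasCompactSupport
      (HasCompactSupport.intro hk fun v hv => h0 t hts v hv)
  · have : Continuous fun v => χ v * β' (f t v) * divergence (flux (f t)) v := by
      rw [← continuousOn_univ]
      exact hcont.comp (f := fun v : E3 => (t, v)) (by fun_prop) fun v _ => ⟨ht, mem_univ _⟩
    exact this.aestronglyMeasurable
  · refine ae_of_all _ fun v s hs => ?_
    have hs' : s ∈ Ioo 0 T := hball (Metric.ball_subset_closedBall hs)
    by_cases hv : v ∈ k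
    · rw [indicator_of_mem hv]
      exact hB (s, v) ⟨Metric.ball_subset_closedBall hs, hv⟩
    · rw [indicator_of_notMem hv, h0' s (Ioo_subset_Icc_self hs') v hv]
      simp
  · rw [integrable_indicator_iff hk.measurableSet]
    exact integrableOn_const hk.measure_lt_top.ne
  · refine ae_of_all _ fun v s hs => ?_
    have hs' : s ∈ Ioo 0 T := hball (Metric.ball_subset_closedBall hs)
    rw [mul_assoc]
    exact ((hβ (f s v)).comp s (hf.hasDerivAt hs' v)).const_mul (χ v)

lemma IsSmoothDecayingSolution.continuousOn_integral (hf : IsSmoothDecayingSolution T f)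
    {χ : E3 → ℝ} (hχ : Continuous χ) {β : ℝ → ℝ} (hβ : Continuous β) {k : Set E3}
    (hk : IsCompact k) (h0 : ∀ s ∈ Icc 0 T, ∀ v, v ∉ k → χ v * β (f s v) = 0) :
    ContinuousOn (fun s => ∫ v, χ v * β (f s v)) (Icc 0 T) := by
  refine continuousOn_integral_of_compact_support (f := fun s v => χ v * β (f s v)) hk ?_
    fun s v hs hv => h0 s hs v hv
  exact ((hχ.comp continuous_snd).continuousOn).mul (hβ.comp_continuousOn hf.continuousOn)

/-- The truncations at a positive level are supported in a ball that does not depend on time. -/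
lemma IsSmoothDecayingSolution.exists_ball (hf : IsSmoothDecayingSolution T f) {ℓ : ℝ}
    (hℓ : 0 < ℓ) : ∃ R : ℝ, ∀ t ∈ Icc 0 T, ∀ v, v ∉ Metric.closedBall (0 : E3) R →
      ∀ s : ℝ, s ≠ 0 → posPow s (f t v - ℓ) = 0 := by
  obtain ⟨C, hC⟩ := hf.decay 1 0
  refine ⟨C / ℓ, fun t ht v hv s hs => posPow_eq_zero_of_decay (fun v => ?_) hℓ hs hv⟩
  have := hC t ht v
  rwa [pow_one, norm_iteratedFDeriv_zero] at this

lemma IsSmoothDecayingSolution.continuousOn_levelIntegral (hf : IsSmoothDecayingSolution T f)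
    {ℓ : ℝ} (hℓ : 0 < ℓ) {s : ℝ} (hs : 0 < s) :
    ContinuousOn (fun t => levelIntegral s ℓ (f t)) (Icc 0 T) := by
  obtain ⟨R, hR⟩ := hf.exists_ball hℓ
  refine hf.continuousOn_integral (continuous_bracket_rpow _)
    (β := fun x => posPow s (x - ℓ)) ?_ (isCompact_closedBall 0 R) fun t ht v hv => ?_
  · exact (continuous_posPow hs.le).comp (continuous_id.sub continuous_const)
  · simp [hR t ht v hv s hs.ne']

lemma IsSmoothDecayingSolution.hasDerivAt_levelIntegral (hf : IsSmoothDecayingSolution T f)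
    {ℓ : ℝ} (hℓ : 0 < ℓ) {t : ℝ} (ht : t ∈ Ioo 0 T) :
    HasDerivAt (fun t => levelIntegral (5 / 2) ℓ (f t))
      (5 / 2 * ∫ v, bracket v ^ (9 / 2 : ℝ) * posPow (3 / 2) (f t v - ℓ)
        * divergence (flux (f t)) v) t := by
  obtain ⟨R, hR⟩ := hf.exists_ball hℓ
  have h := hf.hasDerivAt_integral (continuous_bracket_rpow (9 / 2))
    (β := fun x => posPow (5 / 2) (x - ℓ)) (β' := fun x => 5 / 2 * posPow (3 / 2) (x - ℓ))
    (fun x => ?_) ?_ (isCompact_closedBall (0 : E3) R) (fun t ht v hv => ?_)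
    (fun t ht v hv => ?_) ht
  · have e : ∫ v, 5 / 2 * (bracket v ^ (9 / 2 : ℝ) * posPow (3 / 2) (f t v - ℓ)
          * divergence (flux (f t)) v)
        = ∫ v, bracket v ^ (9 / 2 : ℝ) * (5 / 2 * posPow (3 / 2) (f t v - ℓ))
          * divergence (flux (f t)) v :=
      integral_congr_ae (ae_of_all _ fun v => by ring)
    rw [← integral_const_mul, e]
    exact h
  · have := (hasDerivAt_posPow (r := 5 / 2) (by norm_num) (x - ℓ)).comp_sub_const x ℓ
    norm_num at this ⊢
    exact this
  · exact continuous_const.mul ((continuous_posPow (by norm_num)).comp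
      (continuous_id.sub continuous_const))
  · simp [hR t ht v hv (5 / 2) (by norm_num)]
  · simp [hR t ht v hv (3 / 2) (by norm_num)]

/-- Uniform decay of a derivative of the solution. -/
lemma IsSmoothDecayingSolution.exists_uniform_decay (hf : IsSmoothDecayingSolution T f) (n : ℕ) :
    ∃ C : ℝ, 0 ≤ C ∧ ∀ t ∈ Icc 0 T, ∀ v,
      ‖iteratedFDeriv ℝ n (f t) v‖ ≤ C * (1 + ‖v‖) ^ (-4 : ℝ) := by
  obtain ⟨C₀, h₀⟩ := hf.decay 0 n
  obtain ⟨C₄, h₄⟩ := hf.decay 4 n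
  refine ⟨8 * (|C₀| + |C₄|), by positivity, fun t ht v => ?_⟩
  rw [Real.rpow_neg (by positivity), ← div_eq_mul_inv, le_div_iff₀ (by positivity)]
  have e : (1 + ‖v‖) ^ (4 : ℝ) = (1 + ‖v‖) ^ 4 := by norm_cast
  have h1 : (1 + ‖v‖) ^ 4 ≤ 8 * (1 + ‖v‖ ^ 4) := by
    have := add_pow_le (zero_le_one (α := ℝ)) (norm_nonneg v) 4
    norm_num at this
    exact this
  have a0 := (h₀ t ht v).trans (le_abs_self _)
  have a4 := (h₄ t ht v).trans (le_abs_self _)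
  rw [e]
  calc ‖iteratedFDeriv ℝ n (f t) v‖ * (1 + ‖v‖) ^ 4
      ≤ ‖iteratedFDeriv ℝ n (f t) v‖ * (8 * (1 + ‖v‖ ^ 4)) := by gcongr
    _ = 8 * (‖v‖ ^ 0 * ‖iteratedFDeriv ℝ n (f t) v‖
          + ‖v‖ ^ 4 * ‖iteratedFDeriv ℝ n (f t) v‖) := by ring
    _ ≤ _ := by gcongr

end Evolution

/-- The quadratic cutoff `(1 - |v|² / R²)_+²`. -/
noncomputable def cutoff (R : ℝ) (v : E3) : ℝ := posPow 2 (1 - ‖v‖ ^ 2 / R ^ 2)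

lemma cutoff_nonneg (R : ℝ) (v : E3) : 0 ≤ cutoff R v := posPow_nonneg _ _

lemma cutoff_le_one (R : ℝ) (v : E3) : cutoff R v ≤ 1 := by
  have h : 0 ≤ ‖v‖ ^ 2 / R ^ 2 := by positivity
  unfold cutoff posPow
  exact Real.rpow_le_one (le_max_right _ _) (max_le (by linarith) zero_le_one) (by norm_num)

lemma cutoff_eq_zero {R : ℝ} (hR : 0 < R) {v : E3} (hv : v ∉ Metric.closedBall (0 : E3) R) :
    cutoff R v = 0 := by
  rw [mem_closedBall_zero_iff, not_le] at hv
  refine posPow_of_nonpos (by norm_num) ?_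
  rw [sub_nonpos, one_le_div (by positivity)]
  exact pow_le_pow_left₀ hR.le hv.le 2

lemma contDiff_cutoff (R : ℝ) : ContDiff ℝ 1 (cutoff R) :=
  (contDiff_posPow (by norm_num)).comp
    (contDiff_const.sub ((contDiff_norm_sq ℝ).div_const _))

lemma norm_gradient_cutoff_le {R : ℝ} (hR : 0 < R) (v : E3) :
    ‖gradient (cutoff R) v‖ ≤ 4 / R := by
  have h1 : HasGradientAt (fun v : E3 => 1 - ‖v‖ ^ 2 / R ^ 2) ((-(2 / R ^ 2)) • v) v := by
    rw [hasGradientAt_iff_hasFDerivAt]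
    have := ((hasStrictFDerivAt_norm_sq v).hasFDerivAt.mul_const (R ^ 2)⁻¹).const_sub 1
    refine this.congr_fderiv ?_
    ext y
    simp
    ring
  have h2 := (hasGradientAt_comp (hasDerivAt_posPow (r := 2) (by norm_num) _) h1).gradient
  unfold cutoff
  rw [h2]
  by_cases hv : ‖v‖ ≤ R
  · have hp : posPow (2 - 1) (1 - ‖v‖ ^ 2 / R ^ 2) ≤ 1 := by
      have h : 0 ≤ ‖v‖ ^ 2 / R ^ 2 := by positivity
      unfold posPow
      exact Real.rpow_le_one (le_max_right _ _) (max_le (by linarith) zero_le_one) (by norm_num)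
    have hp0 := posPow_nonneg (2 - 1) (1 - ‖v‖ ^ 2 / R ^ 2)
    rw [norm_smul, norm_smul, Real.norm_of_nonneg (by positivity), norm_neg,
      Real.norm_of_nonneg (by positivity)]
    calc 2 * posPow (2 - 1) (1 - ‖v‖ ^ 2 / R ^ 2) * (2 / R ^ 2 * ‖v‖)
        ≤ 2 * 1 * (2 / R ^ 2 * R) := by gcongr
      _ = 4 / R := by field_simp; norm_num
  · rw [posPow_of_nonpos (by norm_num)]
    · simp; positivity
    · rw [sub_nonpos, one_le_div (by positivity)]
      exact pow_le_pow_left₀ hR.le (not_le.1 hv).le 2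

section Mass
variable {T : ℝ} {f : ℝ → E3 → ℝ}

/-- The flux decays uniformly in time. -/
lemma IsSmoothDecayingSolution.exists_flux_bound (hf : IsSmoothDecayingSolution T f) :
    ∃ M : ℝ, 0 ≤ M ∧ ∀ t ∈ Icc 0 T, ∀ v x,
      |⟪x, flux (f t) v⟫| ≤ ‖x‖ * (M * (1 + ‖v‖) ^ (-4 : ℝ)) := by
  obtain ⟨C₀, hC₀, h₀⟩ := hf.exists_uniform_decay 0
  obtain ⟨C₁, hC₁, h₁⟩ := hf.exists_uniform_decay 1
  set m : ℝ := ∫ z : E3, (1 + ‖z‖) ^ (-4 : ℝ)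
  have hm : 0 ≤ m := integral_nonneg fun z => by positivity
  set a : ℝ := C₀ * (nearMass + m)
  have ha : 0 ≤ a := mul_nonneg hC₀ (add_nonneg nearMass_nonneg hm)
  refine ⟨9 * a * C₁ + C₀ * a, by positivity, fun t ht v x => ?_⟩
  obtain ⟨g, hg⟩ := hf.exists_schwartz ht
  have hg0 : ∀ v, 0 ≤ g v := fun v => by rw [hg]; exact hf.nonneg t ht v
  have h₀' : ∀ v, g v ≤ C₀ * (1 + ‖v‖) ^ (-4 : ℝ) := fun v => by
    have := h₀ t ht v
    rw [norm_iteratedFDeriv_zero, ← hg, Real.norm_of_nonneg (hg0 v)] at this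
    exact this
  have h₁' : ‖gradient g v‖ ≤ C₁ * (1 + ‖v‖) ^ (-4 : ℝ) := by
    have := h₁ t ht v
    rw [norm_iteratedFDeriv_one, ← hg] at this
    rwa [norm_gradient]
  have hcb : coeffBound g v ≤ a := by
    have i1 := integrable_nearKernel.mul_const C₀
    have i2 : Integrable fun z : E3 => C₀ * (1 + ‖v - z‖) ^ (-4 : ℝ) :=
      (integrable_one_add_norm_neg_four.comp_sub_left v).const_mul C₀
    calc coeffBound g v ≤ ∫ z, (nearKernel z * C₀ + C₀ * (1 + ‖v - z‖) ^ (-4 : ℝ)) := by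
          refine integral_mono (weaklySingular_nearKernel_add_one.integrable_schwartz g v)
            (i1.add i2) fun z => ?_
          have hn := nearKernel_nonneg z
          have hb := h₀' (v - z)
          have hb' : g (v - z) ≤ C₀ :=
            hb.trans (mul_le_of_le_one_right hC₀ (one_add_norm_neg_four_le_one _))
          rw [smul_eq_mul]
          nlinarith [mul_le_mul_of_nonneg_left hb' hn]
      _ = a := by
          rw [integral_add i1 i2, integral_mul_const, integral_const_mul,
            integral_sub_left_eq_self (fun z : E3 => (1 + ‖z‖) ^ (-4 : ℝ)) volume v]
          simp only [a, nearMass]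
          ring
  rw [← hg]
  simp only [flux, inner_sub_right, inner_smul_right]
  have hd : 0 ≤ (1 + ‖v‖) ^ (-4 : ℝ) := by positivity
  have b1 : |⟪x, Matrix.toEuclideanLin (coeffA g v) (gradient g v)⟫|
      ≤ 9 * a * ‖x‖ * (C₁ * (1 + ‖v‖) ^ (-4 : ℝ)) :=
    (abs_inner_toEuclideanLin_le (fun i j => (abs_coeffA_le_coeffBound hg0 v i j).trans hcb)
      x _).trans (by gcongr)
  have b2 : |g v * ⟪x, gradient (coeffa g) v⟫| ≤ C₀ * (1 + ‖v‖) ^ (-4 : ℝ) * (‖x‖ * a) := by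
    rw [abs_mul, abs_of_nonneg (hg0 v)]
    refine mul_le_mul (h₀' v) ((abs_real_inner_le_norm _ _).trans ?_) (abs_nonneg _)
      (by positivity)
    gcongr
    exact (norm_gradient_coeffa_le_coeffBound hg0 v).trans hcb
  calc _ ≤ _ := abs_sub _ _
    _ ≤ 9 * a * ‖x‖ * (C₁ * (1 + ‖v‖) ^ (-4 : ℝ)) + C₀ * (1 + ‖v‖) ^ (-4 : ℝ) * (‖x‖ * a) :=
        add_le_add b1 b2
    _ = _ := by ring

/-- The mass does not increase: the flux through large spheres is negligible. -/
lemma IsSmoothDecayingSolution.integral_le_one (hf : IsSmoothDecayingSolution T f)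
    (h0 : IsNormalised (f 0)) {τ : ℝ} (hτ : τ ∈ Icc 0 T) : ∫ v, f τ v ≤ 1 := by
  obtain ⟨M, hM, hflux⟩ := hf.exists_flux_bound
  set m : ℝ := ∫ z : E3, (1 + ‖z‖) ^ (-4 : ℝ)
  have hm : 0 ≤ m := integral_nonneg fun z => by positivity
  have hint (t : ℝ) (ht : t ∈ Icc 0 T) : Integrable (f t) := by
    obtain ⟨g, hg⟩ := hf.exists_schwartz ht
    rw [← hg]; exact (fourthOrderDecay_schwartz g).integrable g.continuous
  have h0T : (0 : ℝ) ∈ Icc 0 T := ⟨le_rfl, hτ.1.trans hτ.2⟩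
  have hsupp (R : ℝ) (hR : 0 < R) : HasCompactSupport (cutoff R) :=
    HasCompactSupport.intro (isCompact_closedBall (0 : E3) R) fun v hv => cutoff_eq_zero hR hv
  have hstep (R : ℝ) (hR : 0 < R) :
      ∫ v, cutoff R v * f τ v ≤ 1 + 4 / R * (M * m) * τ := by
    have hk : ∀ s ∈ Icc 0 T, ∀ v, v ∉ Metric.closedBall (0 : E3) R →
        cutoff R v * f s v = 0 := fun s _ v hv => by rw [cutoff_eq_zero hR hv, zero_mul]
    have hcont := hf.continuousOn_integral (contDiff_cutoff R).continuous (β := fun x => x)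
      continuous_id (isCompact_closedBall 0 R) hk
    have hder (t : ℝ) (ht : t ∈ Ioo 0 T) := hf.hasDerivAt_integral (contDiff_cutoff R).continuous
      (β := fun x => x) (β' := fun _ => 1) (fun x => hasDerivAt_id x) continuous_const
      (isCompact_closedBall 0 R) hk
      (fun s _ v hv => by rw [cutoff_eq_zero hR hv, zero_mul]) ht
    have hbound (t : ℝ) (ht : t ∈ Ioo 0 T) :
        ∫ v, cutoff R v * 1 * divergence (flux (f t)) v ≤ 4 / R * (M * m) := by
      have ht' := Ioo_subset_Icc_self ht
      obtain ⟨g, hg⟩ := hf.exists_schwartz ht'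
      simp_rw [mul_one]
      rw [← hg, integral_mul_divergence (contDiff_cutoff R) (hsupp R hR) (contDiff_flux g), hg]
      refine (neg_le_abs _).trans ?_
      rw [← Real.norm_eq_abs]
      have i1 : Integrable fun v : E3 => 4 / R * (M * (1 + ‖v‖) ^ (-4 : ℝ)) :=
        (integrable_one_add_norm_neg_four.const_mul M).const_mul _
      refine (norm_integral_le_of_norm_le i1 (ae_of_all _ fun v => ?_)).trans (le_of_eq ?_)
      · refine (hflux t ht' v _).trans ?_
        gcongr
        exact norm_gradient_cutoff_le hR v
      · rw [integral_const_mul, integral_const_mul]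
    have hmv := intervalIntegral.sub_le_integral_of_hasDeriv_right_of_le hτ.1
      (hcont.mono (Icc_subset_Icc_right hτ.2))
      (fun t ht => (hder t ⟨ht.1, ht.2.trans_le hτ.2⟩).hasDerivWithinAt)
      (φ := fun _ => 4 / R * (M * m)) (integrableOn_const (by simp))
      (fun t ht => hbound t ⟨ht.1, ht.2.trans_le hτ.2⟩)
    rw [intervalIntegral.integral_const, sub_zero, smul_eq_mul] at hmv
    have h1 : ∫ v, cutoff R v * f 0 v ≤ 1 := by
      rw [← h0.mass]
      refine integral_mono_of_nonneg (ae_of_all _ fun v =>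
        mul_nonneg (cutoff_nonneg R v) (h0.nonneg v)) (hint 0 h0T) (ae_of_all _ fun v => ?_)
      exact mul_le_of_le_one_left (h0.nonneg v) (cutoff_le_one R v)
    linarith
  have t1 : Tendsto (fun n : ℕ => ∫ v, cutoff ((n : ℝ) + 1) v * f τ v) atTop
      (𝓝 (∫ v, f τ v)) := by
    refine tendsto_integral_of_dominated_convergence (fun v => ‖f τ v‖) (fun n => ?_)
      (hint τ hτ).norm (fun n => ae_of_all _ fun v => ?_) (ae_of_all _ fun v => ?_)
    · exact ((contDiff_cutoff _).continuous.mul (hf.continuous_slice hτ)).aestronglyMeasurable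
    · rw [norm_mul, Real.norm_of_nonneg (cutoff_nonneg _ v)]
      exact mul_le_of_le_one_left (norm_nonneg _) (cutoff_le_one _ v)
    · have hu : Tendsto (fun n : ℕ => ((n : ℝ) + 1)⁻¹) atTop (𝓝 0) := by
        simpa using tendsto_one_div_add_atTop_nhds_zero_nat (𝕜 := ℝ)
      have hc : Continuous fun x : ℝ => posPow 2 (1 - ‖v‖ ^ 2 * x ^ 2) * f τ v :=
        ((continuous_posPow (by norm_num)).comp (by fun_prop)).mul continuous_const
      have := (hc.tendsto 0).comp hu
      simp only [ne_eq, OfNat.ofNat_ne_zero, not_false_eq_true, zero_pow, mul_zero, sub_zero] at this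
      rw [posPow_of_nonneg zero_le_one, Real.one_rpow, one_mul] at this
      refine this.congr fun n => ?_
      simp [cutoff, div_eq_mul_inv]
  have t2 : Tendsto (fun n : ℕ => 1 + 4 / ((n : ℝ) + 1) * (M * m) * τ) atTop
      (𝓝 (1 + 4 * 0 * (M * m) * τ)) := by
    have hu : Tendsto (fun n : ℕ => ((n : ℝ) + 1)⁻¹) atTop (𝓝 0) := by
      simpa using tendsto_one_div_add_atTop_nhds_zero_nat (𝕜 := ℝ)
    simp_rw [div_eq_mul_inv]
    exact (((hu.const_mul 4).mul_const _).mul_const _).const_add 1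
  have := le_of_tendsto_of_tendsto' t1 t2 fun n => hstep _ (by positivity)
  simpa using this

end Mass

/-! ### Chebyshev and interpolation between levels -/

/-- Chebyshev's inequality in pointwise form: a higher level allows a lower exponent. -/
lemma posPow_chebyshev {Δ s q : ℝ} (hΔ : 0 < Δ) (hs : 0 < s) (hsq : s ≤ q) (x ℓ : ℝ) :
    posPow s (x - (ℓ + Δ)) ≤ Δ ^ (s - q) * posPow q (x - ℓ) := by
  rcases le_or_gt (x - (ℓ + Δ)) 0 with h | h
  · rw [posPow_of_nonpos hs.ne' h]
    exact mul_nonneg (by positivity) (posPow_nonneg _ _)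
  · have hx : Δ < x - ℓ := by linarith
    have hx0 : 0 < x - ℓ := hΔ.trans hx
    rw [posPow_of_nonneg h.le, posPow_of_nonneg hx0.le]
    calc (x - (ℓ + Δ)) ^ s ≤ (x - ℓ) ^ s := Real.rpow_le_rpow h.le (by linarith) hs.le
      _ = (x - ℓ) ^ (s - q) * (x - ℓ) ^ q := by rw [← Real.rpow_add hx0]; ring_nf
      _ ≤ Δ ^ (s - q) * (x - ℓ) ^ q := by
          gcongr ?_ * _
          exact Real.rpow_le_rpow_of_nonpos hΔ hx.le (by linarith)

lemma levelIntegral_chebyshev (g : 𝓢(E3, ℝ)) {ℓ Δ s q : ℝ} (hℓ : 0 < ℓ) (hΔ : 0 < Δ)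
    (hs : 0 < s) (hsq : s ≤ q) :
    levelIntegral s (ℓ + Δ) g ≤ Δ ^ (s - q) * levelIntegral q ℓ g := by
  unfold levelIntegral
  rw [← integral_const_mul]
  refine integral_mono (integrable_levelIntegral g (by linarith) hs)
    ((integrable_levelIntegral g hℓ (hs.trans_le hsq)).const_mul _) fun v => ?_
  have h := mul_le_mul_of_nonneg_left (posPow_chebyshev hΔ hs hsq (g v) ℓ)
    (Real.rpow_nonneg (bracket_pos v).le (9 / 2))
  linarith

/-- Interpolation between the energy and the Sobolev norm. -/
lemma levelIntegral_interpolation (g : 𝓢(E3, ℝ)) {ℓ : ℝ} (hℓ : 0 < ℓ) :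
    levelIntegral (25 / 6) ℓ g ≤ sobolevNorm ℓ g * levelIntegral (5 / 2) ℓ g ^ (2 / 3 : ℝ) := by
  have hS := sobolevNorm_nonneg ℓ g
  have hY := levelIntegral_nonneg (5 / 2) ℓ g
  have hX := levelIntegral_nonneg (15 / 2) ℓ g
  refine (ENNReal.ofReal_le_ofReal_iff (by positivity)).1 ?_
  have h := ENNReal.lintegral_mul_norm_pow_le (μ := (volume : Measure E3))
    (f := fun v => ENNReal.ofReal (bracket v ^ (9 / 2 : ℝ) * posPow (15 / 2) (g v - ℓ)))
    (g := fun v => ENNReal.ofReal (bracket v ^ (9 / 2 : ℝ) * posPow (5 / 2) (g v - ℓ)))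
    (p := 1 / 3) (q := 2 / 3)
    (continuous_weighted g.continuous _ (by norm_num) ℓ).measurable.ennreal_ofReal.aemeasurable
    (continuous_weighted g.continuous _ (by norm_num) ℓ).measurable.ennreal_ofReal.aemeasurable
    (by norm_num) (by norm_num) (by norm_num)
  rw [lintegral_rpow_eq_levelIntegral hℓ (by norm_num),
    lintegral_rpow_eq_levelIntegral hℓ (by norm_num),
    ENNReal.ofReal_rpow_of_nonneg hX (by norm_num),
    ENNReal.ofReal_rpow_of_nonneg hY (by norm_num), ← ENNReal.ofReal_mul (by positivity)] at h
  rw [← lintegral_rpow_eq_levelIntegral hℓ (by norm_num)]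
  refine le_trans (le_of_eq ?_) h
  congr 1; ext v
  have hb := bracket_pos v
  have h1 := posPow_nonneg (5 / 2) (g v - ℓ)
  have h2 := posPow_nonneg (15 / 2) (g v - ℓ)
  rw [ENNReal.ofReal_rpow_of_nonneg (by positivity) (by norm_num),
    ENNReal.ofReal_rpow_of_nonneg (by positivity) (by norm_num),
    ← ENNReal.ofReal_mul (by positivity), Real.mul_rpow (by positivity) h2,
    Real.mul_rpow (by positivity) h1, posPow_rpow, posPow_rpow]
  congr 1
  rw [mul_mul_mul_comm, ← Real.rpow_mul hb.le, ← Real.rpow_mul hb.le, ← Real.rpow_add hb,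
    posPow_add (by norm_num) (by norm_num)]
  norm_num

/-! ### The first energy bound -/

/-- A continuously differentiable substitute for `x_+^(3/4)`: it vanishes for `x ≤ 0` and is
comparable to `x^(3/4)` for `x ≥ δ`. -/
noncomputable def rootProfile (δ x : ℝ) : ℝ := posPow 2 x * (posPow 2 x + δ ^ 2) ^ (-(5 / 8) : ℝ)

/-- The derivative of `rootProfile δ`. -/
noncomputable def rootProfileDeriv (δ x : ℝ) : ℝ :=
  ((posPow 2 x + δ ^ 2) ^ (-(5 / 8) : ℝ)
    + posPow 2 x * (-(5 / 8) * (posPow 2 x + δ ^ 2) ^ (-(5 / 8) - 1 : ℝ))) * (2 * posPow 1 x)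

lemma hasDerivAt_rootProfile {δ : ℝ} (hδ : 0 < δ) (x : ℝ) :
    HasDerivAt (rootProfile δ) (rootProfileDeriv δ x) x := by
  have hp := posPow_nonneg 2 x
  have h1 : HasDerivAt (posPow 2) (2 * posPow 1 x) x := by
    have := hasDerivAt_posPow (r := 2) (by norm_num) x
    norm_num at this
    exact this
  have h2 : HasDerivAt (fun y : ℝ => (y + δ ^ 2) ^ (-(5 / 8) : ℝ))
      (-(5 / 8) * (posPow 2 x + δ ^ 2) ^ (-(5 / 8) - 1 : ℝ)) (posPow 2 x) :=
    (Real.hasDerivAt_rpow_const (Or.inl (by positivity))).comp_add_const (posPow 2 x) (δ ^ 2)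
  have h3 := ((hasDerivAt_id (posPow 2 x)).mul h2).comp x h1
  refine h3.congr_deriv ?_
  simp only [rootProfileDeriv, id, one_mul]

lemma continuous_rootProfileDeriv {δ : ℝ} (hδ : 0 < δ) : Continuous (rootProfileDeriv δ) := by
  have h2 := continuous_posPow (r := 2) (by norm_num)
  have h1 := continuous_posPow (r := 1) (by norm_num)
  have hne (x : ℝ) : posPow 2 x + δ ^ 2 ≠ 0 := by have := posPow_nonneg 2 x; positivity
  have h (s : ℝ) : Continuous fun x => (posPow 2 x + δ ^ 2) ^ s :=
    (h2.add continuous_const).rpow_const fun x => Or.inl (hne x)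
  exact ((h _).add (h2.mul (continuous_const.mul (h _)))).mul (continuous_const.mul h1)

lemma contDiff_rootProfile {δ : ℝ} (hδ : 0 < δ) : ContDiff ℝ 1 (rootProfile δ) := by
  rw [contDiff_one_iff_deriv]
  refine ⟨fun x => (hasDerivAt_rootProfile hδ x).differentiableAt, ?_⟩
  rw [funext fun x => (hasDerivAt_rootProfile hδ x).deriv]
  exact continuous_rootProfileDeriv hδ

lemma rootProfile_nonneg (δ x : ℝ) : 0 ≤ rootProfile δ x := by
  have := posPow_nonneg 2 x
  unfold rootProfile
  positivity

lemma rootProfile_of_nonpos (δ : ℝ) {x : ℝ} (hx : x ≤ 0) : rootProfile δ x = 0 := by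
  simp [rootProfile, posPow_of_nonpos two_ne_zero hx]

lemma rootProfileDeriv_of_nonpos (δ : ℝ) {x : ℝ} (hx : x ≤ 0) : rootProfileDeriv δ x = 0 := by
  simp [rootProfileDeriv, posPow_of_nonpos one_ne_zero hx]

lemma rootProfile_le {δ x : ℝ} (hδ : 0 < δ) (hx : 0 < x) : rootProfile δ x ≤ (x + δ) ^ (3 / 4 : ℝ) := by
  unfold rootProfile
  rw [posPow_of_nonneg hx.le]
  have hx2 : 0 < x ^ (2 : ℝ) := by positivity
  calc x ^ (2 : ℝ) * (x ^ (2 : ℝ) + δ ^ 2) ^ (-(5 / 8) : ℝ)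
      ≤ x ^ (2 : ℝ) * (x ^ (2 : ℝ)) ^ (-(5 / 8) : ℝ) := by
        gcongr ?_ * ?_
        exact Real.rpow_le_rpow_of_nonpos hx2 (by nlinarith) (by norm_num)
    _ = x ^ (3 / 4 : ℝ) := by
        rw [← Real.rpow_mul hx.le, ← Real.rpow_add hx]; norm_num
    _ ≤ _ := by gcongr; linarith

lemma le_rootProfile {δ x : ℝ} (hδ : 0 < δ) (hx : δ ≤ x) :
    (x + δ) ^ (3 / 4 : ℝ) ≤ 4 * rootProfile δ x := by
  have hx0 : 0 < x := hδ.trans_le hx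
  unfold rootProfile
  rw [posPow_of_nonneg hx0.le]
  have hx2 : x ^ (2 : ℝ) = x ^ 2 := by norm_cast
  have h1 : (2 * x ^ (2 : ℝ)) ^ (-(5 / 8) : ℝ) ≤ (x ^ (2 : ℝ) + δ ^ 2) ^ (-(5 / 8) : ℝ) := by
    refine Real.rpow_le_rpow_of_nonpos (by positivity) ?_ (by norm_num)
    rw [hx2]; nlinarith
  have h2 : (1 / 2 : ℝ) ≤ (2 : ℝ) ^ (-(5 / 8) : ℝ) := by
    calc (1 / 2 : ℝ) = 2 ^ (-1 : ℝ) := by rw [Real.rpow_neg_one]; norm_num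
      _ ≤ _ := Real.rpow_le_rpow_of_exponent_le (by norm_num) (by norm_num)
  have h3 : (2 : ℝ) ^ (3 / 4 : ℝ) ≤ 2 := by
    calc (2 : ℝ) ^ (3 / 4 : ℝ) ≤ 2 ^ (1 : ℝ) :=
          Real.rpow_le_rpow_of_exponent_le (by norm_num) (by norm_num)
      _ = 2 := Real.rpow_one 2
  calc (x + δ) ^ (3 / 4 : ℝ) ≤ (2 * x) ^ (3 / 4 : ℝ) := by gcongr; linarith
    _ = 2 ^ (3 / 4 : ℝ) * x ^ (3 / 4 : ℝ) := Real.mul_rpow (by norm_num) hx0.le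
    _ ≤ 2 * x ^ (3 / 4 : ℝ) := by gcongr
    _ = 4 * (x ^ (2 : ℝ) * (1 / 2 * (x ^ (2 : ℝ)) ^ (-(5 / 8) : ℝ))) := by
        have : x ^ (3 / 4 : ℝ) = x ^ (2 : ℝ) * (x ^ (2 : ℝ)) ^ (-(5 / 8) : ℝ) := by
          rw [← Real.rpow_mul hx0.le, ← Real.rpow_add hx0]; norm_num
        rw [this]; ring
    _ ≤ 4 * (x ^ (2 : ℝ) * (2 ^ (-(5 / 8) : ℝ) * (x ^ (2 : ℝ)) ^ (-(5 / 8) : ℝ))) := by gcongr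
    _ = 4 * (x ^ (2 : ℝ) * (2 * x ^ (2 : ℝ)) ^ (-(5 / 8) : ℝ)) := by
        rw [Real.mul_rpow (by norm_num) (by positivity)]
    _ ≤ _ := by gcongr

lemma abs_rootProfileDeriv_le {δ x : ℝ} (hδ : 0 < δ) (hx : 0 < x) :
    |rootProfileDeriv δ x| ≤ 4 * (x + δ) ^ (-(1 / 4) : ℝ) := by
  unfold rootProfileDeriv
  rw [posPow_of_nonneg hx.le, posPow_of_nonneg hx.le, Real.rpow_one]
  have hx2 : x ^ (2 : ℝ) = x ^ 2 := by norm_cast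
  rw [hx2]
  set y := x ^ 2 + δ ^ 2
  have hy : 0 < y := by positivity
  have e1 : y ^ (-(5 / 8) : ℝ) = y ^ (-(5 / 8) - 1 : ℝ) * y := by
    rw [Real.rpow_sub_one hy.ne']; field_simp
  have hz : 0 ≤ y ^ (-(5 / 8) - 1 : ℝ) := by positivity
  have h0 : 0 ≤ y ^ (-(5 / 8) : ℝ) + x ^ 2 * (-(5 / 8) * y ^ (-(5 / 8) - 1 : ℝ)) := by
    rw [e1]
    have : x ^ 2 ≤ y := by simp only [y]; nlinarith
    nlinarith
  have h1 : y ^ (-(5 / 8) : ℝ) + x ^ 2 * (-(5 / 8) * y ^ (-(5 / 8) - 1 : ℝ))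
      ≤ y ^ (-(5 / 8) : ℝ) := by nlinarith [mul_nonneg (sq_nonneg x) hz]
  have hd : 0 < x + δ := by linarith
  have h2 : y ^ (-(5 / 8) : ℝ) ≤ ((x + δ) ^ 2 / 2) ^ (-(5 / 8) : ℝ) := by
    refine Real.rpow_le_rpow_of_nonpos (by positivity) ?_ (by norm_num)
    simp only [y]; nlinarith [sq_nonneg (x - δ)]
  have h3 : ((x + δ) ^ 2 / 2) ^ (-(5 / 8) : ℝ) ≤ 2 * (x + δ) ^ (-(5 / 4) : ℝ) := by
    have t : (2 : ℝ) ^ (5 / 8 : ℝ) ≤ 2 := by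
      calc (2 : ℝ) ^ (5 / 8 : ℝ) ≤ 2 ^ (1 : ℝ) :=
            Real.rpow_le_rpow_of_exponent_le (by norm_num) (by norm_num)
        _ = 2 := Real.rpow_one 2
    have e : ((x + δ) ^ 2) ^ (-(5 / 8) : ℝ) = (x + δ) ^ (-(5 / 4) : ℝ) := by
      rw [← Real.rpow_natCast, ← Real.rpow_mul hd.le]; norm_num
    rw [Real.div_rpow (by positivity) (by norm_num), e, Real.rpow_neg (by norm_num : (0 : ℝ) ≤ 2),
      div_inv_eq_mul, mul_comm]
    gcongr
  have h4 : (x + δ) ^ (-(5 / 4) : ℝ) * (x + δ) = (x + δ) ^ (-(1 / 4) : ℝ) := by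
    rw [← Real.rpow_add_one hd.ne']; norm_num
  rw [abs_of_nonneg (by positivity)]
  calc _ ≤ y ^ (-(5 / 8) : ℝ) * (2 * x) := by gcongr
    _ ≤ 2 * (x + δ) ^ (-(5 / 4) : ℝ) * (2 * (x + δ)) := by
        gcongr
        · exact h2.trans h3
        · linarith
    _ = 4 * ((x + δ) ^ (-(5 / 4) : ℝ) * (x + δ)) := by ring
    _ = _ := by rw [h4]

/-- Above the level, the gradient of the truncation is the classical one. -/
lemma gradient_levelPart_rpow {g : E3 → ℝ} (hg : ContDiff ℝ 1 g) {K : ℝ} {v : E3} (hv : K < g v) :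
    gradient (fun w => levelPart K g w ^ (3 / 4 : ℝ)) v
      = (3 / 4 * (g v - K) ^ (-(1 / 4) : ℝ)) • gradient g v := by
  have hpos : 0 < g v - K := by linarith
  have h1 : HasDerivAt (fun x : ℝ => (x - K) ^ (3 / 4 : ℝ))
      (3 / 4 * (g v - K) ^ (-(1 / 4) : ℝ)) (g v) := by
    have := (Real.hasDerivAt_rpow_const (x := g v - K) (p := 3 / 4)
      (Or.inl hpos.ne')).comp_sub_const (g v) K
    norm_num at this ⊢
    exact this
  have h2 := hasGradientAt_comp h1 (hasGradientAt_of_contDiff hg v)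
  refine (h2.congr_of_eventuallyEq ?_).gradient
  filter_upwards [hg.continuous.continuousAt.eventually (lt_mem_nhds hv)] with w hw
  rw [levelPart, max_eq_left (by linarith)]

/-- The dissipation part of the critical energy controls the energy above the level `K`: the
Sobolev inequality is applied to a regularisation of `⟨v⟩^(3/4) (g - K)_+^(3/4)`. -/
lemma exists_initial_bound : ∃ C : ℝ, 0 < C ∧ ∀ (g : 𝓢(E3, ℝ)) (K δ ε : ℝ), 0 ≤ K → 0 < δ →
    0 ≤ ε →
    ∫⁻ v, ENNReal.ofReal (bracket v ^ (9 / 2 : ℝ) * levelPart K g v ^ (3 / 2 : ℝ))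
      ≤ ENNReal.ofReal ε →
    ENNReal.ofReal (levelIntegral (5 / 2) (K + 2 * δ) g) ≤ ENNReal.ofReal (C * ε ^ (2 / 3 : ℝ)) *
      ((∫⁻ v, ENNReal.ofReal (bracket v ^ (3 / 2 : ℝ) *
        ‖gradient (fun w => levelPart K g w ^ (3 / 4 : ℝ)) v‖ ^ 2)) + ENNReal.ofReal ε) := by
  obtain ⟨S, hS, hSob⟩ := exists_sobolev
  refine ⟨928 * S, by positivity, fun g K δ ε hK hδ hε0 hε => ?_⟩
  set lp : E3 → ℝ := levelPart K g with hlp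
  have hlc : Continuous lp := (g.continuous.sub continuous_const).max continuous_const
  have hln (v : E3) : 0 ≤ lp v := le_max_right _ _
  have hlpos (v : E3) (hv : K ≤ g v) : lp v = g v - K := max_eq_left (by linarith)
  set H : E3 → ℝ := fun v => rootProfile δ (g v - (K + δ)) with hH
  have hH0 (v : E3) : 0 ≤ H v := rootProfile_nonneg _ _
  set w : E3 → ℝ := fun v => bracket v ^ (3 / 4 : ℝ) * H v with hw
  have hHc : ContDiff ℝ 1 H := (contDiff_rootProfile hδ).comp ((g.smooth 1).sub contDiff_const)
  have hwc : ContDiff ℝ 1 w := ((contDiff_bracket_rpow _).of_le (by simp)).mul hHc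
  have hws : HasCompactSupport w := by
    refine ((hasCompactSupport_posPow g (ℓ := K + δ) (by linarith) (s := 2)
      (by norm_num)).mono fun v hv hv' => hv ?_).mul_left
    simp [hH, rootProfile, hv']
  have hHlp (v : E3) : H v ≤ lp v ^ (3 / 4 : ℝ) := by
    rcases le_or_gt (g v - (K + δ)) 0 with h | h
    · simp only [hH]; rw [rootProfile_of_nonpos _ h]; exact Real.rpow_nonneg (hln v) _
    · have := rootProfile_le hδ h
      rw [hlpos v (by linarith)]
      convert this using 2
      ring
  -- the gradient of the regularised root is controlled by that of the root itself
  have hgrad (v : E3) : ‖gradient w v‖ ^ 2 ≤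
      58 * (bracket v ^ (3 / 2 : ℝ) * ‖gradient (fun w => lp w ^ (3 / 4 : ℝ)) v‖ ^ 2)
        + 2 * (bracket v ^ (9 / 2 : ℝ) * lp v ^ (3 / 2 : ℝ)) := by
    have hb := bracket_pos v
    have hb1 := one_le_bracket v
    have hd : HasDerivAt (fun x => rootProfile δ (x - (K + δ)))
        (rootProfileDeriv δ (g v - (K + δ))) (g v) :=
      (hasDerivAt_rootProfile hδ (g v - (K + δ))).comp_sub_const (g v) (K + δ)
    have hg := (hasGradientAt_mul (hasGradientAt_bracket_rpow (3 / 4) v)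
      (hasGradientAt_comp (β := fun x => rootProfile δ (x - (K + δ))) hd
        (hasGradientAt_of_contDiff (g.smooth 1) v))).gradient
    change gradient w v = _ at hg
    rw [hg]
    set D := rootProfileDeriv δ (g v - (K + δ))
    have n1 : ‖bracket v ^ (3 / 4 : ℝ) • (D • gradient g v)‖
        ≤ 16 / 3 * (bracket v ^ (3 / 4 : ℝ) * ‖gradient (fun w => lp w ^ (3 / 4 : ℝ)) v‖) := by
      rw [norm_smul, norm_smul, Real.norm_of_nonneg (by positivity), Real.norm_eq_abs]
      rcases le_or_gt (g v - (K + δ)) 0 with h | h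
      · simp only [D]; rw [rootProfileDeriv_of_nonpos _ h]
        simp only [abs_zero, zero_mul, mul_zero]
        positivity
      · have hDle := abs_rootProfileDeriv_le hδ h
        rw [show g v - (K + δ) + δ = g v - K by ring] at hDle
        have hgK : 0 < g v - K := by linarith
        rw [hlp, gradient_levelPart_rpow (g.smooth 1) (by linarith), norm_smul,
          Real.norm_of_nonneg (by positivity)]
        calc bracket v ^ (3 / 4 : ℝ) * (|D| * ‖gradient g v‖)
            ≤ bracket v ^ (3 / 4 : ℝ) * (4 * (g v - K) ^ (-(1 / 4) : ℝ) * ‖gradient g v‖) := by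
              gcongr
          _ = _ := by ring
    have n2 : ‖rootProfile δ (g v - (K + δ)) • ((3 / 4 * bracket v ^ (3 / 4 - 2 : ℝ)) • v)‖
        ≤ lp v ^ (3 / 4 : ℝ) := by
      rw [norm_smul, Real.norm_of_nonneg (hH0 v)]
      refine (mul_le_of_le_one_right (hH0 v) ((norm_gradient_bracket_rpow_le _ v).trans ?_)).trans
        (hHlp v)
      have : bracket v ^ (3 / 4 - 1 : ℝ) ≤ 1 :=
        Real.rpow_le_one_of_one_le_of_nonpos hb1 (by norm_num)
      rw [abs_of_pos (by norm_num)]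
      linarith
    have n3 : 1 ≤ bracket v ^ (9 / 2 : ℝ) := Real.one_le_rpow hb1 (by norm_num)
    have e1 : bracket v ^ (3 / 2 : ℝ) = (bracket v ^ (3 / 4 : ℝ)) ^ 2 := by
      rw [← Real.rpow_natCast, ← Real.rpow_mul hb.le]; norm_num
    have e2 : lp v ^ (3 / 2 : ℝ) = (lp v ^ (3 / 4 : ℝ)) ^ 2 := by
      rw [← Real.rpow_natCast, ← Real.rpow_mul (hln v)]; norm_num
    have hsq := pow_le_pow_left₀ (norm_nonneg _)
      ((norm_add_le _ _).trans (add_le_add n1 n2)) 2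
    refine hsq.trans ?_
    rw [e1, e2, ← mul_pow]
    set a := bracket v ^ (3 / 4 : ℝ) * ‖gradient (fun w => lp w ^ (3 / 4 : ℝ)) v‖
    set b := lp v ^ (3 / 4 : ℝ)
    have : b ^ 2 ≤ bracket v ^ (9 / 2 : ℝ) * b ^ 2 := le_mul_of_one_le_left (sq_nonneg b) n3
    nlinarith [sq_nonneg (16 / 3 * a - b), sq_nonneg a]
  set G := ∫⁻ v, ENNReal.ofReal (bracket v ^ (3 / 2 : ℝ) *
    ‖gradient (fun w => lp w ^ (3 / 4 : ℝ)) v‖ ^ 2)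
  have hw6 : ENNReal.ofReal ((∫ v, |w v| ^ 6) ^ (1 / 3 : ℝ))
      ≤ ENNReal.ofReal S * (ENNReal.ofReal 58 * (G + ENNReal.ofReal ε)) := by
    have i1 : Integrable fun v => ‖gradient w v‖ ^ 2 :=
      ((continuous_gradient hwc).norm.pow 2).integrable_of_hasCompactSupport
        ((hasCompactSupport_gradient hws).mono fun v hv hv' => hv (by simp [hv']))
    refine (ENNReal.ofReal_le_ofReal (hSob w hwc hws)).trans ?_
    rw [ENNReal.ofReal_mul hS.le]
    gcongr
    rw [ofReal_integral_eq_lintegral_ofReal i1 (ae_of_all _ fun v => by positivity)]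
    calc ∫⁻ v, ENNReal.ofReal (‖gradient w v‖ ^ 2)
        ≤ ∫⁻ v, (ENNReal.ofReal 58 * ENNReal.ofReal (bracket v ^ (3 / 2 : ℝ) *
            ‖gradient (fun w => lp w ^ (3 / 4 : ℝ)) v‖ ^ 2)
          + ENNReal.ofReal 2 * ENNReal.ofReal (bracket v ^ (9 / 2 : ℝ) * lp v ^ (3 / 2 : ℝ))) := by
          refine lintegral_mono fun v => ?_
          have hb := bracket_pos v
          have hl := hln v
          rw [← ENNReal.ofReal_mul (by norm_num), ← ENNReal.ofReal_mul (by norm_num),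
            ← ENNReal.ofReal_add (by positivity) (by positivity)]
          exact ENNReal.ofReal_le_ofReal (hgrad v)
      _ = ENNReal.ofReal 58 * G + ENNReal.ofReal 2 *
            ∫⁻ v, ENNReal.ofReal (bracket v ^ (9 / 2 : ℝ) * lp v ^ (3 / 2 : ℝ)) := by
          have hm : Measurable fun v =>
              ENNReal.ofReal (bracket v ^ (9 / 2 : ℝ) * lp v ^ (3 / 2 : ℝ)) :=
            ((continuous_bracket_rpow _).mul (hlc.rpow_const fun v =>
              Or.inr (by norm_num))).measurable.ennreal_ofReal
          rw [lintegral_add_right _ (hm.const_mul _), lintegral_const_mul _ hm,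
            lintegral_const_mul' _ _ ENNReal.ofReal_ne_top]
      _ ≤ ENNReal.ofReal 58 * G + ENNReal.ofReal 58 * ENNReal.ofReal ε := by
          gcongr
          norm_num
      _ = _ := by rw [mul_add]
  have hFm : Measurable fun v => ENNReal.ofReal (bracket v ^ (3 : ℝ) * lp v) :=
    ((continuous_bracket_rpow 3).mul hlc).measurable.ennreal_ofReal
  have hwm : Measurable fun v => ENNReal.ofReal (w v ^ 2) :=
    (hwc.continuous.pow 2).measurable.ennreal_ofReal
  -- above the level `K + 2 δ` the regularised root `H` is comparable to `(g - K)^(3/4)`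
  have hpt (v : E3) : ENNReal.ofReal (bracket v ^ (9 / 2 : ℝ) *
      posPow (5 / 2) (g v - (K + 2 * δ))) ≤ ENNReal.ofReal 16 *
        ((fun v => ENNReal.ofReal (bracket v ^ (3 : ℝ) * lp v)) *
          fun v => ENNReal.ofReal (w v ^ 2)) v := by
    have hb := bracket_pos v
    have hl := hln v
    rw [Pi.mul_apply, ← ENNReal.ofReal_mul (by positivity), ← ENNReal.ofReal_mul (by norm_num)]
    refine ENNReal.ofReal_le_ofReal ?_
    rcases le_or_gt (g v - (K + 2 * δ)) 0 with h | h
    · rw [posPow_of_nonpos (by norm_num) h, mul_zero]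
      have := sq_nonneg (w v)
      positivity
    · have hlow := le_rootProfile hδ (x := g v - (K + δ)) (by linarith)
      rw [show g v - (K + δ) + δ = g v - K by ring] at hlow
      have hgK : 0 < g v - K := by linarith
      rw [posPow_of_nonneg h.le, hlpos v (by linarith)]
      have e1 : bracket v ^ (9 / 2 : ℝ) = bracket v ^ (3 : ℝ) * (bracket v ^ (3 / 4 : ℝ)) ^ 2 := by
        rw [← Real.rpow_natCast, ← Real.rpow_mul hb.le, ← Real.rpow_add hb]; norm_num
      have e2 : (g v - K) ^ (5 / 2 : ℝ) = (g v - K) * ((g v - K) ^ (3 / 4 : ℝ)) ^ 2 := by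
        rw [← Real.rpow_natCast, ← Real.rpow_mul hgK.le, mul_comm, ← Real.rpow_add_one hgK.ne']
        norm_num
      have h5 : (g v - (K + 2 * δ)) ^ (5 / 2 : ℝ) ≤ (g v - K) ^ (5 / 2 : ℝ) :=
        Real.rpow_le_rpow h.le (by linarith) (by norm_num)
      have h6 : ((g v - K) ^ (3 / 4 : ℝ)) ^ 2 ≤ (4 * H v) ^ 2 :=
        pow_le_pow_left₀ (by positivity) hlow 2
      calc bracket v ^ (9 / 2 : ℝ) * (g v - (K + 2 * δ)) ^ (5 / 2 : ℝ)
          ≤ bracket v ^ (9 / 2 : ℝ) * ((g v - K) * (4 * H v) ^ 2) := by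
            gcongr
            exact h5.trans (by rw [e2]; gcongr)
        _ = 16 * (bracket v ^ (3 : ℝ) * (g v - K) * w v ^ 2) := by
            rw [e1]; simp only [hw]; ring
  have hFp : ∫⁻ v, ENNReal.ofReal (bracket v ^ (3 : ℝ) * lp v) ^ (3 / 2 : ℝ) ≤ ENNReal.ofReal ε := by
    refine le_trans (le_of_eq ?_) hε
    congr 1; ext v
    have hb := bracket_pos v
    have hl := hln v
    rw [ENNReal.ofReal_rpow_of_nonneg (by positivity) (by norm_num),
      Real.mul_rpow (by positivity) hl, ← Real.rpow_mul hb.le]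
    norm_num [hlp]
  have hwp : ∫⁻ v, ENNReal.ofReal (w v ^ 2) ^ (3 : ℝ) = ENNReal.ofReal (∫ v, |w v| ^ 6) := by
    rw [ofReal_integral_eq_lintegral_ofReal]
    · congr 1; ext v
      rw [ENNReal.ofReal_rpow_of_nonneg (sq_nonneg _) (by norm_num)]
      congr 1
      rw [← sq_abs]
      norm_cast
      ring
    · exact (hwc.continuous.abs.pow 6).integrable_of_hasCompactSupport
        (hws.mono fun v hv hv' => hv (by simp [hv']))
    · exact ae_of_all _ fun v => by positivity
  have hw6n : 0 ≤ ∫ v, |w v| ^ 6 := integral_nonneg fun v => by positivity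
  rw [← lintegral_rpow_eq_levelIntegral (by linarith) (by norm_num)]
  calc _ ≤ ∫⁻ v, ENNReal.ofReal 16 * ((fun v => ENNReal.ofReal (bracket v ^ (3 : ℝ) * lp v)) *
          fun v => ENNReal.ofReal (w v ^ 2)) v := lintegral_mono hpt
    _ = ENNReal.ofReal 16 * ∫⁻ v, ((fun v => ENNReal.ofReal (bracket v ^ (3 : ℝ) * lp v)) *
          fun v => ENNReal.ofReal (w v ^ 2)) v := lintegral_const_mul _ (hFm.mul hwm)
    _ ≤ ENNReal.ofReal 16 * ((∫⁻ v, ENNReal.ofReal (bracket v ^ (3 : ℝ) * lp v) ^ (3 / 2 : ℝ))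
          ^ (1 / (3 / 2) : ℝ) * (∫⁻ v, ENNReal.ofReal (w v ^ 2) ^ (3 : ℝ)) ^ (1 / 3 : ℝ)) := by
        gcongr
        exact ENNReal.lintegral_mul_le_Lp_mul_Lq volume
          (Real.holderConjugate_iff.mpr ⟨by norm_num, by norm_num⟩) hFm.aemeasurable
          hwm.aemeasurable
    _ ≤ ENNReal.ofReal 16 * (ENNReal.ofReal ε ^ (1 / (3 / 2) : ℝ) *
          (ENNReal.ofReal S * (ENNReal.ofReal 58 * (G + ENNReal.ofReal ε)))) := by
        rw [hwp, ENNReal.ofReal_rpow_of_nonneg hw6n (by norm_num)]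
        gcongr
    _ = _ := by
        rw [ENNReal.ofReal_rpow_of_nonneg hε0 (by norm_num),
          show (1 / (3 / 2) : ℝ) = 2 / 3 by norm_num,
          show 928 * S * ε ^ (2 / 3 : ℝ) = 16 * (ε ^ (2 / 3 : ℝ) * (S * 58)) by ring,
          ENNReal.ofReal_mul (by norm_num : (0 : ℝ) ≤ 16), ENNReal.ofReal_mul (by positivity),
          ENNReal.ofReal_mul hS.le]
        ring

/-! ### The De Giorgi iteration -/

/-- A differential inequality `y' ≤ ψ - c u` is integrated against the weight `σ - t₀`, which
removes the initial value. -/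
lemma integrate_differential_inequality {y y' u ψ : ℝ → ℝ} {c t₀ t₁ s : ℝ} (hc : 0 ≤ c)
    (h01 : t₀ < t₁) (h1s : t₁ ≤ s)
    (hy : ContinuousOn y (Icc t₀ s)) (hu : ContinuousOn u (Icc t₀ s))
    (hψ : ContinuousOn ψ (Icc t₀ s)) (hy0 : ∀ σ, 0 ≤ y σ) (hu0 : ∀ σ, 0 ≤ u σ)
    (hψ0 : ∀ σ, 0 ≤ ψ σ) (hd : ∀ σ ∈ Ioo t₀ s, HasDerivAt y (y' σ) σ)
    (hle : ∀ σ ∈ Ioo t₀ s, y' σ ≤ ψ σ - c * u σ) :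
    ∀ τ ∈ Icc t₁ s, (t₁ - t₀) * y τ + c * (t₁ - t₀) * ∫ σ in t₁..τ, u σ
      ≤ ∫ σ in t₀..s, (y σ + (s - t₀) * ψ σ) := by
  intro τ hτ
  have h0τ : t₀ ≤ τ := h01.le.trans hτ.1
  have hsub : Icc t₀ τ ⊆ Icc t₀ s := Icc_subset_Icc_right hτ.2
  have hw : ContinuousOn (fun σ : ℝ => σ - t₀) (Icc t₀ τ) := by fun_prop
  have hy1 := hy.mono hsub
  have hu1 := hu.mono hsub
  have hψ1 := hψ.mono hsub
  have hφ : ContinuousOn (fun σ => y σ + (σ - t₀) * (ψ σ - c * u σ)) (Icc t₀ τ) :=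
    hy1.add (hw.mul (hψ1.sub (continuousOn_const.mul hu1)))
  have key := intervalIntegral.sub_le_integral_of_hasDeriv_right_of_le
    (g := fun σ => (σ - t₀) * y σ) (g' := fun σ => 1 * y σ + (σ - t₀) * y' σ) h0τ
    (hw.mul hy1)
    (fun σ hσ => ((((hasDerivAt_id σ).sub_const t₀).mul
      (hd σ ⟨hσ.1, hσ.2.trans_le hτ.2⟩))).hasDerivWithinAt)
    (φ := fun σ => y σ + (σ - t₀) * (ψ σ - c * u σ)) (hφ.integrableOn_compact isCompact_Icc)
    (fun σ hσ => by
      have := mul_le_mul_of_nonneg_left (hle σ ⟨hσ.1, hσ.2.trans_le hτ.2⟩)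
        (sub_nonneg.2 hσ.1.le)
      simpa using this)
  rw [sub_self, zero_mul, sub_zero] at key
  have iv {h : ℝ → ℝ} {a b : ℝ} (hh : ContinuousOn h (Icc t₀ s)) (ha : t₀ ≤ a) (hab : a ≤ b)
      (hb : b ≤ s) : IntervalIntegrable h volume a b :=
    (hh.mono (Icc_subset_Icc ha hb)).intervalIntegrable_of_Icc hab
  have hw' : ContinuousOn (fun σ : ℝ => σ - t₀) (Icc t₀ s) := by fun_prop
  have hF : ContinuousOn (fun σ => y σ + (s - t₀) * ψ σ) (Icc t₀ s) :=
    hy.add (continuousOn_const.mul hψ)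
  have hG : ContinuousOn (fun σ => (σ - t₀) * u σ) (Icc t₀ s) := hw'.mul hu
  have b1 : ∫ σ in t₀..τ, (y σ + (σ - t₀) * (ψ σ - c * u σ))
      ≤ ∫ σ in t₀..τ, ((y σ + (s - t₀) * ψ σ) - c * ((σ - t₀) * u σ)) := by
    refine intervalIntegral.integral_mono_on h0τ (hφ.intervalIntegrable_of_Icc h0τ)
      (iv (hF.sub (continuousOn_const.mul hG)) le_rfl h0τ hτ.2) fun σ hσ => ?_
    have := mul_le_mul_of_nonneg_right
      (show σ - t₀ ≤ s - t₀ by linarith [hσ.2, hτ.2]) (hψ0 σ)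
    linarith
  rw [intervalIntegral.integral_sub (iv hF le_rfl h0τ hτ.2)
    ((iv hG le_rfl h0τ hτ.2).const_mul c), intervalIntegral.integral_const_mul] at b1
  have b2 : ∫ σ in t₀..τ, (y σ + (s - t₀) * ψ σ) ≤ ∫ σ in t₀..s, (y σ + (s - t₀) * ψ σ) := by
    rw [← intervalIntegral.integral_add_adjacent_intervals (iv hF le_rfl h0τ hτ.2)
      (iv hF h0τ hτ.2 le_rfl)]
    refine le_add_of_nonneg_right (intervalIntegral.integral_nonneg hτ.2 fun σ _ =>
      add_nonneg (hy0 σ) (mul_nonneg (by linarith) (hψ0 σ)))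
  have b3 : (t₁ - t₀) * ∫ σ in t₁..τ, u σ ≤ ∫ σ in t₀..τ, (σ - t₀) * u σ := by
    rw [← intervalIntegral.integral_add_adjacent_intervals (iv hG le_rfl h01.le h1s)
      (iv hG h01.le hτ.1 hτ.2), ← intervalIntegral.integral_const_mul]
    refine le_add_of_nonneg_of_le (intervalIntegral.integral_nonneg h01.le fun σ hσ =>
      mul_nonneg (sub_nonneg.2 hσ.1) (hu0 σ)) ?_
    refine intervalIntegral.integral_mono_on hτ.1 ((iv hu h01.le hτ.1 hτ.2).const_mul _)
      (iv hG h01.le hτ.1 hτ.2) fun σ hσ => ?_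
    have := hσ.1
    have := hu0 σ
    gcongr
  have b4 := mul_le_mul_of_nonneg_left b3 hc
  have b5 : (t₁ - t₀) * y τ ≤ (τ - t₀) * y τ := by
    have := hy0 τ
    have := hτ.1
    gcongr
  linarith

section Iteration
variable {T : ℝ} {f : ℝ → E3 → ℝ}

lemma IsSmoothDecayingSolution.continuousOn_sobolevNorm (hf : IsSmoothDecayingSolution T f)
    {ℓ : ℝ} (hℓ : 0 < ℓ) : ContinuousOn (fun t => sobolevNorm ℓ (f t)) (Icc 0 T) :=
  (hf.continuousOn_levelIntegral hℓ (by norm_num)).rpow_const fun _ _ => Or.inr (by norm_num)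

/-- The energy inequality at the level `ℓ`, with constants `c` and `C`. -/
def EnergyInequality (T : ℝ) (f : ℝ → E3 → ℝ) (c C ℓ : ℝ) : Prop :=
  ∀ t ∈ Ioo 0 T,
    5 / 2 * ∫ v, bracket v ^ (9 / 2 : ℝ) * posPow (3 / 2) (f t v - ℓ) * divergence (flux (f t)) v
      ≤ C * (ℓ * levelIntegral (5 / 2) ℓ (f t) + ℓ ^ 2 * levelIntegral (3 / 2) ℓ (f t))
        - c * sobolevNorm ℓ (f t)

/-- The energy at level `ℓ` is at most `E` on `[t, s]`, and so is the time integral of the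
Sobolev norm. -/
def EnergyBound (f : ℝ → E3 → ℝ) (ℓ t s E : ℝ) : Prop :=
  (∀ τ ∈ Icc t s, levelIntegral (5 / 2) ℓ (f τ) ≤ E) ∧ ∫ τ in t..s, sobolevNorm ℓ (f τ) ≤ E

/-- One step in time: an integral bound on `[t₀, s]` becomes an energy bound on `[t₁, s]`. -/
lemma IsSmoothDecayingSolution.energyBound_of_integral (hf : IsSmoothDecayingSolution T f)
    {c C ℓ t₀ t₁ s B : ℝ} {h : ℝ → ℝ} (hc : 0 < c) (hc1 : c ≤ 1) (hC : 0 < C) (hℓ : 0 < ℓ)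
    (h0 : 0 ≤ t₀) (h01 : t₀ < t₁) (h1s : t₁ ≤ s) (hsT : s ≤ T)
    (hE : EnergyInequality T f c C ℓ) (hh : ContinuousOn h (Icc t₀ s))
    (hle : ∀ σ ∈ Icc t₀ s, levelIntegral (5 / 2) ℓ (f σ) + (s - t₀) *
      (C * (ℓ * levelIntegral (5 / 2) ℓ (f σ) + ℓ ^ 2 * levelIntegral (3 / 2) ℓ (f σ))) ≤ h σ)
    (hB : ∫ σ in t₀..s, h σ ≤ B) :
    EnergyBound f ℓ t₁ s (B / (c * (t₁ - t₀))) := by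
  have hsub : Icc t₀ s ⊆ Icc 0 T := Icc_subset_Icc h0 hsT
  have hY := (hf.continuousOn_levelIntegral hℓ (s := 5 / 2) (by norm_num)).mono hsub
  have hZ := (hf.continuousOn_levelIntegral hℓ (s := 3 / 2) (by norm_num)).mono hsub
  have hU := (hf.continuousOn_sobolevNorm hℓ).mono hsub
  have hψ : ContinuousOn (fun σ => C * (ℓ * levelIntegral (5 / 2) ℓ (f σ)
      + ℓ ^ 2 * levelIntegral (3 / 2) ℓ (f σ))) (Icc t₀ s) :=
    continuousOn_const.mul ((continuousOn_const.mul hY).add (continuousOn_const.mul hZ))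
  have h0s : t₀ ≤ s := h01.le.trans h1s
  have hY0 (σ : ℝ) := levelIntegral_nonneg (5 / 2) ℓ (f σ)
  have hU0 (σ : ℝ) := sobolevNorm_nonneg ℓ (f σ)
  have key := integrate_differential_inequality hc.le h01 h1s hY hU hψ hY0 hU0
    (fun σ => by
      have := hY0 σ
      have := levelIntegral_nonneg (3 / 2) ℓ (f σ)
      positivity)
    (fun σ hσ => hf.hasDerivAt_levelIntegral hℓ ⟨h0.trans_lt hσ.1, hσ.2.trans_le hsT⟩)
    (fun σ hσ => hE σ ⟨h0.trans_lt hσ.1, hσ.2.trans_le hsT⟩)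
  have hI := (intervalIntegral.integral_mono_on h0s
    ((hY.add (continuousOn_const.mul hψ)).intervalIntegrable_of_Icc h0s)
    (hh.intervalIntegrable_of_Icc h0s) hle).trans hB
  have ht : 0 < t₁ - t₀ := sub_pos.2 h01
  constructor
  · intro τ hτ
    have k := (key τ hτ).trans hI
    have hu : 0 ≤ ∫ σ in t₁..τ, sobolevNorm ℓ (f σ) :=
      intervalIntegral.integral_nonneg hτ.1 fun σ _ => hU0 σ
    rw [le_div_iff₀ (by positivity)]
    have h1 : c * ((t₁ - t₀) * levelIntegral (5 / 2) ℓ (f τ))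
        ≤ 1 * ((t₁ - t₀) * levelIntegral (5 / 2) ℓ (f τ)) :=
      mul_le_mul_of_nonneg_right hc1 (mul_nonneg ht.le (hY0 τ))
    have h2 : 0 ≤ c * (t₁ - t₀) * ∫ σ in t₁..τ, sobolevNorm ℓ (f σ) := by positivity
    linarith
  · have k := (key s ⟨h1s, le_rfl⟩).trans hI
    rw [le_div_iff₀ (by positivity)]
    have := mul_nonneg ht.le (hY0 s)
    linarith

/-- One step of the iteration: raising the level by `Δ` and shrinking the time interval turns the
energy bound `E` into a multiple of `E^(5/3)`. -/
lemma IsSmoothDecayingSolution.energyBound_step (hf : IsSmoothDecayingSolution T f)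
    {c C ℓ Δ t₀ t₁ s E : ℝ} (hc : 0 < c) (hc1 : c ≤ 1) (hC : 0 < C) (hℓ : 0 < ℓ) (hΔ : 0 < Δ)
    (h0 : 0 ≤ t₀) (h01 : t₀ < t₁) (h1s : t₁ ≤ s) (hsT : s ≤ T) (hE0 : 0 ≤ E)
    (hE : EnergyInequality T f c C (ℓ + Δ)) (hb : EnergyBound f ℓ t₀ s E) :
    EnergyBound f (ℓ + Δ) t₁ s (Δ ^ (-(5 / 3) : ℝ) *
      (1 + (s - t₀) * (C * ((ℓ + Δ) + (ℓ + Δ) ^ 2 / Δ))) * E ^ (5 / 3 : ℝ)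
        / (c * (t₁ - t₀))) := by
  have hsub : Icc t₀ s ⊆ Icc 0 T := Icc_subset_Icc h0 hsT
  have h0s : t₀ ≤ s := h01.le.trans h1s
  have hst : 0 ≤ s - t₀ := sub_nonneg.2 h0s
  have hX := (hf.continuousOn_levelIntegral hℓ (s := 25 / 6) (by norm_num)).mono hsub
  have hU := (hf.continuousOn_sobolevNorm hℓ).mono hsub
  set D : ℝ := Δ ^ (-(5 / 3) : ℝ) * (1 + (s - t₀) * (C * ((ℓ + Δ) + (ℓ + Δ) ^ 2 / Δ)))
  refine hf.energyBound_of_integral (h := fun σ => D * levelIntegral (25 / 6) ℓ (f σ)) hc hc1 hC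
    (by positivity) h0 h01 h1s hsT hE (continuousOn_const.mul hX) (fun σ hσ => ?_) ?_
  · obtain ⟨g, hg⟩ := hf.exists_schwartz (hsub hσ)
    rw [← hg]
    have c1 := levelIntegral_chebyshev g (q := 25 / 6) hℓ hΔ (s := 5 / 2) (by norm_num)
      (by norm_num)
    have c2 := levelIntegral_chebyshev g (q := 25 / 6) hℓ hΔ (s := 3 / 2) (by norm_num)
      (by norm_num)
    rw [show (5 / 2 - 25 / 6 : ℝ) = -(5 / 3) by norm_num] at c1
    rw [show (3 / 2 - 25 / 6 : ℝ) = -(5 / 3) - 1 by norm_num, Real.rpow_sub_one hΔ.ne'] at c2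
    calc _ ≤ Δ ^ (-(5 / 3) : ℝ) * levelIntegral (25 / 6) ℓ g + (s - t₀) *
          (C * ((ℓ + Δ) * (Δ ^ (-(5 / 3) : ℝ) * levelIntegral (25 / 6) ℓ g)
            + (ℓ + Δ) ^ 2 * (Δ ^ (-(5 / 3) : ℝ) / Δ * levelIntegral (25 / 6) ℓ g))) := by gcongr
      _ = _ := by simp only [D]; ring
  · have hD : 0 ≤ D := by positivity
    rw [intervalIntegral.integral_const_mul]
    refine mul_le_mul_of_nonneg_left ?_ hD
    calc ∫ σ in t₀..s, levelIntegral (25 / 6) ℓ (f σ)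
        ≤ ∫ σ in t₀..s, sobolevNorm ℓ (f σ) * E ^ (2 / 3 : ℝ) := by
          refine intervalIntegral.integral_mono_on h0s (hX.intervalIntegrable_of_Icc h0s)
            ((hU.mul continuousOn_const).intervalIntegrable_of_Icc h0s) fun σ hσ => ?_
          obtain ⟨g, hg⟩ := hf.exists_schwartz (hsub hσ)
          have hY := hb.1 σ hσ
          rw [← hg] at hY ⊢
          refine (levelIntegral_interpolation g hℓ).trans ?_
          have := sobolevNorm_nonneg ℓ g
          have := levelIntegral_nonneg (5 / 2) ℓ g
          gcongr
      _ ≤ E * E ^ (2 / 3 : ℝ) := by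
          rw [intervalIntegral.integral_mul_const]
          exact mul_le_mul_of_nonneg_right hb.2 (by positivity)
      _ = E ^ (5 / 3 : ℝ) := by
          rw [show (5 / 3 : ℝ) = 1 + 2 / 3 by norm_num, Real.rpow_add_of_nonneg hE0 (by norm_num)
            (by norm_num), Real.rpow_one]

lemma EnergyBound.mono {ℓ t s E E' : ℝ} (h : EnergyBound f ℓ t s E) (hE : E ≤ E') :
    EnergyBound f ℓ t s E' :=
  ⟨fun τ hτ => (h.1 τ hτ).trans hE, h.2.trans hE⟩

/-- A function whose energy at level `ℓ` vanishes is at most `ℓ`. -/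
lemma le_of_levelIntegral_eq_zero (g : 𝓢(E3, ℝ)) {ℓ : ℝ} (hℓ : 0 < ℓ)
    (h : levelIntegral (5 / 2) ℓ g = 0) (v : E3) : g v ≤ ℓ := by
  have hc := continuous_weighted g.continuous (9 / 2) (s := 5 / 2) (by norm_num) ℓ
  have h0 := (integral_eq_zero_iff_of_nonneg (fun v => mul_nonneg
    (Real.rpow_nonneg (bracket_pos v).le _) (posPow_nonneg _ _))
    (integrable_levelIntegral g hℓ (by norm_num))).1 h
  have h1 := congrFun ((Continuous.ae_eq_iff_eq volume hc continuous_zero).1 h0) v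
  by_contra! hv
  have hv' : 0 < g v - ℓ := sub_pos.2 hv
  have hb := bracket_pos v
  simp only [posPow_of_nonneg hv'.le] at h1
  have : 0 < bracket v ^ (9 / 2 : ℝ) * (g v - ℓ) ^ (5 / 2 : ℝ) := by positivity
  exact this.ne' h1

/-- If the energy at a level `ℓ₀` comparable to `M` is small, the iteration shows that it vanishes
at the level `ℓ₀ + M` at the final time. -/
lemma IsSmoothDecayingSolution.le_of_energyBound (hf : IsSmoothDecayingSolution T f)
    {c C ℓ₀ M r s E : ℝ} (hc : 0 < c) (hc1 : c ≤ 1) (hC : 0 < C) (hM : 0 < M) (hMℓ : M ≤ ℓ₀)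
    (hℓM : ℓ₀ ≤ 3 * M) (hr : 0 < r) (hrs : r ≤ s) (hsT : s ≤ T) (hE0 : 0 ≤ E)
    (hE : ∀ ℓ, ℓ₀ ≤ ℓ → EnergyInequality T f c C ℓ)
    (hb : EnergyBound f ℓ₀ (s - r / 2) s E)
    (hsmall : (16 / c * (1 + 20 * C)) * (1 / r + M) * M ^ (-(5 / 3) : ℝ) * E ^ (2 / 3 : ℝ)
      ≤ 1 / 64) (v : E3) : f s v ≤ ℓ₀ + M := by
  have hs0 : 0 ≤ s := hr.le.trans hrs
  obtain ⟨g, hg⟩ := hf.exists_schwartz ⟨hs0, hsT⟩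
  -- the rate `64⁻¹` is dictated by `64^(5/3) = 1024 = 16 * 64`: one step loses a factor `16 ^ k`,
  -- namely `2 ^ k` from the time increment, `4 ^ k` from `Δ^(-5/3)` and `2 ^ k` from `ℓ² / Δ`
  have hiter (k : ℕ) : EnergyBound f (ℓ₀ + M * (1 - (1 / 2) ^ k)) (s - r / 2 * (1 / 2) ^ k) s
      (E / 64 ^ k) := by
    induction k with
    | zero => simpa using hb
    | succ k ih =>
      set q : ℝ := (1 / 2) ^ k with hq
      have hq0 : 0 < q := by positivity
      have hq1 : q ≤ 1 := pow_le_one₀ (by norm_num) (by norm_num)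
      have eℓ : ℓ₀ + M * (1 - (1 / 2) ^ (k + 1)) = ℓ₀ + M * (1 - q) + M * q / 2 := by
        rw [pow_succ]; ring
      have et : s - r / 2 * (1 / 2) ^ (k + 1) = s - r / 2 * q + r * q / 4 := by
        rw [pow_succ]; ring
      rw [eℓ, et]
      have hℓk : ℓ₀ ≤ ℓ₀ + M * (1 - q) :=
        le_add_of_nonneg_right (mul_nonneg hM.le (by linarith))
      have hrq : r * q ≤ r := mul_le_of_le_one_right hr.le hq1
      have hMq : M * q ≤ M := mul_le_of_le_one_right hM.le hq1
      have hrq0 : 0 < r * q := by positivity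
      have hMq0 : 0 < M * q := by positivity
      refine (hf.energyBound_step hc hc1 hC (hM.trans_le (hMℓ.trans hℓk))
        (Δ := M * q / 2) (by positivity) (t₀ := s - r / 2 * q) (by linarith)
        (by linarith) (by linarith) hsT (by positivity) (hE _ (by linarith)) ih).mono ?_
      set L := ℓ₀ + M * (1 - q) + M * q / 2
      have hL0 : 0 < L := by simp only [L]; linarith
      have hL : L ≤ 4 * M := by simp only [L]; linarith
      have hqi : 1 ≤ q⁻¹ := (one_le_inv₀ hq0).2 hq1
      have p1 : (M * q / 2) ^ (-(5 / 3) : ℝ) ≤ M ^ (-(5 / 3) : ℝ) * (4 * q⁻¹ ^ 2) := by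
        rw [show M * q / 2 = M * (q / 2) by ring, Real.mul_rpow hM.le (by positivity)]
        gcongr
        calc (q / 2) ^ (-(5 / 3) : ℝ) ≤ (q / 2) ^ (-2 : ℝ) :=
              Real.rpow_le_rpow_of_exponent_ge (by positivity) (by linarith) (by norm_num)
          _ = 4 * q⁻¹ ^ 2 := by
              rw [Real.rpow_neg (by positivity)]
              norm_cast
              field_simp
              norm_num
      have p2 : 1 + (s - (s - r / 2 * q)) * (C * (L + L ^ 2 / (M * q / 2)))
          ≤ (1 + 20 * C) * (1 / r + M) * r * q⁻¹ := by
        have a1 : L ^ 2 / (M * q / 2) ≤ 32 * M * q⁻¹ := by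
          calc L ^ 2 / (M * q / 2) ≤ (4 * M) ^ 2 / (M * q / 2) := by gcongr
            _ = 32 * M * q⁻¹ := by field_simp; ring
        have a2 : L ≤ 4 * M * q⁻¹ := hL.trans (le_mul_of_one_le_right (by positivity) hqi)
        have a3 : s - (s - r / 2 * q) ≤ r / 2 := by linarith
        have a4 : 0 ≤ L + L ^ 2 / (M * q / 2) := by positivity
        calc _ ≤ q⁻¹ + r / 2 * (C * (4 * M * q⁻¹ + 32 * M * q⁻¹)) := by gcongr
          _ = (1 + 18 * C * (M * r)) * q⁻¹ := by ring
          _ ≤ (1 + 20 * C) * (1 + M * r) * q⁻¹ := by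
              gcongr
              have : 0 < M * r := by positivity
              nlinarith
          _ = _ := by field_simp
      have p3 : (E / 64 ^ k) ^ (5 / 3 : ℝ) = E * E ^ (2 / 3 : ℝ) / 1024 ^ k := by
        rw [Real.div_rpow hE0 (by positivity)]
        congr 1
        · rw [show (5 / 3 : ℝ) = 1 + 2 / 3 by norm_num, Real.rpow_add_of_nonneg hE0
            (by norm_num) (by norm_num), Real.rpow_one]
        · rw [← Real.rpow_natCast, ← Real.rpow_natCast, show (64 : ℝ) = 2 ^ (6 : ℝ) by norm_num,
            show (1024 : ℝ) = 2 ^ (10 : ℝ) by norm_num, ← Real.rpow_mul (by norm_num),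
            ← Real.rpow_mul (by norm_num), ← Real.rpow_mul (by norm_num)]
          congr 1
          ring
      have e3 : q⁻¹ = 2 ^ k := by rw [hq]; simp
      have e4 : (1024 : ℝ) ^ k = 64 ^ k * (2 ^ k) ^ 4 := by
        rw [← pow_mul, mul_comm k 4, pow_mul, ← mul_pow]; norm_num
      rw [p3, show s - r / 2 * q + r * q / 4 - (s - r / 2 * q) = r * q / 4 by ring]
      have hR := Real.rpow_nonneg hE0 (2 / 3)
      have hMr := Real.rpow_nonneg hM.le (-(5 / 3))
      have a5 : 0 ≤ s - (s - r / 2 * q) := by linarith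
      calc _ ≤ M ^ (-(5 / 3) : ℝ) * (4 * q⁻¹ ^ 2) * ((1 + 20 * C) * (1 / r + M) * r * q⁻¹)
              * (E * E ^ (2 / 3 : ℝ) / 1024 ^ k) / (c * (r * q / 4)) := by gcongr
        _ = (16 / c * (1 + 20 * C)) * (1 / r + M) * M ^ (-(5 / 3) : ℝ) * E ^ (2 / 3 : ℝ)
              * (E / 64 ^ k) := by
            rw [e4, ← e3]
            field_simp
            try ring
        _ ≤ 1 / 64 * (E / 64 ^ k) := by gcongr
        _ = E / 64 ^ (k + 1) := by rw [pow_succ]; ring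
  rw [← hg]
  refine le_of_levelIntegral_eq_zero g (by linarith) (le_antisymm ?_ (levelIntegral_nonneg _ _ _)) v
  have hlim : Tendsto (fun k : ℕ => E / 64 ^ k) atTop (𝓝 0) := by
    have := (tendsto_pow_atTop_nhds_zero_of_lt_one (r := (1 / 64 : ℝ)) (by norm_num)
      (by norm_num)).const_mul E
    rw [mul_zero] at this
    refine this.congr fun k => ?_
    rw [one_div, inv_pow, div_eq_mul_inv]
  refine ge_of_tendsto' hlim fun k => ?_
  have h1 := (hiter k).1 s ⟨by have : 0 ≤ r / 2 * (1 / 2) ^ k := by positivity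
                               linarith, le_rfl⟩
  rw [← hg] at h1
  have hk : (0 : ℝ) < (1 / 2) ^ k := by positivity
  have hk1 : ((1 : ℝ) / 2) ^ k ≤ 1 := pow_le_one₀ (by norm_num) (by norm_num)
  have h2 := levelIntegral_chebyshev g (ℓ := ℓ₀ + M * (1 - (1 / 2) ^ k)) (Δ := M * (1 / 2) ^ k)
    (s := 5 / 2) (q := 5 / 2)
    (by have := mul_nonneg hM.le (sub_nonneg.2 hk1); linarith) (by positivity) (by norm_num) le_rfl
  rw [sub_self, Real.rpow_zero, one_mul, show ℓ₀ + M * (1 - (1 / 2) ^ k) + M * (1 / 2) ^ k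
    = ℓ₀ + M by ring] at h2
  exact h2.trans h1

end Iteration

/-! ### The pointwise bound -/

section Bound
variable {T : ℝ} {f : ℝ → E3 → ℝ}

lemma lintegral_levelPart_le_criticalEnergy (K : ℝ) {τ : ℝ} (hτ : τ ∈ Ioo 0 T) :
    ∫⁻ v, ENNReal.ofReal (bracket v ^ (9 / 2 : ℝ) * levelPart K (f τ) v ^ (3 / 2 : ℝ))
      ≤ criticalEnergy K T f :=
  (le_iSup₂ (f := fun τ (_ : τ ∈ Ioo 0 T) => ∫⁻ v, ENNReal.ofReal
    (bracket v ^ (9 / 2 : ℝ) * levelPart K (f τ) v ^ (3 / 2 : ℝ))) τ hτ).trans le_self_add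

/-- The energy above the level `K + 2 δ`, integrated over a time interval of length at most one,
is controlled by the critical energy. -/
lemma exists_integral_energy_le : ∃ C : ℝ, 0 < C ∧ ∀ (T : ℝ) (f : ℝ → E3 → ℝ),
    IsSmoothDecayingSolution T f → ∀ K δ t₀ s : ℝ, 0 ≤ K → 0 < δ → 0 ≤ t₀ → t₀ ≤ s → s ≤ T →
    s - t₀ ≤ 1 → criticalEnergy K T f ≠ ⊤ →
    ∫ τ in t₀..s, levelIntegral (5 / 2) (K + 2 * δ) (f τ)
      ≤ C * (criticalEnergy K T f).toReal ^ (2 / 3 : ℝ) * (criticalEnergy K T f).toReal := by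
  obtain ⟨C, hC, h⟩ := exists_initial_bound
  refine ⟨2 * C, by positivity, fun T f hf K δ t₀ s hK hδ h0 h0s hsT h1 hfin => ?_⟩
  set ε := (criticalEnergy K T f).toReal with hε
  have hε0 : 0 ≤ ε := ENNReal.toReal_nonneg
  have hεe : ENNReal.ofReal ε = criticalEnergy K T f := ENNReal.ofReal_toReal hfin
  have hsub : Ioo t₀ s ⊆ Ioo 0 T := Ioo_subset_Ioo h0 hsT
  have hcont := (hf.continuousOn_levelIntegral (ℓ := K + 2 * δ) (by linarith) (s := 5 / 2)
    (by norm_num)).mono (Icc_subset_Icc h0 hsT)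
  rw [intervalIntegral.integral_of_le h0s, integral_Ioc_eq_integral_Ioo]
  refine (ENNReal.ofReal_le_ofReal_iff (by positivity)).1 ?_
  rw [ofReal_integral_eq_lintegral_ofReal
    ((hcont.integrableOn_compact isCompact_Icc).mono_set Ioo_subset_Icc_self)
    (ae_of_all _ fun τ => levelIntegral_nonneg _ _ _)]
  set G : ℝ → ℝ≥0∞ := fun τ => ∫⁻ v, ENNReal.ofReal (bracket v ^ (3 / 2 : ℝ) *
    ‖gradient (fun w => levelPart K (f τ) w ^ (3 / 4 : ℝ)) v‖ ^ 2)
  have hG : ∫⁻ τ in Ioo t₀ s, G τ ≤ ENNReal.ofReal ε := by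
    rw [hεe]
    exact (lintegral_mono_set hsub).trans le_add_self
  calc ∫⁻ τ in Ioo t₀ s, ENNReal.ofReal (levelIntegral (5 / 2) (K + 2 * δ) (f τ))
      ≤ ∫⁻ τ in Ioo t₀ s, ENNReal.ofReal (C * ε ^ (2 / 3 : ℝ)) * (G τ + ENNReal.ofReal ε) := by
        refine setLIntegral_mono' measurableSet_Ioo fun τ hτ => ?_
        obtain ⟨g, hg⟩ := hf.exists_schwartz (Ioo_subset_Icc_self (hsub hτ))
        have hs := lintegral_levelPart_le_criticalEnergy (f := f) K (hsub hτ)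
        rw [← hεe, ← hg] at hs
        simp only [G]
        rw [← hg]
        exact h g K δ ε hK hδ hε0 hs
    _ = ENNReal.ofReal (C * ε ^ (2 / 3 : ℝ)) *
          ((∫⁻ τ in Ioo t₀ s, G τ) + ENNReal.ofReal ε * ENNReal.ofReal (s - t₀)) := by
        rw [lintegral_const_mul' _ _ ENNReal.ofReal_ne_top, lintegral_add_right _ measurable_const,
          setLIntegral_const, Real.volume_Ioo]
    _ ≤ ENNReal.ofReal (C * ε ^ (2 / 3 : ℝ)) * (ENNReal.ofReal ε + ENNReal.ofReal ε * 1) := by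
        gcongr
        exact ENNReal.ofReal_le_one.2 h1
    _ = _ := by
        rw [mul_one, ← ENNReal.ofReal_add hε0 hε0, ← ENNReal.ofReal_mul (by positivity)]
        congr 1
        ring

lemma EnergyInequality.mono {c c' C ℓ : ℝ} (h : EnergyInequality T f c C ℓ) (hc : c' ≤ c) :
    EnergyInequality T f c' C ℓ := fun t ht => (h t ht).trans <| by
  have := mul_le_mul_of_nonneg_right hc (sobolevNorm_nonneg ℓ (f t))
  linarith

end Bound

end LandauCoulomb

open LandauCoulomb

theorem mainTheorem4 (c₀ : ℝ) (hc₀ : 0 < c₀) :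
    ∃ ε₀ : ℝ, 0 < ε₀ ∧ ∃ Cstar : ℝ, 0 < Cstar ∧
      ∀ (T : ℝ), 0 < T → ∀ f : ℝ → LandauCoulomb.E3 → ℝ,
        LandauCoulomb.IsSmoothDecayingSolution T f →
        LandauCoulomb.IsNormalised (f 0) →
        (∀ t ∈ Set.Icc 0 T, ∀ v,
          (LandauCoulomb.coeffA (f t) v
            - (c₀ * (LandauCoulomb.bracket v ^ 3)⁻¹) •
              (1 : Matrix (Fin 3) (Fin 3) ℝ)).PosSemidef) →
        ∀ K : ℝ, 0 ≤ K →
          LandauCoulomb.criticalEnergy K T f < ENNReal.ofReal ε₀ →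
          ∀ t : ℝ, 0 < t → ∀ τ ∈ Set.Icc t T, ∀ v,
            f τ v ≤ Cstar * (K + 1)
              + Cstar * (LandauCoulomb.criticalEnergy K T f).toReal ^ (2 / 3 : ℝ) * t⁻¹ := by
  obtain ⟨ε₁, hε₁, c', hc', C, hC, henergy⟩ := exists_energy_inequality hc₀
  obtain ⟨I, hI, hinit⟩ := exists_integral_energy_le
  set c := min c' 1
  have hc : 0 < c := lt_min hc' one_pos
  have hc1 : c ≤ 1 := min_le_right _ _
  set A₁ : ℝ := 2 * I / c * (1 + 12 * C) with hA₁
  set A₂ : ℝ := 16 / c * (1 + 20 * C) with hA₂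
  have hA₁0 : 0 < A₁ := by positivity
  have hA₂0 : 0 < A₂ := by positivity
  -- `N` is the weight of the critical energy in the truncation level; its summands make the
  -- starting energy at most `M ε` and meet the smallness condition of the iteration
  set N : ℝ := 1 + 2 * A₁ + 128 * A₂ with hN
  have hN0 : 0 < N := by positivity
  refine ⟨min ε₁ ((1 / N) ^ (3 / 2 : ℝ)), lt_min hε₁ (by positivity), 8 + 4 * N, by positivity,
    fun T hT f hf hnorm hA K hK hcrit t ht s hs v => ?_⟩
  have hs0 : 0 < s := ht.trans_le hs.1
  have hfin : criticalEnergy K T f ≠ ⊤ := hcrit.ne_top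
  set ε := (criticalEnergy K T f).toReal with hε
  have hε0 : 0 ≤ ε := ENNReal.toReal_nonneg
  have hεlt : ε < min ε₁ ((1 / N) ^ (3 / 2 : ℝ)) := ENNReal.toReal_lt_of_lt_ofReal hcrit
  have hεe : ENNReal.ofReal ε = criticalEnergy K T f := ENNReal.ofReal_toReal hfin
  set a := ε ^ (2 / 3 : ℝ) with ha
  have ha0 : 0 ≤ a := by positivity
  have haN : a * N ≤ 1 := by
    have h1 : a ≤ ((1 / N) ^ (3 / 2 : ℝ)) ^ (2 / 3 : ℝ) :=
      Real.rpow_le_rpow hε0 (hεlt.le.trans (min_le_right _ _)) (by norm_num)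
    rw [← Real.rpow_mul (by positivity), show (3 / 2 * (2 / 3) : ℝ) = 1 by norm_num,
      Real.rpow_one] at h1
    rwa [le_div_iff₀ hN0] at h1
  set r := min s 1 with hr
  have hr0 : 0 < r := lt_min hs0 one_pos
  have hr1 : r ≤ 1 := min_le_right _ _
  have hrs : r ≤ s := min_le_left _ _
  have hrinv : 1 / r ≤ 1 + t⁻¹ := by
    have : s⁻¹ ≤ t⁻¹ := inv_anti₀ ht hs.1
    rcases min_choice s 1 with h | h
    · rw [hr, h, one_div]; linarith
    · rw [hr, h]; have := inv_pos.2 ht; norm_num; positivity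
  set M := (K + 1) + N * a / r with hM
  have hNar : 0 ≤ N * a / r := by positivity
  have hM1 : 1 ≤ M := by linarith
  have hM0 : 0 < M := one_pos.trans_le hM1
  have hKM : K ≤ M := by linarith
  have hmass : (1 / r + M) * a * N ≤ 2 * M := by
    have h1 : 1 / r * a * N ≤ M := by
      calc 1 / r * a * N = N * a / r := by ring
        _ ≤ M := by linarith
    have h2 : M * (a * N) ≤ M * 1 := mul_le_mul_of_nonneg_left haN hM0.le
    linarith
  have hE (ℓ : ℝ) (hℓ : K + 2 * M ≤ ℓ) : EnergyInequality T f c C ℓ := by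
    refine EnergyInequality.mono (c := c') (fun τ hτ => ?_) (min_le_left _ _)
    have hτ' := Ioo_subset_Icc_self hτ
    obtain ⟨g, hg⟩ := hf.exists_schwartz hτ'
    have h1 := lintegral_levelPart_le_criticalEnergy (f := f) K hτ
    have h2 := hf.integral_le_one hnorm hτ'
    have h3 := hA τ hτ'
    have h4 := hf.nonneg τ hτ'
    rw [← hεe] at h1
    rw [← hg] at h1 h2 h3 h4 ⊢
    exact henergy g h4 h2 h3 K hK ε hε0 (hεlt.le.trans (min_le_left _ _)) h1 ℓ (by linarith)
      (by linarith)
  -- the window `[s - r, s]` has length at most one and lies in `[0, T]`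
  have hstart : EnergyBound f (K + 2 * M) (s - r / 2) s (M * ε) := by
    have hsub : Icc (s - r) s ⊆ Icc 0 T := Icc_subset_Icc (by linarith) hs.2
    have hKM0 : 0 < K + M := by linarith
    have hY := (hf.continuousOn_levelIntegral hKM0 (s := 5 / 2) (by norm_num)).mono hsub
    have hi := hinit T f hf K (M / 2) (s - r) s hK (by linarith) (by linarith) (by linarith) hs.2
      (by linarith) hfin
    rw [mul_div_cancel₀ _ (two_ne_zero' ℝ)] at hi
    refine (hf.energyBound_of_integral (t₀ := s - r) (B := (1 + r * (C * (12 * M))) * (I * a * ε))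
      (h := fun σ => (1 + r * (C * (12 * M))) * levelIntegral (5 / 2) (K + M) (f σ)) hc hc1 hC
      (by linarith) (by linarith) (by linarith) (by linarith) hs.2 (hE _ le_rfl)
      (continuousOn_const.mul hY) (fun σ hσ => ?_) ?_).mono ?_
    · obtain ⟨g, hg⟩ := hf.exists_schwartz (hsub hσ)
      rw [← hg]
      have c1 := levelIntegral_chebyshev g (q := 5 / 2) hKM0 hM0 (s := 5 / 2) (by norm_num) le_rfl
      have c2 := levelIntegral_chebyshev g (q := 5 / 2) hKM0 hM0 (s := 3 / 2) (by norm_num)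
        (by norm_num)
      rw [sub_self, Real.rpow_zero, one_mul] at c1
      rw [show (3 / 2 - 5 / 2 : ℝ) = -1 by norm_num, Real.rpow_neg_one] at c2
      rw [show K + M + M = K + 2 * M by ring] at c1 c2
      have hy := levelIntegral_nonneg (5 / 2) (K + 2 * M) g
      have hz := levelIntegral_nonneg (3 / 2) (K + 2 * M) g
      have hℓ : K + 2 * M ≤ 3 * M := by linarith
      rw [sub_sub_cancel]
      calc _ ≤ levelIntegral (5 / 2) (K + M) g + r * (C * (3 * M * levelIntegral (5 / 2) (K + M) g
            + (3 * M) ^ 2 * (M⁻¹ * levelIntegral (5 / 2) (K + M) g))) := by gcongr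
        _ = _ := by field_simp; ring
    · rw [intervalIntegral.integral_const_mul]
      gcongr
    · have h1 : 1 + r * (C * (12 * M)) ≤ (1 + 12 * C) * (1 / r + M) * r := by
        have : (1 + 12 * C) * (1 / r + M) * r = (1 + 12 * C) * (1 + M * r) := by field_simp
        rw [this]
        have : 0 < M * r := by positivity
        nlinarith
      calc _ ≤ (1 + 12 * C) * (1 / r + M) * r * (I * a * ε) / (c * (s - r / 2 - (s - r))) := by
            have : 0 < s - r / 2 - (s - r) := by linarith
            gcongr
        _ = A₁ * ((1 / r + M) * a) * ε := by
            rw [hA₁, show s - r / 2 - (s - r) = r / 2 by ring]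
            field_simp
        _ ≤ M * ε := by
            gcongr
            have h2 : 0 ≤ (1 / r + M) * a := by positivity
            have h3 : 2 * A₁ ≤ N := by linarith
            have := mul_le_mul_of_nonneg_left h3 h2
            linarith
  have hsmall : A₂ * (1 / r + M) * M ^ (-(5 / 3) : ℝ) * (M * ε) ^ (2 / 3 : ℝ) ≤ 1 / 64 := by
    have e1 : M ^ (-(5 / 3) : ℝ) * M ^ (2 / 3 : ℝ) = M⁻¹ := by
      rw [← Real.rpow_add hM0, ← Real.rpow_neg_one]; norm_num
    rw [Real.mul_rpow hM0.le hε0]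
    calc _ = A₂ * ((1 / r + M) * a) * (M ^ (-(5 / 3) : ℝ) * M ^ (2 / 3 : ℝ)) := by ring
      _ = A₂ * ((1 / r + M) * a) / M := by rw [e1, ← div_eq_mul_inv]
      _ ≤ 1 / 64 := by
          rw [div_le_iff₀ hM0]
          have h2 : 0 ≤ (1 / r + M) * a := by positivity
          have h3 : 128 * A₂ ≤ N := by linarith
          have := mul_le_mul_of_nonneg_left h3 h2
          linarith
  have hbound := hf.le_of_energyBound hc hc1 hC hM0 (by linarith) (by linarith) hr0 hrs hs.2
    (by positivity) hE hstart hsmall v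
  have h1 : N * a / r ≤ 1 + N * a * t⁻¹ := by
    calc N * a / r = N * a * (1 / r) := by ring
      _ ≤ N * a * (1 + t⁻¹) := by gcongr
      _ ≤ _ := by linarith
  have h2 : 0 ≤ a * t⁻¹ := by positivity
  have h3 : 0 ≤ N * K := by positivity
  linarith
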